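/- Let ${\bf S}$ be the Suslin functional, defined for $g:\mathbb N\to\mathbb N$ by ${\bf S}(g)=0$ if $\forall h\in\mathbb N^{\mathbb N}\,\exists n\,(g(\bar h(n))=0)$ and ${\bf S}(g)=1$ otherwise, where $\bar h(n)$ is the sequence number of $\langle h(0),\ldots,h(n-1)\rangle$. Let $\omega_1^{\bf S}$ be the least ordinal that is not the order type of a well-ordering of a subset of $\mathbb N$ computable in ${\bf S}$, in the sense of Kleene's schemes S1-S9 (a well-ordering is computable in ${\bf S}$ if the characteristic function of its reflexive order relation is). Let $C=\{0,1\}^{\mathbb N}$ be the Cantor space with the completed product measure ${\bf m}$ of the uniform measures on $\{0,1\}$. For $f\in C$, identified with $\{n\in\mathbb N \mid f(n)=1\}$, let $L_\alpha[f]$ be the $\alpha$-th level of the constructible hierarchy relative to $f$: $L_0[f]=\emptyset$, $L_{\alpha+1}[f]$ is the set of all subsets of $L_\alpha[f]$ that are first-order definable with parameters over $(L_\alpha[f],\in,f)$ (with $f$ as a unary predicate), and $L_\lambda[f]=\bigcup_{\beta<\lambda}L_\beta[f]$ for limit $\lambda$. An ordinal $\alpha$ is called $f$-admissible if $(L_\alpha[f],\in,f)$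 is a model of Kripke-Platek set theory (extensionality, foundation, pairing, union, $\Delta_0$-separation and $\Delta_0$-replacement, the latter in the form of $\Delta_0$-collection, in the language with $\in$ and a unary predicate for $f$). Then the set $$\{f\in C \mid \omega_1^{\bf S}\text{ is }f\text{-admissible}\}$$ is ${\bf m}$-measurable and ${\bf m}(\{f\in C \mid \omega_1^{\bf S}\text{ is }f\text{-admissible}\})=1$. -/

import Mathlib

open MeasureTheory FirstOrder

namespace SuslinFunctional

/-! ### Computability relative to the Suslin functional -/

/-- The sequence number of `f̄(n) = ⟨f 0, …, f (n-1)⟩`. -/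
def seqBar (f : ℕ → ℕ) (n : ℕ) : ℕ := Encodable.encode ((List.range n).map f)

open Classical in
/-- The Suslin functional `S`: `S g = 0` if `∀ f, ∃ n, g (f̄(n)) = 0`,
and `S g = 1` if `∃ f, ∀ n, g (f̄(n)) > 0`. -/
noncomputable def suslin (g : ℕ → ℕ) : ℕ :=
  if ∀ f : ℕ → ℕ, ∃ n : ℕ, g (seqBar f n) = 0 then 0 else 1

/-- The index `⟨a₀, …, aₖ⟩` coded by a sequence number. -/
def idx (l : List ℕ) : ℕ := Encodable.encode l

/-- `Comp e a b` means `{e}(S, a) = b`: Kleene's schemes S1 - S6, S8, S9 for computations relative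
to the Suslin functional from a list `a` of integer arguments. There are no function arguments, so
that the scheme S7 (application of a function argument) does not occur. -/
inductive Comp : ℕ → List ℕ → ℕ → Prop
  /-- S1, successor. -/
  | succ (x : ℕ) (a : List ℕ) : Comp (idx [1]) (x :: a) (x + 1)
  /-- S2, constants. -/
  | const (q : ℕ) (a : List ℕ) : Comp (idx [2, q]) a q
  /-- S3, projection. -/
  | proj (x : ℕ) (a : List ℕ) : Comp (idx [3]) (x :: a) x
  /-- S4, composition: `{e}(a) = {e₁}({e₂}(a), a)`. -/
  | comp (e₁ e₂ : ℕ) (a : List ℕ) (c b : ℕ) :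
      Comp e₂ a c → Comp e₁ (c :: a) b → Comp (idx [4, e₁, e₂]) a b
  /-- S5, primitive recursion, at `0`: `{e}(0, a) = {e₁}(a)`. -/
  | recZero (e₁ e₂ : ℕ) (a : List ℕ) (b : ℕ) :
      Comp e₁ a b → Comp (idx [5, e₁, e₂]) (0 :: a) b
  /-- S5, primitive recursion, at `x + 1`: `{e}(x + 1, a) = {e₂}(x, {e}(x, a), a)`. -/
  | recSucc (e₁ e₂ x : ℕ) (a : List ℕ) (c b : ℕ) :
      Comp (idx [5, e₁, e₂]) (x :: a) c → Comp e₂ (x :: c :: a) b →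
        Comp (idx [5, e₁, e₂]) ((x + 1) :: a) b
  /-- S6, permutation: the argument in position `k` is moved to the front. -/
  | perm (e₁ : ℕ) (a₁ : List ℕ) (x : ℕ) (a₂ : List ℕ) (b : ℕ) :
      Comp e₁ (x :: (a₁ ++ a₂)) b → Comp (idx [6, a₁.length, e₁]) (a₁ ++ x :: a₂) b
  /-- S8, application of the Suslin functional to a total function:
  `{e}(a) = S (fun s ↦ {e₁}(s, a))`. -/
  | suslin (e₁ : ℕ) (a : List ℕ) (g : ℕ → ℕ) :
      (∀ s : ℕ, Comp e₁ (s :: a) (g s)) → Comp (idx [8, e₁]) a (suslin g)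
  /-- S9, enumeration: `{e}(d, a, a') = {d}(a)`, where `a` has length `n`. -/
  | enum (d : ℕ) (a a' : List ℕ) (b : ℕ) :
      Comp d a b → Comp (idx [9, a.length]) (d :: (a ++ a')) b

/-- The relation `R` on `ℕ` is computable in the Suslin functional: its characteristic function is
of the form `fun x y ↦ {e}(S, x, y)`. -/
def ComputableRel (R : ℕ → ℕ → Prop) : Prop :=
  ∃ e : ℕ, ∀ x y : ℕ, (R x y → Comp e [x, y] 1) ∧ (¬ R x y → Comp e [x, y] 0)

/-- `α` is an ordinal computable in the Suslin functional: it is the order type of a well-ordering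
of a subset of `ℕ` (the field `{x | R x x}` of the reflexive order `R`) that is computable in the
Suslin functional. -/
def ComputableOrdinal (α : Ordinal.{0}) : Prop :=
  ∃ R : ℕ → ℕ → Prop, ComputableRel R ∧
    ∃ _ : IsWellOrder {x : ℕ // R x x} (fun x y => R x.1 y.1 ∧ x ≠ y),
      Ordinal.type (fun x y : {x : ℕ // R x x} => R x.1 y.1 ∧ x ≠ y) = α

/-- `ω₁^S`, the least ordinal that is not computable in the Suslin functional. -/
noncomputable def omegaOneS : Ordinal.{0} := sInf {α | ¬ ComputableOrdinal α}

/-! ### The constructible hierarchy relative to `f` -/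

/-- The relation symbols of the language of set theory with a constant predicate for `f`. -/
inductive SetRel : ℕ → Type
  /-- Membership. -/
  | mem : SetRel 2
  /-- The predicate for `f`. -/
  | pred : SetRel 1

/-- The language of set theory with an additional unary predicate symbol for `f`. -/
def setLang : FirstOrder.Language.{0, 0} where
  Functions _ := Empty
  Relations := SetRel

/-- The elements of the set `X`, as the domain of a structure in which the predicate symbol is
interpreted by `f`. -/
def Carrier (_f : ℕ → Bool) (X : ZFSet.{0}) : Type 1 := {x : ZFSet.{0} // x ∈ X}

/-- The structure `(X, ∈, f)`, where `f` is identified with the set of those (von Neumann) natural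
numbers `n` for which `f n = 1`. -/
instance carrierStructure (f : ℕ → Bool) (X : ZFSet.{0}) : FirstOrder.Language.Structure setLang (Carrier f X) where
  funMap := fun e _ => Empty.elim e
  RelMap := fun R =>
    match R with
    | SetRel.mem => fun v => (v 0).1 ∈ (v 1).1
    | SetRel.pred => fun v => ∃ n : ℕ, f n = true ∧ (v 0).1 = Ordinal.toZFSet (n : Ordinal.{0})

/-- The set of all subsets of `X` that are first-order definable over `(X, ∈, f)` with parameters
from `X`. -/
noncomputable def defPow (f : ℕ → Bool) (X : ZFSet.{0}) : ZFSet.{0} :=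
  X.powerset.sep fun Y =>
    (Set.univ : Set (Carrier f X)).Definable₁ setLang {y : Carrier f X | y.1 ∈ Y}

/-- The constructible hierarchy relative to `f`: `L_α[f]` is the union of the sets
`defPow f (L_β[f])` for `β < α`. -/
noncomputable def L (f : ℕ → Bool) (α : Ordinal.{0}) : ZFSet.{0} :=
  ZFSet.iUnion fun β : Set.Iio α => defPow f (L f β.1)
termination_by α
decreasing_by exact β.2

/-! ### Admissibility -/

/-- The `Δ₀` formulas: the least class of formulas that contains the atomic formulas and is closed
under propositional connectives and bounded quantification `∀ z ∈ u`, where `u` is a variable. The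
bounded existential quantifier is obtained by negation. -/
inductive IsDelta0 {P : Type} : ∀ {n : ℕ}, setLang.BoundedFormula P n → Prop
  | falsum {n : ℕ} : IsDelta0 (Language.BoundedFormula.falsum (n := n))
  | equal {n : ℕ} (t₁ t₂ : setLang.Term (P ⊕ Fin n)) : IsDelta0 (Language.BoundedFormula.equal t₁ t₂)
  | rel {n l : ℕ} (R : setLang.Relations l) (ts : Fin l → setLang.Term (P ⊕ Fin n)) :
      IsDelta0 (Language.BoundedFormula.rel R ts)
  | imp {n : ℕ} {φ ψ : setLang.BoundedFormula P n} :
      IsDelta0 φ → IsDelta0 ψ → IsDelta0 (Language.BoundedFormula.imp φ ψ)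
  | ball {n : ℕ} (u : P ⊕ Fin n) {φ : setLang.BoundedFormula P (n + 1)} :
      IsDelta0 φ →
        IsDelta0 (Language.BoundedFormula.all (Language.BoundedFormula.imp
          (Language.BoundedFormula.rel (l := 2) SetRel.mem
            ![Language.Term.var (Sum.inr (Fin.last n)), Language.Term.var (Sum.map id Fin.castSucc u)])
          φ))

/-- The structure `(X, ∈, f)` is a model of Kripke-Platek set theory, in the language with a
predicate for `f`. In the schemes, `p` is an assignment of parameters to the free variables. -/
structure IsModelKP (f : ℕ → Bool) (X : ZFSet.{0}) : Prop where
  nonempty : Nonempty (Carrier f X)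
  extensionality : ∀ a b : Carrier f X,
    (∀ x : Carrier f X, x.1 ∈ a.1 ↔ x.1 ∈ b.1) → a = b
  foundation : ∀ (φ : setLang.BoundedFormula ℕ 1) (p : ℕ → Carrier f X),
    (∃ x, φ.Realize p ![x]) →
      ∃ x, φ.Realize p ![x] ∧ ∀ y : Carrier f X, y.1 ∈ x.1 → ¬ φ.Realize p ![y]
  pairing : ∀ a b : Carrier f X, ∃ c : Carrier f X, a.1 ∈ c.1 ∧ b.1 ∈ c.1
  union : ∀ a : Carrier f X, ∃ c : Carrier f X,
    ∀ b : Carrier f X, b.1 ∈ a.1 → ∀ x : Carrier f X, x.1 ∈ b.1 → x.1 ∈ c.1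
  delta0_separation : ∀ φ : setLang.BoundedFormula ℕ 1, IsDelta0 φ →
    ∀ (p : ℕ → Carrier f X) (a : Carrier f X), ∃ b : Carrier f X,
      ∀ x : Carrier f X, x.1 ∈ b.1 ↔ x.1 ∈ a.1 ∧ φ.Realize p ![x]
  delta0_replacement : ∀ φ : setLang.BoundedFormula ℕ 2, IsDelta0 φ →
    ∀ (p : ℕ → Carrier f X) (a : Carrier f X),
      (∀ x : Carrier f X, x.1 ∈ a.1 → ∃ y : Carrier f X, φ.Realize p ![x, y]) →
        ∃ b : Carrier f X, ∀ x : Carrier f X, x.1 ∈ a.1 →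
          ∃ y : Carrier f X, y.1 ∈ b.1 ∧ φ.Realize p ![x, y]

/-- The ordinal `α` is `f`-admissible: `L_α[f]` is a model of Kripke-Platek set theory. -/
def IsAdmissible (f : ℕ → Bool) (α : Ordinal.{0}) : Prop := IsModelKP f (L f α)

/-- The product measure on the Cantor space `{0, 1}^ℕ` of the uniform measures on `{0, 1}`. -/
noncomputable def cantorMeasure : Measure (ℕ → Bool) :=
  Measure.infinitePi fun _ : ℕ => (PMF.uniformOfFintype Bool).toMeasure

end SuslinFunctional

/-!
For every `f`, the level `ω₁^S` of the hierarchy relative to `f` satisfies extensionality,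
foundation, pairing, union and `Δ₀` separation (`isAdmissible_of_hasBounds`). What is at stake is
`Δ₀` collection, and there are only countably many instances of it once the parameters have names
that do not depend on `f`. So it is enough that each instance holds for almost every `f`.

Computability. The ordinal `ω₁^S` is the supremum of the lengths of the convergent computations in
`S` (`omegaOneS_eq`). One inclusion is recursion along a computable well-ordering; the other one is
the stage comparison theorem `decOn_stageLE`: of two computations, one of which converges, `S` can
decide which one is shorter. Stage comparison gives Gandy selection, which is used as a boundedness
principle (`exists_bound`): if for every `n` there is a convergent computation with a property that
`S` decides on convergent computations, then there are such computations of bounded length.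

Names. A convergent computation `x` of length `α` names the level `L_α[f]`, uniformly in `f`, and an
element of `L_{α+1}[f]` is named by `x`, a formula and finitely many names of parameters from
`L_α[f]` (`mem_L_lvl_iff`). Membership and equality of the named sets and satisfaction of formulas
in the levels become infinitary propositional formulas in the atoms `f n`, built from countable
conjunctions. The formulas about names with labels below a given ordinal are well-founded, so that
truth is a valid valuation (`truth_isValid`) and all valid valuations agree there
(`IsValid.kNAll_iff`). To be a valid valuation is a closed condition once witnesses for the
existential clauses are added. For each statement about names the set of all `f` that satisfy it is
therefore analytic, and also co-analytic, uniformly in a computation that bounds the labels.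

Measure. Let `A` be an analytic set, the projection of the branches of a tree. If `A` has measure
greater than `r`, then there is a bound for the entries of the witnesses such that all finite
approximations to the bounded part of `A` have measure at least `r` (`exists_bound_of_lt`). By
compactness the existence of such a bound implies that `A` has measure at least `r`
(`le_measure_of_bound`). For rational `r` it is one existential quantifier over functions applied to
a decidable matrix, which is what the Suslin functional evaluates. Thus `S` decides whether the
measure is less than or greater than `r`, with an arbitrary answer in the case of equality
(`exists_decOn_measure`).

Collection. Let `B` be the set of all `f` for which each element of a fixed level satisfies an
upward absolute formula in some level below `ω₁^S`, and let `r` be a rational number less than the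
measure of `B`. For every `N`, the first `N` names of elements are treated by a single level for all
`f` in a set of measure greater than `r`, and whether a level has this property is decided by `S` in
the sense above. By boundedness one level does so for all `N`, with measure at least `r`, and by
continuity of the measure it treats all names simultaneously for a set of `f` of measure at least
`r`. As `r` is arbitrary, almost all `f` in `B` have a bound below `ω₁^S` (`ae_exists_bound`).
-/

namespace SuslinFunctional

/-! ### Programs for the schemes S1 - S9 -/

/-- The schemes ignore additional arguments at the end of the argument list. -/
theorem Comp.append {e : ℕ} {a : List ℕ} {b : ℕ} (h : Comp e a b) (r : List ℕ) :
    Comp e (a ++ r) b := by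
  induction h with
  | succ x a => exact Comp.succ x _
  | const q a => exact Comp.const q _
  | proj x a => exact Comp.proj x _
  | comp e₁ e₂ a c b _ _ h₂ h₁ => exact Comp.comp e₁ e₂ _ c b h₂ h₁
  | recZero e₁ e₂ a b _ h => exact Comp.recZero e₁ e₂ _ b h
  | recSucc e₁ e₂ x a c b _ _ h h₂ => exact Comp.recSucc e₁ e₂ x _ c b h h₂
  | perm e₁ a₁ x a₂ b _ h =>
    have := Comp.perm e₁ a₁ x (a₂ ++ r) b (by simpa using h)
    simpa using this
  | suslin e₁ a g _ h => exact Comp.suslin e₁ _ g h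
  | enum d a a' b h _ =>
    have := Comp.enum d a (a' ++ r) b h
    simpa using this

/-- The index of the program that runs `e` after moving the `m` arguments behind the first `k`
arguments to the front. -/
def rotIdx : ℕ → ℕ → ℕ → ℕ
  | _, 0, e => e
  | k, m + 1, e => idx [6, k + m, rotIdx (k + 1) m e]

theorem comp_rotIdx {e b : ℕ} (a : List ℕ) : ∀ c : List ℕ, Comp e (a ++ c) b →
    Comp (rotIdx c.length a.length e) (c ++ a) b := by
  induction a using List.reverseRecOn with
  | nil => intro c h; simpa [rotIdx] using h
  | append_singleton a x ih =>
    intro c h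
    have h1 := ih (x :: c) (by simpa using h)
    have h2 := Comp.perm _ (c ++ a) x [] b (by simpa using h1)
    simpa [rotIdx] using h2

/-- The index of the program that pushes the values of the programs in a list on the argument list
(of original length `m`, with `k` values in front of it already), and then runs `e`. -/
def pushIdx (m e : ℕ) : ℕ → List ℕ → ℕ
  | _, [] => e
  | k, r :: l => idx [4, pushIdx m e (k + 1) l, rotIdx k m r]

theorem comp_pushIdx {e b : ℕ} {a : List ℕ} {l v : List ℕ}
    (h : List.Forall₂ (fun r c => Comp r a c) l v) :
    ∀ c : List ℕ, Comp e (v.reverse ++ c ++ a) b →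
      Comp (pushIdx a.length e c.length l) (c ++ a) b := by
  induction h with
  | nil => intro c hb; simpa [pushIdx] using hb
  | @cons r x l v hr _ ih =>
    intro c hb
    exact Comp.comp _ _ _ x b (comp_rotIdx a c (hr.append c)) (ih (x :: c) (by simpa using hb))

/-- The schemes S1 - S6 yield all primitive recursive functions. -/
theorem exists_index_of_primrec' {n : ℕ} {f : List.Vector ℕ n → ℕ} (hf : Nat.Primrec' f) :
    ∃ e, ∀ v : List.Vector ℕ n, Comp e v.toList (f v) := by
  induction hf with
  | zero => exact ⟨_, fun v => Comp.const 0 _⟩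
  | succ =>
    refine ⟨idx [1], fun v => ?_⟩
    obtain ⟨x, w, rfl⟩ : ∃ x w, v = x ::ᵥ w := ⟨v.head, v.tail, v.cons_head_tail.symm⟩
    exact Comp.succ x w.toList
  | @get n i =>
    refine ⟨idx [6, i, idx [3] ], fun v => ?_⟩
    have hi : (i : ℕ) < v.toList.length := by simp
    have h1 := Comp.perm (idx [3]) (v.toList.take i) (v.get i) (v.toList.drop (i + 1)) (v.get i)
      (Comp.proj _ _)
    have h2 : v.toList.take i ++ v.get i :: v.toList.drop (i + 1) = v.toList := by
      rw [List.Vector.get_eq_get_toList]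
      simp
    rw [h2, List.length_take, min_eq_left hi.le] at h1
    exact h1
  | @comp m n f g _ _ hf hg =>
    obtain ⟨ef, hf⟩ := hf
    choose eg hg using hg
    refine ⟨pushIdx m ef 0 (List.ofFn eg).reverse, fun v => ?_⟩
    have h1 : List.Forall₂ (fun r c => Comp r v.toList c) (List.ofFn eg).reverse
        (List.ofFn fun i => g i v).reverse := by
      rw [List.forall₂_reverse_iff, List.forall₂_iff_get]
      refine ⟨by simp, fun i h h' => ?_⟩
      simpa using hg _ v
    have h2 := hf (List.Vector.ofFn fun i => g i v)
    rw [List.Vector.toList_ofFn] at h2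
    have := comp_pushIdx (e := ef) (b := f (List.Vector.ofFn fun i => g i v)) h1 []
      (by simpa using h2.append v.toList)
    simpa using this
  | @prec n f g _ _ hf hg =>
    obtain ⟨ef, hf⟩ := hf
    obtain ⟨eg, hg⟩ := hg
    refine ⟨idx [5, ef, eg], fun v => ?_⟩
    obtain ⟨x, w, rfl⟩ : ∃ x w, v = x ::ᵥ w := ⟨v.head, v.tail, v.cons_head_tail.symm⟩
    simp only [List.Vector.toList_cons, List.Vector.head_cons, List.Vector.tail_cons]
    induction x with
    | zero => exact Comp.recZero _ _ _ _ (hf w)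
    | succ x ih =>
      refine Comp.recSucc _ _ _ _ _ _ ih ?_
      simpa using hg (x ::ᵥ _ ::ᵥ w)

theorem exists_index_of_primrec {f : ℕ → ℕ} (hf : Primrec f) :
    ∃ e, ∀ x r, Comp e (x :: r) (f x) := by
  obtain ⟨e, he⟩ := exists_index_of_primrec' (Nat.Primrec'.prim_iff₁.2 hf)
  exact ⟨e, fun x r => by simpa using (he (x ::ᵥ List.Vector.nil)).append r⟩

theorem exists_index_of_primrec₂ {f : ℕ → ℕ → ℕ} (hf : Primrec₂ f) :
    ∃ e, ∀ x y r, Comp e (x :: y :: r) (f x y) := by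
  obtain ⟨e, he⟩ := exists_index_of_primrec' (Nat.Primrec'.prim_iff₂.2 hf)
  exact ⟨e, fun x y r => by simpa using (he (x ::ᵥ y ::ᵥ List.Vector.nil)).append r⟩

theorem exists_index_of_primrec₃ {f : ℕ × ℕ × ℕ → ℕ} (hf : Primrec f) :
    ∃ e, ∀ x y z r, Comp e (x :: y :: z :: r) (f (x, y, z)) := by
  have hf' : Primrec fun v : List.Vector ℕ 3 => f (v.get 0, v.get 1, v.get 2) :=
    hf.comp ((Primrec.vector_get.comp .id (.const 0)).pair
      ((Primrec.vector_get.comp .id (.const 1)).pair (Primrec.vector_get.comp .id (.const 2))))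
  obtain ⟨e, he⟩ := exists_index_of_primrec' (Nat.Primrec'.prim_iff.2 hf')
  refine ⟨e, fun x y z r => ?_⟩
  have := (he (x ::ᵥ y ::ᵥ z ::ᵥ List.Vector.nil)).append r
  exact this

/-- Kleene's recursion theorem. The second argument `y` of `h` is a by-product of the diagonal
construction; its shape is recorded for the analysis of subcomputations. -/
theorem exists_fixedPoint (h : ℕ) : ∃ e y d : ℕ, e = idx [4, y, idx [2, y] ] ∧ y = idx [4, h, d] ∧
    ∀ a, Comp d (y :: a) e := by
  have hp : Primrec fun y : ℕ => idx [4, y, idx [2, y] ] := by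
    refine Primrec.encode.comp (Primrec.list_cons.comp (.const 4) (Primrec.list_cons.comp .id
      (Primrec.list_cons.comp (Primrec.encode.comp (Primrec.list_cons.comp (.const 2)
        (Primrec.list_cons.comp .id (.const [])))) (.const []))))
  obtain ⟨d, hd⟩ := exists_index_of_primrec hp
  exact ⟨_, _, d, rfl, rfl, fun a => hd _ a⟩

/-! ### Functions and relations computable in the Suslin functional on a domain -/

section Computable

open Encodable Classical

variable {α β γ : Type} [Primcodable α] [Primcodable β] [Primcodable γ]

/-- The function `F` is, on the domain `D`, the restriction of a partial function computable in the
Suslin functional. -/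
def CompOn (D : α → Prop) (F : α → ℕ) : Prop :=
  ∃ e, ∀ a, D a → Comp e [encode a] (F a)

/-- The relation `P` is decidable in the Suslin functional on the domain `D`. -/
def DecOn (D P : α → Prop) : Prop :=
  CompOn D fun a => if P a then 1 else 0

theorem CompOn.mono {D D' : α → Prop} {F F' : α → ℕ} (h : CompOn D F) (hD : ∀ a, D' a → D a)
    (hF : ∀ a, D' a → F a = F' a) : CompOn D' F' := by
  obtain ⟨e, he⟩ := h
  exact ⟨e, fun a ha => hF a ha ▸ he a (hD a ha)⟩

theorem CompOn.of_primrec {D : α → Prop} {F : α → ℕ} (h : Primrec F) : CompOn D F := by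
  have h1 : Primrec fun n : ℕ => ((decode (α := α) n).map F).getD 0 :=
    Primrec.option_getD.comp (Primrec.option_map Primrec.decode (h.comp .snd).to₂) (.const 0)
  obtain ⟨e, he⟩ := exists_index_of_primrec h1
  exact ⟨e, fun a _ => by simpa using he (encode a) []⟩

theorem CompOn.comp {D : β → Prop} {F : β → ℕ} {g : α → β} (h : CompOn D F) (hg : Primrec g) :
    CompOn (fun a => D (g a)) (fun a => F (g a)) := by
  obtain ⟨e, he⟩ := h
  obtain ⟨d, hd⟩ := CompOn.of_primrec (D := fun _ => True) (Primrec.encode.comp hg)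
  exact ⟨idx [4, e, d], fun a ha =>
    Comp.comp _ _ _ _ _ (hd a trivial) ((he _ ha).append [encode a])⟩

/-- Substitution of a partial function. -/
theorem CompOn.subst {D : α → Prop} {F : α → ℕ} {D' : α × ℕ → Prop} {G : α × ℕ → ℕ}
    (hF : CompOn D F) (hG : CompOn D' G) :
    CompOn (fun a => D a ∧ D' (a, F a)) (fun a => G (a, F a)) := by
  obtain ⟨e, he⟩ := hF
  obtain ⟨d, hd⟩ := hG
  obtain ⟨p, hp⟩ := exists_index_of_primrec₂ (f := fun c x => Nat.pair x c)
    (Primrec₂.natPair.comp Primrec.snd Primrec.fst)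
  refine ⟨idx [4, idx [4, d, p], e], fun a ha => ?_⟩
  refine Comp.comp _ _ _ _ _ (he a ha.1) (Comp.comp _ _ _ _ _ (hp _ _ _) ?_)
  exact (hd _ ha.2).append _

/-- Definition by cases, in which only the value for the case that applies is computed. -/
theorem CompOn.ite {D P : α → Prop} {F G : α → ℕ} (hP : DecOn D P)
    (hF : CompOn (fun a => D a ∧ P a) F) (hG : CompOn (fun a => D a ∧ ¬ P a) G) :
    CompOn D fun a => if P a then F a else G a := by
  obtain ⟨e, he⟩ := hP
  obtain ⟨f, hf⟩ := hF
  obtain ⟨g, hg⟩ := hG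
  have h1 : Primrec fun c : ℕ => if c = 1 then f else g :=
    Primrec.ite (Primrec.eq.comp .id (.const 1)) (.const f) (.const g)
  obtain ⟨s, hs⟩ := exists_index_of_primrec h1
  -- select the index `f` or `g` by the value of `e`, and run it by S9
  refine ⟨idx [4, idx [4, idx [6, 2, idx [6, 1, idx [9, 1] ] ], s], e], fun a ha => ?_⟩
  refine Comp.comp _ _ _ _ _ (he a ha) (Comp.comp _ _ _ _ _ (hs _ _) ?_)
  refine Comp.perm _ [_, _] _ [] _ (Comp.perm _ [_] _ [_] _ (Comp.enum _ [_] [_] _ ?_))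
  by_cases hPa : P a
  · simpa [hPa] using hf a ⟨ha, hPa⟩
  · simpa [hPa] using hg a ⟨ha, hPa⟩

theorem DecOn.mono {D D' P P' : α → Prop} (h : DecOn D P) (hD : ∀ a, D' a → D a)
    (hP : ∀ a, D' a → (P a ↔ P' a)) : DecOn D' P' :=
  CompOn.mono h hD fun a ha => by simp [hP a ha]

theorem DecOn.comp {D P : β → Prop} {g : α → β} (h : DecOn D P) (hg : Primrec g) :
    DecOn (fun a => D (g a)) (fun a => P (g a)) :=
  CompOn.comp h hg

theorem DecOn.of_primrecPred {D P : α → Prop} (h : PrimrecPred P) : DecOn D P :=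
  (CompOn.of_primrec (Primrec.ite h (.const 1) (.const 0))).mono (fun _ => id) fun _ _ => rfl

theorem DecOn.ite {D P Q R : α → Prop} (hP : DecOn D P) (hQ : DecOn (fun a => D a ∧ P a) Q)
    (hR : DecOn (fun a => D a ∧ ¬ P a) R) :
    DecOn D fun a => if P a then Q a else R a :=
  (CompOn.ite hP hQ hR).mono (fun _ => id) fun a _ => by by_cases h : P a <;> simp [h]

theorem DecOn.const {D : α → Prop} (p : Prop) : DecOn D fun _ => p :=
  CompOn.of_primrec (.const _)

theorem DecOn.and {D P Q : α → Prop} (hP : DecOn D P) (hQ : DecOn (fun a => D a ∧ P a) Q) :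
    DecOn D fun a => P a ∧ Q a :=
  (hP.ite hQ (DecOn.const False)).mono (fun _ => id) fun a _ => by by_cases h : P a <;> simp [h]

theorem DecOn.or {D P Q : α → Prop} (hP : DecOn D P) (hQ : DecOn (fun a => D a ∧ ¬ P a) Q) :
    DecOn D fun a => P a ∨ Q a :=
  (hP.ite (DecOn.const True) hQ).mono (fun _ => id) fun a _ => by by_cases h : P a <;> simp [h]

theorem DecOn.imp {D P Q : α → Prop} (hP : DecOn D P) (hQ : DecOn (fun a => D a ∧ P a) Q) :
    DecOn D fun a => P a → Q a :=
  (hP.ite hQ (DecOn.const True)).mono (fun _ => id) fun a _ => by by_cases h : P a <;> simp [h]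

theorem DecOn.not {D P : α → Prop} (hP : DecOn D P) : DecOn D fun a => ¬ P a :=
  (hP.imp (DecOn.const False)).mono (fun _ => id) fun _ _ => Iff.rfl

theorem DecOn.iff {D P Q : α → Prop} (hP : DecOn D P) (hQ : DecOn D Q) :
    DecOn D fun a => P a ↔ Q a :=
  (hP.ite (hQ.mono (fun _ h => h.1) fun _ _ => Iff.rfl)
    (hQ.not.mono (fun _ h => h.1) fun _ _ => Iff.rfl)).mono (fun _ => id)
    fun a _ => by by_cases h : P a <;> simp [h]

theorem DecOn.subst {D : α → Prop} {F : α → ℕ} {D' P : α × ℕ → Prop}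
    (hF : CompOn D F) (hP : DecOn D' P) :
    DecOn (fun a => D a ∧ D' (a, F a)) (fun a => P (a, F a)) :=
  CompOn.subst hF hP

/-- The quantifier `∃ h : ℕ → ℕ, ∀ n, P (h̄(n))` is what the Suslin functional decides. -/
theorem DecOn.exists_fun {D P : α × List ℕ → Prop} (h : DecOn D P) :
    DecOn (fun a => ∀ l, D (a, l))
      (fun a => ∃ h : ℕ → ℕ, ∀ n, P (a, (List.range n).map h)) := by
  obtain ⟨e, he⟩ := h
  obtain ⟨p, hp⟩ := exists_index_of_primrec₂ (f := fun s x => Nat.pair x s)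
    (Primrec₂.natPair.comp Primrec.snd Primrec.fst)
  refine ⟨idx [8, idx [4, e, p] ], fun a ha => ?_⟩
  have h1 := Comp.suslin (idx [4, e, p]) [encode a]
    (fun s => if P (a, Denumerable.ofNat (List ℕ) s) then 1 else 0) fun s =>
      Comp.comp _ _ _ _ _ (hp s (encode a) []) (by
        have := (he (a, Denumerable.ofNat (List ℕ) s) (ha _)).append [s, encode a]
        rwa [Encodable.encode_prod_val, Denumerable.encode_ofNat] at this)
  convert h1 using 1
  simp only [SuslinFunctional.suslin, seqBar, Denumerable.ofNat_encode]
  by_cases hx : ∃ h : ℕ → ℕ, ∀ n, P (a, (List.range n).map h)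
  · rw [if_pos hx, if_neg]
    push Not
    obtain ⟨h, hh⟩ := hx
    exact ⟨h, fun n => by simp [hh n]⟩
  · rw [if_neg hx, if_pos]
    push Not at hx
    intro f
    obtain ⟨n, hn⟩ := hx f
    exact ⟨n, by simp [hn]⟩

end Computable

section Quantifiers

open Encodable

variable {α β : Type} [Primcodable α] [Denumerable β]

/-- A number quantifier is a function quantifier in which only the first value matters. -/
theorem DecOn.exists {D P : α × β → Prop} (h : DecOn D P) :
    DecOn (fun a => ∀ b, D (a, b)) (fun a => ∃ b, P (a, b)) := by
  have hg : Primrec fun q : α × List ℕ => (q.1, Denumerable.ofNat β q.2.headI) :=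
    Primrec.fst.pair ((Primrec.ofNat β).comp (Primrec.list_headI.comp .snd))
  have h1 : DecOn (fun q : α × List ℕ => ∀ b, D (q.1, b))
      (fun q => q.2.length = 0 ∨ P (q.1, Denumerable.ofNat β q.2.headI)) :=
    (DecOn.of_primrecPred (Primrec.eq.comp (Primrec.list_length.comp .snd) (.const 0))).or
      ((h.comp hg).mono (fun q hq => hq.1 _) fun _ _ => Iff.rfl)
  refine h1.exists_fun.mono (fun a ha _ => ha) fun a _ => ⟨?_, ?_⟩
  · rintro ⟨f, hf⟩
    exact ⟨_, (hf 1).resolve_left (by simp)⟩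
  · rintro ⟨b, hb⟩
    refine ⟨fun _ => encode b, fun n => ?_⟩
    rcases n with _ | n
    · simp
    · right
      simpa [List.range_succ_eq_map, List.headI] using hb

theorem DecOn.forall {D P : α × β → Prop} (h : DecOn D P) :
    DecOn (fun a => ∀ b, D (a, b)) (fun a => ∀ b, P (a, b)) :=
  h.not.exists.not.mono (fun _ => id) fun a _ => by simp

end Quantifiers

/-! ### The universal function -/

open Classical in
/-- The value of `{e}(S, a)`, with the junk value `0` for divergent computations. -/
noncomputable def val (e : ℕ) (a : List ℕ) : ℕ :=
  if h : ∃ b, Comp e a b then h.choose else 0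

/-- An index of the program without arguments that runs `e` on the arguments `a`. -/
def specIdx (e : ℕ) (a : List ℕ) : ℕ :=
  a.foldl (fun d q => idx [4, d, idx [2, q] ]) e

theorem primrec_specIdx : Primrec fun x : ℕ × List ℕ => specIdx x.1 x.2 := by
  have h1 : Primrec fun q : (ℕ × List ℕ) × ℕ × ℕ => q.2.1 := Primrec.fst.comp .snd
  have h2 : Primrec fun q : (ℕ × List ℕ) × ℕ × ℕ => q.2.2 := Primrec.snd.comp .snd
  have h3 : Primrec fun q : (ℕ × List ℕ) × ℕ × ℕ => idx [4, q.2.1, idx [2, q.2.2] ] :=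
    Primrec.encode.comp (Primrec.list_cons.comp (.const 4) (Primrec.list_cons.comp h1
      (Primrec.list_cons.comp (Primrec.encode.comp (Primrec.list_cons.comp (.const 2)
        (Primrec.list_cons.comp h2 (.const [])))) (.const []))))
  exact Primrec.list_foldl .snd .fst h3.to₂

theorem comp_specIdx {e b : ℕ} (a r : List ℕ) (h : Comp e (a ++ r) b) : Comp (specIdx e a) r b := by
  induction a generalizing e with
  | nil => simpa [specIdx] using h
  | cons q a ih => exact ih (Comp.comp _ _ _ _ _ (Comp.const q _) h)

/-! ### Subcomputations -/

open Encodable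

/-- A computation `{e}(S, a)`, given by its index `e` and its arguments `a`. -/
abbrev Node : Type := ℕ × List ℕ

/-- The computations that succeed by one of the schemes S1 - S3. -/
inductive IsLeaf : Node → Prop
  | succ (x : ℕ) (a : List ℕ) : IsLeaf (idx [1], x :: a)
  | const (q : ℕ) (a : List ℕ) : IsLeaf (idx [2, q], a)
  | proj (x : ℕ) (a : List ℕ) : IsLeaf (idx [3], x :: a)

/-- The computations to which one of the schemes S4 - S9 applies. -/
inductive IsBranch : Node → Prop
  | comp (e₁ e₂ : ℕ) (a : List ℕ) : IsBranch (idx [4, e₁, e₂], a)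
  | prec (e₁ e₂ x : ℕ) (a : List ℕ) : IsBranch (idx [5, e₁, e₂], x :: a)
  | perm (e₁ : ℕ) (a₁ : List ℕ) (x : ℕ) (a₂ : List ℕ) :
      IsBranch (idx [6, a₁.length, e₁], a₁ ++ x :: a₂)
  | suslin (e₁ : ℕ) (a : List ℕ) : IsBranch (idx [8, e₁], a)
  | enum (d : ℕ) (a a' : List ℕ) : IsBranch (idx [9, a.length], d :: (a ++ a'))

/-- The list coded by the index of a computation. -/
def Node.ix (x : Node) : List ℕ := Denumerable.ofNat (List ℕ) x.1

@[simp] theorem Node.ix_mk (l a : List ℕ) : Node.ix (idx l, a) = l :=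
  Denumerable.ofNat_encode l

theorem Node.eq_idx (x : Node) {l : List ℕ} (h : x.ix = l) : x = (idx l, x.2) := by
  ext1
  · rw [← h]; exact (Denumerable.encode_ofNat (α := List ℕ) x.1).symm
  · rfl

/-- A convergent computation, used where a scheme has no subcomputation of some kind. -/
def trivNode : Node := (idx [2, 0], [])

/-- The family of the immediate subcomputations that are determined by the computation alone. -/
def famChild (x : Node) (s : ℕ) : Node :=
  if x.ix.getD 0 0 = 4 then (x.ix.getD 2 0, x.2)
  else if x.ix.getD 0 0 = 5 then
    if x.2.headI = 0 then trivNode else (x.1, (x.2.headI - 1) :: x.2.tail)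
  else if x.ix.getD 0 0 = 8 then (x.ix.getD 1 0, s :: x.2)
  else trivNode

/-- The immediate subcomputation that may depend on the value `c` of the first one. -/
def lastChild (x : Node) (c : ℕ) : Node :=
  if x.ix.getD 0 0 = 4 then (x.ix.getD 1 0, c :: x.2)
  else if x.ix.getD 0 0 = 5 then
    if x.2.headI = 0 then (x.ix.getD 1 0, x.2.tail)
    else (x.ix.getD 2 0, (x.2.headI - 1) :: c :: x.2.tail)
  else if x.ix.getD 0 0 = 6 then
    (x.ix.getD 2 0, x.2.getD (x.ix.getD 1 0) 0 ::
      (x.2.take (x.ix.getD 1 0) ++ x.2.drop (x.ix.getD 1 0 + 1)))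
  else if x.ix.getD 0 0 = 9 then (x.2.headI, x.2.tail.take (x.ix.getD 1 0))
  else trivNode

section Primrec

theorem primrec_ix : Primrec Node.ix := (Primrec.ofNat (List ℕ)).comp .fst

theorem primrec_ix_getD (n : ℕ) : Primrec fun x : Node => x.ix.getD n 0 :=
  (Primrec.list_getD 0).comp primrec_ix (.const n)

theorem primrecPred_op (n : ℕ) : PrimrecPred fun x : Node => x.ix.getD 0 0 = n :=
  Primrec.eq.comp (primrec_ix_getD 0) (.const n)

theorem primrec_famChild : Primrec fun q : Node × ℕ => famChild q.1 q.2 := by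
  have hop (n : ℕ) : PrimrecPred fun q : Node × ℕ => q.1.ix.getD 0 0 = n :=
    (primrecPred_op n).comp .fst
  have hi (n : ℕ) : Primrec fun q : Node × ℕ => q.1.ix.getD n 0 := (primrec_ix_getD n).comp .fst
  have ha : Primrec fun q : Node × ℕ => q.1.2 := Primrec.snd.comp .fst
  have hh : Primrec fun q : Node × ℕ => q.1.2.headI := Primrec.list_headI.comp ha
  refine Primrec.ite (hop 4) ((hi 2).pair ha) (Primrec.ite (hop 5) (Primrec.ite
    (Primrec.eq.comp hh (.const 0)) (.const _) ((Primrec.fst.comp .fst).pair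
      (Primrec.list_cons.comp (Primrec.nat_sub.comp hh (.const 1)) (Primrec.list_tail.comp ha))))
    (Primrec.ite (hop 8) ((hi 1).pair (Primrec.list_cons.comp .snd ha)) (.const _)))

theorem primrec_lastChild : Primrec fun q : Node × ℕ => lastChild q.1 q.2 := by
  have hop (n : ℕ) : PrimrecPred fun q : Node × ℕ => q.1.ix.getD 0 0 = n :=
    (primrecPred_op n).comp .fst
  have hi (n : ℕ) : Primrec fun q : Node × ℕ => q.1.ix.getD n 0 := (primrec_ix_getD n).comp .fst
  have ha : Primrec fun q : Node × ℕ => q.1.2 := Primrec.snd.comp .fst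
  have hh : Primrec fun q : Node × ℕ => q.1.2.headI := Primrec.list_headI.comp ha
  have ht : Primrec fun q : Node × ℕ => q.1.2.tail := Primrec.list_tail.comp ha
  refine Primrec.ite (hop 4) ((hi 1).pair (Primrec.list_cons.comp .snd ha))
    (Primrec.ite (hop 5) (Primrec.ite (Primrec.eq.comp hh (.const 0)) ((hi 1).pair ht)
      ((hi 2).pair (Primrec.list_cons.comp (Primrec.nat_sub.comp hh (.const 1))
        (Primrec.list_cons.comp .snd ht))))
    (Primrec.ite (hop 6) ((hi 2).pair (Primrec.list_cons.comp
      ((Primrec.list_getD 0).comp ha (hi 1)) (Primrec.list_append.comp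
        (Primrec.list_take.comp (hi 1) ha)
        (Primrec.list_drop.comp (Primrec.succ.comp (hi 1)) ha))))
    (Primrec.ite (hop 9) (hh.pair (Primrec.list_take.comp (hi 1) ht)) (.const _))))

/-- The shape of a computation can be read off from the lengths and first entries of the lists. -/
theorem isLeaf_iff (x : Node) : IsLeaf x ↔
    (x.ix.length = 2 ∧ x.ix.getD 0 0 = 2) ∨
      ((x.ix.length = 1 ∧ (x.ix.getD 0 0 = 1 ∨ x.ix.getD 0 0 = 3)) ∧ 0 < x.2.length) := by
  constructor
  · rintro (_ | _ | _) <;> simp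
  · rintro (⟨h, h'⟩ | ⟨⟨h, h'⟩, h''⟩)
    · obtain ⟨p, q, hl⟩ := List.length_eq_two.1 h
      obtain rfl : p = 2 := by simpa [hl] using h'
      rw [x.eq_idx hl]
      exact IsLeaf.const _ _
    · obtain ⟨p, hl⟩ := List.length_eq_one_iff.1 h
      obtain ⟨y, a, ha⟩ := List.exists_cons_of_length_pos h''
      rw [x.eq_idx hl, ha]
      rcases h' with h' | h'
      · obtain rfl : p = 1 := by simpa [hl] using h'
        exact IsLeaf.succ _ _
      · obtain rfl : p = 3 := by simpa [hl] using h'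
        exact IsLeaf.proj _ _

theorem isBranch_iff (x : Node) : IsBranch x ↔
    (x.ix.length = 3 ∧ (x.ix.getD 0 0 = 4 ∨ (x.ix.getD 0 0 = 5 ∧ 0 < x.2.length) ∨
      (x.ix.getD 0 0 = 6 ∧ x.ix.getD 1 0 < x.2.length))) ∨
    (x.ix.length = 2 ∧ (x.ix.getD 0 0 = 8 ∨
      (x.ix.getD 0 0 = 9 ∧ x.ix.getD 1 0 < x.2.length))) := by
  constructor
  · rintro (_ | _ | _ | _ | _) <;> simp
  · rintro (⟨h, h'⟩ | ⟨h, h'⟩)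
    · obtain ⟨p, q, r, hl⟩ := List.length_eq_three.1 h
      rw [x.eq_idx hl]
      rw [hl] at h'
      simp only [List.getD_cons_zero, List.getD_cons_succ] at h'
      rcases h' with rfl | ⟨rfl, h'⟩ | ⟨rfl, h'⟩
      · exact IsBranch.comp _ _ _
      · obtain ⟨y, a, ha⟩ := List.exists_cons_of_length_pos h'
        rw [ha]
        exact IsBranch.prec _ _ _ _
      · have h1 := IsBranch.perm r (x.2.take q) x.2[q] (x.2.drop (q + 1))
        simp only [List.length_take, min_eq_left h'.le] at h1
        simpa using h1
    · obtain ⟨p, q, hl⟩ := List.length_eq_two.1 h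
      rw [x.eq_idx hl]
      rw [hl] at h'
      simp only [List.getD_cons_zero, List.getD_cons_succ] at h'
      rcases h' with rfl | ⟨rfl, h'⟩
      · exact IsBranch.suslin _ _
      · obtain ⟨y, a, ha⟩ := List.exists_cons_of_length_pos (Nat.zero_lt_of_lt h')
        rw [ha] at h' ⊢
        have h2 : q ≤ a.length := by simpa [Nat.lt_succ_iff] using h'
        have h1 := IsBranch.enum y (a.take q) (a.drop q)
        simpa [min_eq_left h2] using h1

theorem primrecPred_isLeaf : PrimrecPred IsLeaf := by
  have hl : Primrec fun x : Node => x.ix.length := Primrec.list_length.comp primrec_ix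
  have ha : PrimrecPred fun x : Node => 0 < x.2.length :=
    Primrec.nat_lt.comp (.const 0) (Primrec.list_length.comp .snd)
  exact (((Primrec.eq.comp hl (.const 2)).and (primrecPred_op 2)).or
    (((Primrec.eq.comp hl (.const 1)).and ((primrecPred_op 1).or (primrecPred_op 3))).and ha)).of_eq
    fun x => (isLeaf_iff x).symm

theorem primrecPred_isBranch : PrimrecPred IsBranch := by
  have hl : Primrec fun x : Node => x.ix.length := Primrec.list_length.comp primrec_ix
  have hn : Primrec fun x : Node => x.2.length := Primrec.list_length.comp .snd
  have ha : PrimrecPred fun x : Node => 0 < x.2.length := Primrec.nat_lt.comp (.const 0) hn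
  have hb : PrimrecPred fun x : Node => x.ix.getD 1 0 < x.2.length :=
    Primrec.nat_lt.comp (primrec_ix_getD 1) hn
  exact (((Primrec.eq.comp hl (.const 3)).and ((primrecPred_op 4).or
    (((primrecPred_op 5).and ha).or ((primrecPred_op 6).and hb)))).or
    ((Primrec.eq.comp hl (.const 2)).and
      ((primrecPred_op 8).or ((primrecPred_op 9).and hb)))).of_eq
    fun x => (isBranch_iff x).symm

end Primrec

/-- Inversion of the schemes. -/
def InvForm (e : ℕ) (a : List ℕ) (b : ℕ) : Prop :=
  match Denumerable.ofNat (List ℕ) e with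
  | [1] => b = a.headI + 1
  | [2, q] => b = q
  | [3] => b = a.headI
  | [4, e₁, e₂] => ∃ c, Comp e₂ a c ∧ Comp e₁ (c :: a) b
  | [5, e₁, e₂] => (a.headI = 0 ∧ Comp e₁ a.tail b) ∨ ∃ x c, a.headI = x + 1 ∧
      Comp e (x :: a.tail) c ∧ Comp e₂ (x :: c :: a.tail) b
  | [6, k, e₁] => Comp e₁ (a.getD k 0 :: (a.take k ++ a.drop (k + 1))) b
  | [8, e₁] => ∃ g : ℕ → ℕ, (∀ s, Comp e₁ (s :: a) (g s)) ∧ b = suslin g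
  | [9, n] => Comp a.headI (a.tail.take n) b
  | _ => False

theorem Comp.inv {e : ℕ} {a : List ℕ} {b : ℕ} (h : Comp e a b) : InvForm e a b := by
  cases h with
  | comp _ _ _ c _ h₁ h₂ => simp only [InvForm, idx, Denumerable.ofNat_encode]; exact ⟨c, h₁, h₂⟩
  | recSucc _ _ x _ c _ h₁ h₂ =>
    simp only [InvForm, idx, Denumerable.ofNat_encode]; exact Or.inr ⟨x, c, rfl, h₁, h₂⟩
  | suslin _ _ g h => simp only [InvForm, idx, Denumerable.ofNat_encode]; exact ⟨g, h, rfl⟩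
  | _ => simp_all [InvForm, idx]

theorem Comp.det {e : ℕ} {a : List ℕ} {b b' : ℕ} (h : Comp e a b) (h' : Comp e a b') :
    b = b' := by
  induction h generalizing b' with
  | comp e₁ e₂ a c b _ _ ih₂ ih₁ =>
    have := h'.inv
    simp only [InvForm, idx, Denumerable.ofNat_encode] at this
    obtain ⟨c', h₂, h₁⟩ := this
    obtain rfl := ih₂ h₂
    exact ih₁ h₁
  | recZero e₁ e₂ a b _ ih =>
    have := h'.inv
    simp [InvForm, idx] at this
    exact ih this
  | recSucc e₁ e₂ x a c b _ _ ih₁ ih₂ =>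
    have := h'.inv
    simp [InvForm, idx] at this
    obtain ⟨c', h₁, h₂⟩ := this
    obtain rfl := ih₁ h₁
    exact ih₂ h₂
  | perm e₁ a₁ x a₂ b _ ih =>
    have := h'.inv
    simp [InvForm, idx] at this
    exact ih this
  | suslin e₁ a g _ ih =>
    have := h'.inv
    simp only [InvForm, idx, Denumerable.ofNat_encode] at this
    obtain ⟨g', h₁, rfl⟩ := this
    congr
    exact funext fun s => ih s (h₁ s)
  | enum d a a' b _ ih =>
    have := h'.inv
    simp [InvForm, idx] at this
    exact ih this
  | _ =>
    have := h'.inv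
    simp [InvForm, idx] at this
    exact this.symm

theorem Comp.val_eq {e : ℕ} {a : List ℕ} {b : ℕ} (h : Comp e a b) : val e a = b := by
  have h' : ∃ b, Comp e a b := ⟨b, h⟩
  rw [val, dif_pos h']
  exact h'.choose_spec.det h

/-- `Sub y x`: the computation `y` is an immediate subcomputation of `x`. A computation that matches
no scheme is its own subcomputation, so that it is not accessible. -/
def Sub (y x : Node) : Prop :=
  ¬ IsLeaf x ∧ (¬ IsBranch x → y = x) ∧
    (IsBranch x → (∃ s, y = famChild x s) ∨
      ∃ c, Comp (famChild x 0).1 (famChild x 0).2 c ∧ y = lastChild x c)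

/-- The convergent computations. -/
abbrev Conv (x : Node) : Prop := Acc Sub x

theorem IsLeaf.conv {x : Node} (h : IsLeaf x) : Conv x := ⟨_, fun _ hy => absurd h hy.1⟩

theorem conv_trivNode : Conv trivNode := (IsLeaf.const 0 []).conv

theorem IsBranch.conv {x : Node} (h : IsBranch x) (h₁ : ∀ s, Conv (famChild x s))
    (h₂ : ∀ c, Comp (famChild x 0).1 (famChild x 0).2 c → Conv (lastChild x c)) : Conv x := by
  refine ⟨_, fun y hy => ?_⟩
  rcases hy.2.2 h with ⟨s, rfl⟩ | ⟨c, hc, rfl⟩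
  exacts [h₁ s, h₂ c hc]

theorem Comp.conv {e : ℕ} {a : List ℕ} {b : ℕ} (h : Comp e a b) : Conv (e, a) := by
  induction h with
  | succ x a => exact (IsLeaf.succ x a).conv
  | const q a => exact (IsLeaf.const q a).conv
  | proj x a => exact (IsLeaf.proj x a).conv
  | comp e₁ e₂ a c b h _ ih₂ ih₁ =>
    refine (IsBranch.comp e₁ e₂ a).conv (fun s => by simpa [famChild] using ih₂) fun c' hc => ?_
    obtain rfl := h.det (by simpa [famChild] using hc)
    simpa [lastChild] using ih₁
  | recZero e₁ e₂ a b _ ih =>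
    exact (IsBranch.prec e₁ e₂ 0 a).conv (fun s => by simpa [famChild] using conv_trivNode)
      fun c' _ => by simpa [lastChild] using ih
  | recSucc e₁ e₂ x a c b h _ ih₁ ih₂ =>
    refine (IsBranch.prec e₁ e₂ (x + 1) a).conv (fun s => by simpa [famChild] using ih₁)
      fun c' hc => ?_
    obtain rfl := h.det (by simpa [famChild] using hc)
    simpa [lastChild] using ih₂
  | perm e₁ a₁ x a₂ b _ ih =>
    exact (IsBranch.perm e₁ a₁ x a₂).conv (fun s => by simpa [famChild] using conv_trivNode)
      fun c' _ => by simpa [lastChild] using ih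
  | suslin e₁ a g _ ih =>
    exact (IsBranch.suslin e₁ a).conv (fun s => by simpa [famChild] using ih s)
      fun c' _ => by simpa [lastChild] using conv_trivNode
  | enum d a a' b _ ih =>
    exact (IsBranch.enum d a a').conv (fun s => by simpa [famChild] using conv_trivNode)
      fun c' _ => by simpa [lastChild] using ih

theorem not_conv_of_sub_self {x : Node} (h : Sub x x) : ¬ Conv x := fun hx => by
  induction hx with
  | intro x _ ih => exact ih x h h

theorem Conv.sub {x y : Node} (h : Conv x) (hy : Sub y x) : Conv y := h.inv hy

theorem sub_famChild {x : Node} (h : IsBranch x) (h' : ¬ IsLeaf x) (s : ℕ) :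
    Sub (famChild x s) x := ⟨h', fun h'' => absurd h h'', fun _ => Or.inl ⟨s, rfl⟩⟩

theorem sub_lastChild {x : Node} (h : IsBranch x) (h' : ¬ IsLeaf x) {c : ℕ}
    (hc : Comp (famChild x 0).1 (famChild x 0).2 c) : Sub (lastChild x c) x :=
  ⟨h', fun h'' => absurd h h'', fun _ => Or.inr ⟨c, hc, rfl⟩⟩

theorem Conv.exists_comp {x : Node} (h : Conv x) : ∃ b, Comp x.1 x.2 b := by
  induction h with
  | intro x hx ih =>
    by_cases hl : IsLeaf x
    · rcases hl with ⟨y, a⟩ | ⟨q, a⟩ | ⟨y, a⟩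
      exacts [⟨_, Comp.succ _ _⟩, ⟨_, Comp.const _ _⟩, ⟨_, Comp.proj _ _⟩]
    by_cases hb : IsBranch x
    · have h₁ := fun s => ih _ (sub_famChild hb hl s)
      have h₂ := fun c hc => ih _ (sub_lastChild hb hl (c := c) hc)
      rcases hb with ⟨e₁, e₂, a⟩ | ⟨e₁, e₂, y, a⟩ | ⟨e₁, a₁, y, a₂⟩ | ⟨e₁, a⟩ | ⟨d, a, a'⟩
      · obtain ⟨c, hc⟩ := h₁ 0
        obtain ⟨b, hb⟩ := h₂ c hc
        exact ⟨b, Comp.comp _ _ _ c _ (by simpa [famChild] using hc)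
          (by simpa [lastChild] using hb)⟩
      · obtain ⟨c, hc⟩ := h₁ 0
        obtain ⟨b, hb⟩ := h₂ c hc
        rcases y with _ | y
        · exact ⟨b, Comp.recZero _ _ _ _ (by simpa [lastChild] using hb)⟩
        · exact ⟨b, Comp.recSucc _ _ _ _ c _ (by simpa [famChild] using hc)
            (by simpa [lastChild] using hb)⟩
      · obtain ⟨c, hc⟩ := h₁ 0
        obtain ⟨b, hb⟩ := h₂ c hc
        exact ⟨b, Comp.perm _ _ _ _ _ (by simpa [lastChild] using hb)⟩
      · choose g hg using h₁
        exact ⟨_, Comp.suslin _ _ g fun s => by simpa [famChild] using hg s⟩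
      · obtain ⟨c, hc⟩ := h₁ 0
        obtain ⟨b, hb⟩ := h₂ c hc
        exact ⟨b, Comp.enum _ _ _ _ (by simpa [lastChild] using hb)⟩
    · exact ih x ⟨hl, fun _ => rfl, fun h => absurd h hb⟩

theorem Conv.comp_val {x : Node} (h : Conv x) : Comp x.1 x.2 (val x.1 x.2) := by
  obtain ⟨b, hb⟩ := h.exists_comp
  rwa [hb.val_eq]

theorem IsBranch.not_isLeaf {x : Node} (h : IsBranch x) : ¬ IsLeaf x := by
  rw [isBranch_iff] at h
  rw [isLeaf_iff]
  omega

theorem sub_comp_left (e₁ e₂ : ℕ) (a : List ℕ) : Sub (e₂, a) (idx [4, e₁, e₂], a) := by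
  have h := IsBranch.comp e₁ e₂ a
  simpa [famChild] using sub_famChild h h.not_isLeaf 0

theorem sub_comp_right {e₁ e₂ c : ℕ} {a : List ℕ} (hc : Comp e₂ a c) :
    Sub (e₁, c :: a) (idx [4, e₁, e₂], a) := by
  have h := IsBranch.comp e₁ e₂ a
  simpa [lastChild] using sub_lastChild h h.not_isLeaf (c := c) (by simpa [famChild] using hc)

theorem sub_suslin (e₁ s : ℕ) (a : List ℕ) : Sub (e₁, s :: a) (idx [8, e₁], a) := by
  have h := IsBranch.suslin e₁ a
  simpa [famChild] using sub_famChild h h.not_isLeaf s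

theorem sub_perm (e₁ : ℕ) (a₁ : List ℕ) (x : ℕ) (a₂ : List ℕ) :
    Sub (e₁, x :: (a₁ ++ a₂)) (idx [6, a₁.length, e₁], a₁ ++ x :: a₂) := by
  have h := IsBranch.perm e₁ a₁ x a₂
  simpa [lastChild] using sub_lastChild h h.not_isLeaf (c := 0)
    (by simpa [famChild, trivNode] using Comp.const 0 [])

theorem sub_enum (d : ℕ) (a a' : List ℕ) : Sub (d, a) (idx [9, a.length], d :: (a ++ a')) := by
  have h := IsBranch.enum d a a'
  simpa [lastChild] using sub_lastChild h h.not_isLeaf (c := 0)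
    (by simpa [famChild, trivNode] using Comp.const 0 [])

/-! ### Comparison of the lengths of computations -/

section StageComparison

open Encodable

open Classical in
/-- The length of a convergent computation: its rank in the relation of being a subcomputation
(with the junk value `0` for divergent computations). -/
noncomputable def rk (x : Node) : Ordinal.{0} := if h : Conv x then Acc.rank h else 0

theorem Conv.rk_lt {x y : Node} (h : Conv x) (hy : Sub y x) : rk y < rk x := by
  rw [rk, rk, dif_pos h, dif_pos (h.sub hy)]
  exact Acc.rank_lt_of_rel h hy

theorem Conv.rk_le_iff {x : Node} (h : Conv x) {o : Ordinal.{0} } :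
    rk x ≤ o ↔ ∀ y, Sub y x → rk y < o := by
  constructor
  · exact fun ho y hy => (h.rk_lt hy).trans_le ho
  · intro ho
    rw [rk, dif_pos h, Acc.rank_eq, Ordinal.iSup_le_iff]
    rintro ⟨y, hy⟩
    have := ho y hy
    rw [rk, dif_pos (h.sub hy)] at this
    exact Order.succ_le_of_lt this

theorem Conv.lt_rk_iff {x : Node} (h : Conv x) {o : Ordinal.{0} } :
    o < rk x ↔ ∃ y, Sub y x ∧ o ≤ rk y := by
  rw [← not_le, h.rk_le_iff]
  push Not
  rfl

/-- `x` converges, in at most as many steps as `y`, where a divergent computation takes infinitely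
many steps. -/
def StageLE (x y : Node) : Prop := Conv x ∧ (Conv y → rk x ≤ rk y)

theorem Conv.of_not_stageLE {x y : Node} (h : Conv x ∨ Conv y) (hxy : ¬ StageLE x y) : Conv y := by
  by_contra hy
  exact hxy ⟨h.resolve_right hy, fun h => absurd h hy⟩

/-- The comparison of lengths is determined by the comparisons of the immediate subcomputations. -/
theorem stageLE_iff {x y : Node} :
    StageLE x y ↔ ∀ x', Sub x' x → ∃ y', Sub y' y ∧ StageLE x' y' := by
  constructor
  · rintro ⟨hx, h⟩ x' hx'
    by_cases hy : Conv y
    · obtain ⟨y', hy', h'⟩ := hy.lt_rk_iff.1 ((hx.rk_lt hx').trans_le (h hy))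
      exact ⟨y', hy', hx.sub hx', fun _ => h'⟩
    · obtain ⟨y', hy', h'⟩ : ∃ y', Sub y' y ∧ ¬ Conv y' := by
        by_contra! h'
        exact hy ⟨_, h'⟩
      exact ⟨y', hy', hx.sub hx', fun h'' => absurd h'' h'⟩
  · intro h
    have hx : Conv x := ⟨_, fun x' hx' => by
      obtain ⟨y', _, h', _⟩ := h x' hx'
      exact h'⟩
    refine ⟨hx, fun hy => hx.rk_le_iff.2 fun x' hx' => ?_⟩
    obtain ⟨y', hy', h', h''⟩ := h x' hx'
    exact (h'' (hy.sub hy')).trans_lt (hy.rk_lt hy')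

/-- The immediate subcomputation that depends on the value of the first one, for that value. -/
noncomputable def valChild (x : Node) : Node :=
  lastChild x (val (famChild x 0).1 (famChild x 0).2)

theorem sub_valChild {x : Node} (h : IsBranch x) (h₀ : Conv (famChild x 0)) :
    Sub (valChild x) x :=
  sub_lastChild h h.not_isLeaf h₀.comp_val

theorem sub_iff {x y : Node} (h : IsBranch x) (hy : Sub y x) :
    (∃ s, y = famChild x s) ∨ (Conv (famChild x 0) ∧ y = valChild x) := by
  rcases hy.2.2 h with h | ⟨c, hc, rfl⟩
  · exact Or.inl h
  · exact Or.inr ⟨hc.conv, by rw [valChild, hc.val_eq]⟩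

/-- The comparison of two computations by comparisons of subcomputations. The redundancy on the
right hand side ensures that it can be evaluated from left to right, without ever comparing two
divergent computations or asking for the value of a divergent computation. -/
theorem stageLE_branch {x y : Node} (hx : IsBranch x) (hy : IsBranch y) (hD : Conv x ∨ Conv y) :
    StageLE x y ↔
      ((∀ s, ∃ t, StageLE (famChild x s) (famChild y t)) ∨
        ∀ s, (∃ t, StageLE (famChild x s) (famChild y t)) ∨ StageLE (famChild x s) (valChild y)) ∧
      ((∃ t, StageLE (valChild x) (famChild y t)) ∨ StageLE (valChild x) (valChild y)) := by
  have hsub (z : Node) (h : ∃ y', Sub y' y ∧ StageLE z y') :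
      (∃ t, StageLE z (famChild y t)) ∨ StageLE z (valChild y) := by
    obtain ⟨y', hy', h⟩ := h
    rcases sub_iff hy hy' with ⟨t, rfl⟩ | ⟨_, rfl⟩
    exacts [Or.inl ⟨t, h⟩, Or.inr h]
  constructor
  · intro h
    have h₀ := h.1.sub (sub_famChild hx hx.not_isLeaf 0)
    rw [stageLE_iff] at h
    exact ⟨Or.inr fun s => hsub _ (h _ (sub_famChild hx hx.not_isLeaf s)),
      hsub _ (h _ (sub_valChild hx h₀))⟩
  · rintro ⟨h₁, h₂⟩
    by_cases hyc : Conv y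
    · have hsub' (z : Node)
          (h : (∃ t, StageLE z (famChild y t)) ∨ StageLE z (valChild y)) :
          ∃ y', Sub y' y ∧ StageLE z y' := by
        rcases h with ⟨t, h⟩ | h
        · exact ⟨_, sub_famChild hy hy.not_isLeaf t, h⟩
        · exact ⟨_, sub_valChild hy (hyc.sub (sub_famChild hy hy.not_isLeaf 0)), h⟩
      rw [stageLE_iff]
      intro x' hx'
      rcases sub_iff hx hx' with ⟨s, rfl⟩ | ⟨_, rfl⟩
      · exact hsub' _ (h₁.elim (fun h => Or.inl (h s)) fun h => h s)
      · exact hsub' _ h₂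
    · exact ⟨hD.resolve_right hyc, fun h => absurd h hyc⟩

/-- The universal function is computable, by S9 and the substitution of all arguments. -/
theorem compOn_val : CompOn Conv fun x : Node => val x.1 x.2 := by
  obtain ⟨d, hd⟩ := CompOn.of_primrec (D := fun _ => True) primrec_specIdx
  refine ⟨idx [4, idx [9, 0], d], fun x hx => Comp.comp _ _ _ _ _ (hd x trivial) ?_⟩
  exact Comp.enum _ [] _ _ (comp_specIdx x.2 [] (by simpa using hx.comp_val))

/-- The program `p` decides correctly whether `StageLE x y`. -/
def Correct (p : ℕ) (x y : Node) : Prop :=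
  (StageLE x y → Comp p [encode (x, y)] 1) ∧ (¬ StageLE x y → Comp p [encode (x, y)] 0)

/-- Running a program decides the comparison wherever the program is correct. -/
theorem decOn_correct : DecOn (fun q : ℕ × Node × Node => Correct q.1 q.2.1 q.2.2)
    fun q => StageLE q.2.1 q.2.2 := by
  obtain ⟨r, hr⟩ := exists_index_of_primrec (f := fun n => n.unpair.2)
    (Primrec.snd.comp .unpair)
  obtain ⟨l, hl⟩ := exists_index_of_primrec₂ (f := fun _ n => n.unpair.1)
    (Primrec.fst.comp (Primrec.unpair.comp .snd))
  refine ⟨idx [4, idx [4, idx [9, 1], l], r], ?_⟩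
  rintro ⟨p, x, y⟩ hq
  refine Comp.comp _ _ _ _ _ (hr _ _) (Comp.comp _ _ _ _ _ (hl _ _ _) ?_)
  refine Comp.enum _ [_] _ _ ?_
  have h1 : encode (p, x, y) = Nat.pair p (encode (x, y)) := rfl
  rw [h1, Nat.unpair_pair]
  by_cases h : StageLE x y
  · simpa only [h, if_true] using hq.1 h
  · simpa only [h, if_false] using hq.2 h

/-- One step of the recursion that compares two computations. -/
theorem decOn_stageLE_step : DecOn (fun q : ℕ × Node × Node => (Conv q.2.1 ∨ Conv q.2.2) ∧
      ∀ x' y', Sub x' q.2.1 → Sub y' q.2.2 → Conv x' ∨ Conv y' → Correct q.1 x' y')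
    fun q => StageLE q.2.1 q.2.2 := by
  set Dom : ℕ × Node × Node → Prop := fun q => (Conv q.2.1 ∨ Conv q.2.2) ∧
      ∀ x' y', Sub x' q.2.1 → Sub y' q.2.2 → Conv x' ∨ Conv y' → Correct q.1 x' y' with hDom
  have px : Primrec fun q : ℕ × Node × Node => q.2.1 := Primrec.fst.comp .snd
  have py : Primrec fun q : ℕ × Node × Node => q.2.2 := Primrec.snd.comp .snd
  have pf {α : Type} [Primcodable α] {f : α → Node} {g : α → ℕ} (hf : Primrec f)
    (hg : Primrec g) : Primrec fun a => famChild (f a) (g a) := primrec_famChild.comp (hf.pair hg)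
  have pl {α : Type} [Primcodable α] {f : α → Node} {g : α → ℕ} (hf : Primrec f)
    (hg : Primrec g) : Primrec fun a => lastChild (f a) (g a) := primrec_lastChild.comp (hf.pair hg)
  have hv {α : Type} [Primcodable α] {f : α → Node} (hf : Primrec f) :
      CompOn (fun a => Conv (famChild (f a) 0))
        fun a => val (famChild (f a) 0).1 (famChild (f a) 0).2 :=
    compOn_val.comp (pf hf (.const 0))
  -- the comparison of members of the two families
  have hft : DecOn (fun q : (ℕ × Node × Node) × ℕ =>
      ∀ t, Correct q.1.1 (famChild q.1.2.1 q.2) (famChild q.1.2.2 t))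
      fun q => ∃ t, StageLE (famChild q.1.2.1 q.2) (famChild q.1.2.2 t) :=
    (decOn_correct.comp ((Primrec.fst.comp (Primrec.fst.comp .fst)).pair
      ((pf (px.comp (Primrec.fst.comp .fst)) (Primrec.snd.comp .fst)).pair
        (pf (py.comp (Primrec.fst.comp .fst)) .snd)))).exists
  have hfv : DecOn (fun q : (ℕ × Node × Node) × ℕ => Conv (famChild q.1.2.2 0) ∧
      Correct q.1.1 (famChild q.1.2.1 q.2) (valChild q.1.2.2))
      fun q => StageLE (famChild q.1.2.1 q.2) (valChild q.1.2.2) :=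
    DecOn.subst (hv (py.comp .fst)) (decOn_correct.comp
      (g := fun r : ((ℕ × Node × Node) × ℕ) × ℕ =>
        (r.1.1.1, famChild r.1.1.2.1 r.1.2, lastChild r.1.1.2.2 r.2))
      ((Primrec.fst.comp (Primrec.fst.comp .fst)).pair
        ((pf (px.comp (Primrec.fst.comp .fst)) (Primrec.snd.comp .fst)).pair
          (pl (py.comp (Primrec.fst.comp .fst)) .snd))))
  have hvf : DecOn (fun q : ℕ × Node × Node => Conv (famChild q.2.1 0) ∧
      ∀ t, Correct q.1 (valChild q.2.1) (famChild q.2.2 t))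
      fun q => ∃ t, StageLE (valChild q.2.1) (famChild q.2.2 t) :=
    DecOn.subst (hv px) (decOn_correct.comp
      (g := fun r : ((ℕ × Node × Node) × ℕ) × ℕ =>
        (r.1.1.1, lastChild r.1.1.2.1 r.1.2, famChild r.1.1.2.2 r.2))
      ((Primrec.fst.comp (Primrec.fst.comp .fst)).pair
        ((pl (px.comp (Primrec.fst.comp .fst)) (Primrec.snd.comp .fst)).pair
          (pf (py.comp (Primrec.fst.comp .fst)) .snd)))).exists
  have hvv : DecOn (fun q : ℕ × Node × Node => Conv (famChild q.2.1 0) ∧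
      Conv (famChild q.2.2 0) ∧ Correct q.1 (valChild q.2.1) (valChild q.2.2))
      fun q => StageLE (valChild q.2.1) (valChild q.2.2) :=
    DecOn.subst (hv px) (DecOn.subst
      (D := fun r : (ℕ × Node × Node) × ℕ => Conv (famChild r.1.2.2 0))
      (D' := fun r => Correct r.1.1.1 (lastChild r.1.1.2.1 r.1.2) (lastChild r.1.1.2.2 r.2))
      (P := fun r => StageLE (lastChild r.1.1.2.1 r.1.2) (lastChild r.1.1.2.2 r.2))
      (hv (py.comp .fst)) (decOn_correct.comp
      (g := fun r : ((ℕ × Node × Node) × ℕ) × ℕ =>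
        (r.1.1.1, lastChild r.1.1.2.1 r.1.2, lastChild r.1.1.2.2 r.2))
      ((Primrec.fst.comp (Primrec.fst.comp .fst)).pair
        ((pl (px.comp (Primrec.fst.comp .fst)) (Primrec.snd.comp .fst)).pair
          (pl (py.comp (Primrec.fst.comp .fst)) .snd)))))
  have hbr : DecOn (fun q => Dom q ∧ IsBranch q.2.1 ∧ IsBranch q.2.2)
      fun q => StageLE q.2.1 q.2.2 := by
    have key : DecOn (fun q => Dom q ∧ IsBranch q.2.1 ∧ IsBranch q.2.2) _ :=
      DecOn.and (P := fun q => (∀ s, ∃ t, StageLE (famChild q.2.1 s) (famChild q.2.2 t)) ∨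
        ∀ s, (∃ t, StageLE (famChild q.2.1 s) (famChild q.2.2 t)) ∨
          StageLE (famChild q.2.1 s) (valChild q.2.2))
        (Q := fun q => (∃ t, StageLE (valChild q.2.1) (famChild q.2.2 t)) ∨
          StageLE (valChild q.2.1) (valChild q.2.2))
        (DecOn.or (hft.forall.mono ?_ fun _ _ => Iff.rfl)
          ((DecOn.or (D := fun q : (ℕ × Node × Node) × ℕ =>
            (∀ t, Correct q.1.1 (famChild q.1.2.1 q.2) (famChild q.1.2.2 t)) ∧
            Conv (famChild q.1.2.2 0) ∧ Correct q.1.1 (famChild q.1.2.1 q.2) (valChild q.1.2.2))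
            (hft.mono (fun _ h => h.1) fun _ _ => Iff.rfl)
            (hfv.mono (fun _ h => h.1.2) fun _ _ => Iff.rfl)).forall.mono ?_ fun _ _ => Iff.rfl))
        (DecOn.or (hvf.mono ?_ fun _ _ => Iff.rfl) (hvv.mono ?_ fun _ _ => Iff.rfl))
    · exact key.mono (fun _ => id) fun q hq => (stageLE_branch hq.2.1 hq.2.2 hq.1.1).symm
    · rintro ⟨p, x, y⟩ ⟨⟨hD, hc⟩, hx, hy⟩ s t
      exact hc _ _ (sub_famChild hx hx.not_isLeaf s) (sub_famChild hy hy.not_isLeaf t)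
        (hD.imp (fun h => h.sub (sub_famChild hx hx.not_isLeaf s))
          fun h => h.sub (sub_famChild hy hy.not_isLeaf t))
    · rintro ⟨p, x, y⟩ ⟨⟨⟨hD, hc⟩, hx, hy⟩, hA⟩ s
      have hc' := fun s t => hc _ _ (sub_famChild hx hx.not_isLeaf s)
        (sub_famChild hy hy.not_isLeaf t)
      have hD' := fun s t => hD.imp (fun h => h.sub (sub_famChild hx hx.not_isLeaf s))
          fun h => h.sub (sub_famChild hy hy.not_isLeaf t)
      push Not at hA
      obtain ⟨s₀, hs₀⟩ := hA
      have hy₀ : Conv (famChild y 0) := Conv.of_not_stageLE (hD' s₀ 0) (hs₀ 0)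
      refine ⟨fun t => hc' s t (hD' s t), hy₀, hc _ _ (sub_famChild hx hx.not_isLeaf s)
        (sub_valChild hy hy₀) (hD.imp (fun h => h.sub (sub_famChild hx hx.not_isLeaf s))
          fun h => h.sub (sub_valChild hy hy₀))⟩
    · rintro ⟨p, x, y⟩ ⟨⟨⟨hD, hc⟩, hx, hy⟩, hA⟩
      have hx₀ : Conv (famChild x 0) := by
        rcases hA with h | h
        · obtain ⟨t, h⟩ := h 0
          exact h.1
        · rcases h 0 with ⟨t, h⟩ | h <;> exact h.1
      refine ⟨hx₀, fun t => hc _ _ (sub_valChild hx hx₀) (sub_famChild hy hy.not_isLeaf t)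
        (hD.imp (fun h => h.sub (sub_valChild hx hx₀))
          fun h => h.sub (sub_famChild hy hy.not_isLeaf t))⟩
    · rintro ⟨p, x, y⟩ ⟨⟨⟨⟨hD, hc⟩, hx, hy⟩, hA⟩, hB⟩
      have hx₀ : Conv (famChild x 0) := by
        rcases hA with h | h
        · obtain ⟨t, h⟩ := h 0
          exact h.1
        · rcases h 0 with ⟨t, h⟩ | h <;> exact h.1
      push Not at hB
      have hy₀ : Conv (famChild y 0) := Conv.of_not_stageLE
        (hD.imp (fun h => h.sub (sub_valChild hx hx₀))
          fun h => h.sub (sub_famChild hy hy.not_isLeaf 0)) (hB 0)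
      exact ⟨hx₀, hy₀, hc _ _ (sub_valChild hx hx₀) (sub_valChild hy hy₀)
        (hD.imp (fun h => h.sub (sub_valChild hx hx₀)) fun h => h.sub (sub_valChild hy hy₀))⟩
  have hlx : PrimrecPred fun q : ℕ × Node × Node => IsLeaf q.2.1 := primrecPred_isLeaf.comp px
  have hly : PrimrecPred fun q : ℕ × Node × Node => IsLeaf q.2.2 := primrecPred_isLeaf.comp py
  have hbx : PrimrecPred fun q : ℕ × Node × Node => IsBranch q.2.1 := primrecPred_isBranch.comp px
  have hby : PrimrecPred fun q : ℕ × Node × Node => IsBranch q.2.2 := primrecPred_isBranch.comp py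
  have h5 : DecOn Dom fun q => IsLeaf q.2.1 ∨ (IsBranch q.2.1 ∧ (¬ IsLeaf q.2.2 ∧
      (IsBranch q.2.2 → StageLE q.2.1 q.2.2))) :=
    (DecOn.of_primrecPred hlx).or ((DecOn.of_primrecPred hbx).and
      ((DecOn.of_primrecPred hly).not.and ((DecOn.of_primrecPred hby).imp
        (hbr.mono (fun q hq => ⟨hq.1.1.1.1, hq.1.1.2, hq.2⟩) fun _ _ => Iff.rfl))))
  refine h5.mono (fun _ => id) ?_
  rintro ⟨p, x, y⟩ ⟨hD, -⟩
  change (IsLeaf x ∨ (IsBranch x ∧ (¬ IsLeaf y ∧ (IsBranch y → StageLE x y)))) ↔ StageLE x y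
  by_cases hx : IsLeaf x
  · simp only [hx, true_or, true_iff]
    exact stageLE_iff.2 fun x' hx' => absurd hx hx'.1
  by_cases hxb : IsBranch x
  · by_cases hy : IsLeaf y
    · simp only [hx, hy, false_or, not_true_eq_false, false_and, and_false, false_iff]
      intro h
      obtain ⟨y', hy', _⟩ := stageLE_iff.1 h _ (sub_famChild hxb hx 0)
      exact hy'.1 hy
    by_cases hyb : IsBranch y
    · simp [hx, hxb, hy, hyb]
    · simp only [hx, hxb, hy, hyb, false_or, not_false_eq_true, true_and, IsEmpty.forall_iff,
        true_iff]
      have hyc : ¬ Conv y := not_conv_of_sub_self ⟨hy, fun _ => rfl, fun h => absurd h hyb⟩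
      exact ⟨hD.resolve_right hyc, fun h => absurd h hyc⟩
  · simp only [hx, hxb, false_or, false_and, false_iff]
    exact fun h => not_conv_of_sub_self ⟨hx, fun _ => rfl, fun h => absurd h hxb⟩ h.1

/-- The lengths of two computations of which one converges can be compared by a computation. The
program is the fixed point of `decOn_stageLE_step`, and it is correct by induction on the
computation that converges. -/
theorem decOn_stageLE :
    DecOn (fun q : Node × Node => Conv q.1 ∨ Conv q.2) fun q => StageLE q.1 q.2 := by
  obtain ⟨h, hh⟩ := decOn_stageLE_step
  obtain ⟨k, hk⟩ := exists_index_of_primrec₃ (f := fun q => Nat.pair q.1 q.2.2)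
    (Primrec₂.natPair.comp .fst (Primrec.snd.comp .snd))
  obtain ⟨e, y₀, d, he, hy₀, hd⟩ := exists_fixedPoint (idx [4, h, k])
  have hrec (x y : Node) (hD : Conv x ∨ Conv y)
      (hc : ∀ x' y', Sub x' x → Sub y' y → Conv x' ∨ Conv y' → Correct e x' y') :
      Correct e x y := by
    have h1 := hh (e, x, y) ⟨hD, hc⟩
    have h2 (b : ℕ) (hb : Comp h [encode (e, x, y)] b) : Comp e [encode (x, y)] b := by
      have h3 := Comp.comp h k [e, y₀, encode (x, y)] _ b (hk _ _ _ []) (hb.append _)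
      have h4 := Comp.comp _ _ [y₀, encode (x, y)] _ b (hd [encode (x, y)]) h3
      rw [← hy₀] at h4
      have h5 := Comp.comp _ _ [encode (x, y)] _ b (Comp.const y₀ _) h4
      rwa [← he] at h5
    constructor
    · intro hle
      simp only [hle, if_true] at h1
      exact h2 _ h1
    · intro hle
      simp only [hle, if_false] at h1
      exact h2 _ h1
  have hall (x : Node) (hx : Conv x) : ∀ y, Correct e x y ∧ Correct e y x := by
    induction hx with
    | intro x hx ih =>
      exact fun y => ⟨hrec x y (Or.inl ⟨_, hx⟩) fun x' y' hx' _ _ => (ih x' hx' y').1,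
        hrec y x (Or.inr ⟨_, hx⟩) fun y' x' _ hx' _ => (ih x' hx' y').2⟩
  refine ⟨e, fun q hq => ?_⟩
  have hcor : Correct e q.1 q.2 := hq.elim (fun h => (hall _ h _).1) fun h => (hall _ h _).2
  by_cases hle : StageLE q.1 q.2
  · simpa only [hle, if_true] using hcor.1 hle
  · simpa only [hle, if_false] using hcor.2 hle

end StageComparison

/-! ### Selection and boundedness -/

section Selection

open Encodable Relation

theorem Conv.of_transGen {x y : Node} (h : Conv x) (hy : TransGen Sub y x) : Conv y :=
  Acc.inv_of_transGen h hy

theorem Conv.rk_lt_of_transGen {x y : Node} (h : Conv x) (hy : TransGen Sub y x) :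
    rk y < rk x := by
  induction hy with
  | single hy => exact h.rk_lt hy
  | tail _ hy ih => exact (ih (h.sub hy)).trans (h.rk_lt hy)

/-- The index of the program that applies `e` to the value of the program `d`. -/
def callIdx (e d : ℕ) : ℕ := idx [4, idx [4, idx [9, 1], idx [2, e] ], d]

theorem primrec_callIdx (d : ℕ) : Primrec fun e => callIdx e d := by
  have h (l : List ℕ) : Primrec fun _ : ℕ => l := .const l
  exact Primrec.encode.comp (Primrec.list_cons.comp (.const 4) (Primrec.list_cons.comp
    (Primrec.encode.comp (Primrec.list_cons.comp (.const 4) (Primrec.list_cons.comp (.const _)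
      (Primrec.list_cons.comp (Primrec.encode.comp (Primrec.list_cons.comp (.const 2)
        (Primrec.list_cons.comp .id (h [])))) (h []))))) (h [d])))

theorem comp_callIdx {e d w b : ℕ} {a : List ℕ} (hd : Comp d a w) (he : Comp e [w] b) :
    Comp (callIdx e d) a b :=
  Comp.comp _ _ _ _ _ hd (Comp.comp _ _ _ _ _ (Comp.const e _) (Comp.enum e [w] a b he))

theorem sub_callIdx {d w : ℕ} {a : List ℕ} (e : ℕ) (hd : Comp d a w) :
    TransGen Sub (e, [w]) (callIdx e d, a) :=
  .tail (.tail (.single (sub_enum e [w] a)) (sub_comp_right (Comp.const e _))) (sub_comp_right hd)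

theorem sub_specIdx (a : List ℕ) : ∀ (e : ℕ) (r : List ℕ),
    ReflTransGen Sub (e, a ++ r) (specIdx e a, r) := by
  induction a with
  | nil => exact fun e r => .refl
  | cons q a ih =>
    exact fun e r => .head (sub_comp_right (Comp.const q _)) (ih _ r)

/-- The number `0` codes the empty list, which is not an index. -/
theorem not_conv_zero : ¬ Conv (0, []) := by
  refine not_conv_of_sub_self ⟨?_, fun _ => rfl, fun h => absurd h ?_⟩
  · rw [isLeaf_iff]; simp [Node.ix]
  · rw [isBranch_iff]; simp [Node.ix]

/-- A relation that is decidable on the convergent computations (in the last argument) is, together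
with the convergence of the last argument, semidecidable, by computations that are longer than
those in the last argument. -/
theorem exists_semidecision {Q : ℕ × Node → Prop} (hQ : DecOn (fun q => Conv q.2) Q) :
    ∃ z : ℕ, ∀ q, (Conv (z, [encode q]) ↔ Conv q.2 ∧ Q q) ∧
      (Conv (z, [encode q]) → rk q.2 < rk (z, [encode q])) := by
  obtain ⟨s, hs⟩ := CompOn.of_primrec (D := fun _ => True)
    (primrec_specIdx.comp (Primrec.snd (α := ℕ) (β := Node)))
  obtain ⟨f, hf⟩ := CompOn.ite hQ (CompOn.of_primrec (.const (idx [2, 0])))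
    (CompOn.of_primrec (.const 0))
  -- run the last argument, then decide `Q`, and diverge if it does not hold
  set z₁ := idx [4, idx [9, 0], s] with hz₁
  set z₂ := idx [4, idx [9, 0], idx [6, 1, f] ] with hz₂
  have hsub₁ (q : ℕ × Node) : TransGen Sub q.2 (z₁, [encode q]) :=
    TransGen.tail (TransGen.tail' (by simpa using sub_specIdx q.2.2 q.2.1 [])
      (sub_enum _ [] _)) (sub_comp_right (hs q trivial))
  have hsub₁' (q : ℕ × Node) : TransGen Sub q.2 (idx [4, z₂, z₁], [encode q]) :=
    (hsub₁ q).tail (sub_comp_left _ _ _)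
  have hsub₂ (q : ℕ × Node) (hq : Conv q.2) {c : ℕ} (hc : Comp z₁ [encode q] c) :
      TransGen Sub ((open Classical in if Q q then idx [2, 0] else 0), [])
        (idx [4, z₂, z₁], [encode q]) :=
    .tail (.tail (.single (sub_enum _ [] _)) (sub_comp_right
      (Comp.perm f [c] _ [] _ ((hf q hq).append [c])))) (sub_comp_right hc)
  have hcomp₁ (q : ℕ × Node) (hq : Conv q.2) :
      Comp z₁ [encode q] (val q.2.1 q.2.2) :=
    Comp.comp _ _ _ _ _ (hs q trivial) (Comp.enum _ [] _ _
      (comp_specIdx q.2.2 [] (by simpa using hq.comp_val)))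
  refine ⟨idx [4, z₂, z₁], fun q => ⟨⟨fun h => ?_, fun ⟨hq, hQq⟩ => ?_⟩, fun h =>
    h.rk_lt_of_transGen (hsub₁' q)⟩⟩
  · have hq := h.of_transGen (hsub₁' q)
    refine ⟨hq, ?_⟩
    by_contra hQq
    have := h.of_transGen (hsub₂ q hq (hcomp₁ q hq))
    rw [if_neg hQq] at this
    exact not_conv_zero this
  · have h1 := hf q hq
    simp only [hQq, if_true] at h1
    exact (Comp.comp _ _ _ _ _ (hcomp₁ q hq) (Comp.comp _ _ _ _ _
      (Comp.perm f [_] _ [] _ (h1.append [_])) (Comp.enum _ [] _ _ (Comp.const 0 [])))).conv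

/-- Gandy's selection theorem, in the form of a boundedness principle: if for each `n` some
convergent computation satisfies the decidable condition `Q n`, then there are such computations of
bounded length. -/
theorem exists_bound {Q : ℕ × Node → Prop} (hQ : DecOn (fun q => Conv q.2) Q)
    (h : ∀ n, ∃ x, Conv x ∧ Q (n, x)) :
    ∃ y, Conv y ∧ ∀ n, ∃ x, Conv x ∧ rk x < rk y ∧ Q (n, x) := by
  obtain ⟨z, hz⟩ := exists_semidecision hQ
  obtain ⟨c, hc⟩ := exists_index_of_primrec (f := fun w => Nat.pair w.unpair.1 w.unpair.2.unpair.1)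
    (Primrec₂.natPair.comp (Primrec.fst.comp .unpair)
      (Primrec.fst.comp (Primrec.unpair.comp (Primrec.snd.comp .unpair))))
  obtain ⟨d, hd⟩ := exists_index_of_primrec (f := fun w => Nat.pair w.unpair.1 (w.unpair.2 + 1))
    (Primrec₂.natPair.comp (Primrec.fst.comp .unpair)
      (Primrec.succ.comp (Primrec.snd.comp .unpair)))
  obtain ⟨z₀, hz₀⟩ := exists_index_of_primrec (f := fun n => Nat.pair n 0)
    (Primrec₂.natPair.comp .id (.const 0))
  -- `{t}(n, m)` runs the shorter one of `{t}(n, m + 1)` and the test of the candidate with code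
  -- `m.unpair.1`, so that each candidate is tested infinitely often
  have hsel : CompOn (fun q : ℕ × ℕ =>
      Conv (z, [Nat.pair q.2.unpair.1 q.2.unpair.2.unpair.1]) ∨
        Conv (q.1, [Nat.pair q.2.unpair.1 (q.2.unpair.2 + 1)]))
      fun q => open Classical in
        if StageLE (z, [Nat.pair q.2.unpair.1 q.2.unpair.2.unpair.1])
          (q.1, [Nat.pair q.2.unpair.1 (q.2.unpair.2 + 1)]) then callIdx z c
        else callIdx q.1 d := by
    refine CompOn.ite (decOn_stageLE.comp (g := fun q : ℕ × ℕ =>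
      ((z, [Nat.pair q.2.unpair.1 q.2.unpair.2.unpair.1]),
        (q.1, [Nat.pair q.2.unpair.1 (q.2.unpair.2 + 1)]))) ?_)
      (CompOn.of_primrec (.const _)) (CompOn.of_primrec ((primrec_callIdx d).comp .fst))
    have hu : Primrec fun q : ℕ × ℕ => q.2.unpair := Primrec.unpair.comp .snd
    have h1 : Primrec fun q : ℕ × ℕ => Nat.pair q.2.unpair.1 q.2.unpair.2.unpair.1 :=
      Primrec₂.natPair.comp (Primrec.fst.comp hu)
        (Primrec.fst.comp (Primrec.unpair.comp (Primrec.snd.comp hu)))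
    have h2 : Primrec fun q : ℕ × ℕ => Nat.pair q.2.unpair.1 (q.2.unpair.2 + 1) :=
      Primrec₂.natPair.comp (Primrec.fst.comp hu) (Primrec.succ.comp (Primrec.snd.comp hu))
    exact ((Primrec.const z).pair (Primrec.list_cons.comp h1 (.const []))).pair
      (Primrec.fst.pair (Primrec.list_cons.comp h2 (.const [])))
  obtain ⟨s, hs⟩ := hsel
  obtain ⟨p, hp⟩ := exists_index_of_primrec₃ (f := fun q => Nat.pair q.1 q.2.2)
    (Primrec₂.natPair.comp .fst (Primrec.snd.comp .snd))
  set k := idx [4, idx [6, 3, idx [6, 1, idx [9, 1] ] ], idx [4, s, p] ] with hk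
  obtain ⟨t, y₀, f, ht, hy₀, hf⟩ := exists_fixedPoint k
  have hselect (n m b : ℕ) (hb : Comp (idx [4, s, p]) [t, y₀, Nat.pair n m] b) :
      TransGen Sub (b, [Nat.pair n m]) (t, [Nat.pair n m]) := by
    set w := Nat.pair n m with hw
    have h1 : TransGen Sub (b, [w]) (k, [t, y₀, w]) :=
      .tail (.tail (.tail (.single (sub_enum b [w] [t, y₀])) (sub_perm _ [w] b [t, y₀]))
        (sub_perm _ [b, t, y₀] w [])) (sub_comp_right hb)
    have h2 : TransGen Sub (b, [w]) (y₀, [y₀, w]) := by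
      nth_rewrite 1 [hy₀]
      exact h1.tail (sub_comp_right (hf [w]))
    rw [ht]
    exact h2.tail (sub_comp_right (Comp.const y₀ _))
  have hrun (n m b r : ℕ) (hb : Comp (idx [4, s, p]) [t, y₀, Nat.pair n m] b)
      (hr : Comp b [Nat.pair n m] r) : Comp t [Nat.pair n m] r := by
    have h1 : Comp k [t, y₀, Nat.pair n m] r := Comp.comp _ _ _ _ _ hb
      (Comp.perm _ [b, t, y₀] _ [] _ (Comp.perm _ [_] b [t, y₀] _ (Comp.enum b [_] [t, y₀] _ hr)))
    have h2 : Comp y₀ [y₀, Nat.pair n m] r := by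
      nth_rewrite 1 [hy₀]
      exact Comp.comp _ _ _ _ _ (hf _) h1
    rw [ht]
    exact Comp.comp _ _ _ _ _ (Comp.const y₀ _) h2
  have hcval (n m : ℕ) : Comp c [Nat.pair n m] (Nat.pair n m.unpair.1) := by
    simpa using hc (Nat.pair n m) []
  have hdval (n m : ℕ) : Comp d [Nat.pair n m] (Nat.pair n (m + 1)) := by
    simpa using hd (Nat.pair n m) []
  have hsval (n m : ℕ) (hD : Conv (z, [Nat.pair n m.unpair.1]) ∨ Conv (t, [Nat.pair n (m + 1)])) :
      Comp (idx [4, s, p]) [t, y₀, Nat.pair n m] (open Classical in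
        if StageLE (z, [Nat.pair n m.unpair.1]) (t, [Nat.pair n (m + 1)]) then callIdx z c
        else callIdx t d) := by
    have h1 := hs (t, Nat.pair n m) (by simpa using hD)
    dsimp only at h1
    rw [Nat.unpair_pair] at h1
    exact Comp.comp _ _ _ _ _ (hp _ _ _ _) (h1.append _)
  have hstep (n m : ℕ) (hD : Conv (z, [Nat.pair n m.unpair.1]) ∨ Conv (t, [Nat.pair n (m + 1)])) :
      Conv (t, [Nat.pair n m]) := by
    have h1 := hsval n m hD
    by_cases hle : StageLE (z, [Nat.pair n m.unpair.1]) (t, [Nat.pair n (m + 1)])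
    · rw [if_pos hle] at h1
      exact (hrun n m _ _ h1 (comp_callIdx (hcval n m) hle.1.comp_val)).conv
    · rw [if_neg hle] at h1
      exact (hrun n m _ _ h1 (comp_callIdx (hdval n m)
        (Conv.of_not_stageLE hD hle).comp_val)).conv
  have hconv (n m : ℕ) : Conv (t, [Nat.pair n m]) := by
    obtain ⟨x, hx⟩ := h n
    have hzx : Conv (z, [Nat.pair n (encode x)]) := (hz (n, x)).1.2 hx
    have hdown (j : ℕ) : ∀ i, Conv (t, [Nat.pair n (i + j)]) → Conv (t, [Nat.pair n i]) := by
      induction j with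
      | zero => exact fun i hi => hi
      | succ j ih =>
        intro i hi
        exact ih i (hstep n (i + j) (Or.inr hi))
    refine hdown (Nat.pair (encode x) m - m) m (hstep _ _ (Or.inl ?_))
    rw [Nat.add_sub_cancel' (Nat.right_le_pair _ _)]
    simpa using hzx
  have hfound (x : Node) (hx : Conv x) : ∀ n m, x = (t, [Nat.pair n m]) →
      ∃ i, Conv (z, [Nat.pair n i]) ∧ rk (z, [Nat.pair n i]) < rk x := by
    induction hx.transGen with
    | intro x _ ih =>
      rintro n m rfl
      have h1 := hsval n m (Or.inr (hconv n (m + 1)))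
      by_cases hle : StageLE (z, [Nat.pair n m.unpair.1]) (t, [Nat.pair n (m + 1)])
      · rw [if_pos hle] at h1
        exact ⟨_, hle.1, hx.rk_lt_of_transGen
          ((sub_callIdx z (hcval n m)).trans (hselect n m _ h1))⟩
      · rw [if_neg hle] at h1
        have h2 := (sub_callIdx t (hdval n m)).trans (hselect n m _ h1)
        obtain ⟨i, hi, hi'⟩ := ih _ h2 (hx.of_transGen h2) n (m + 1) rfl
        exact ⟨i, hi, hi'.trans (hx.rk_lt_of_transGen h2)⟩
  refine ⟨(idx [8, callIdx t z₀], []), (Comp.suslin _ _ (fun n => val t [Nat.pair n 0])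
    fun n => comp_callIdx (hz₀ n []) (hconv n 0).comp_val).conv, fun n => ?_⟩
  have hy : Conv (idx [8, callIdx t z₀], []) := (Comp.suslin _ _ (fun n => val t [Nat.pair n 0])
    fun n => comp_callIdx (hz₀ n []) (hconv n 0).comp_val).conv
  have hsub : TransGen Sub (t, [Nat.pair n 0]) (idx [8, callIdx t z₀], []) :=
    (sub_callIdx t (hz₀ n [])).tail (sub_suslin _ n _)
  obtain ⟨i, hi, hi'⟩ := hfound _ (hconv n 0) n 0 rfl
  obtain ⟨x, rfl⟩ : ∃ x : Node, encode x = i := ⟨_, Denumerable.encode_ofNat i⟩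
  obtain ⟨h1, h2⟩ := hz (n, x)
  obtain ⟨hx, hQx⟩ := h1.1 hi
  exact ⟨x, hx, (h2 hi).trans (hi'.trans (hy.rk_lt_of_transGen hsub)), hQx⟩

end Selection

/-! ### The ordinals computable in the Suslin functional -/

section Ordinals

open Encodable Relation

/-- The supremum of the (successors of the) lengths of the convergent computations. -/
noncomputable def convSup : Ordinal.{0} := ⨆ x : Node, Order.succ (rk x)

theorem lt_convSup_iff {α : Ordinal.{0} } : α < convSup ↔ ∃ x, Conv x ∧ rk x = α := by
  have key (x : Node) (hx : Conv x) (h : α ≤ rk x) : ∃ x, Conv x ∧ rk x = α := by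
    rw [rk, dif_pos hx] at h
    obtain ⟨y, hy, rfl⟩ := Acc.mem_range_rank_of_le hx h
    exact ⟨y, hy, by rw [rk, dif_pos hy]⟩
  constructor
  · intro h
    obtain ⟨x, hx⟩ := Ordinal.lt_iSup_iff.1 h
    rw [Order.lt_succ_iff] at hx
    by_cases hxc : Conv x
    · exact key x hxc hx
    · rw [rk, dif_neg hxc] at hx
      exact key trivNode conv_trivNode (hx.trans zero_le)
  · rintro ⟨x, _, rfl⟩
    exact (Order.lt_succ _).trans_le (Ordinal.le_iSup (fun x : Node => Order.succ (rk x)) x)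

theorem compOn_prod_iff {D : ℕ × ℕ → Prop} {F : ℕ × ℕ → ℕ} :
    CompOn D F ↔ ∃ e, ∀ x y, D (x, y) → Comp e [x, y] (F (x, y)) := by
  constructor
  · rintro ⟨e, he⟩
    obtain ⟨p, hp⟩ := exists_index_of_primrec₂ Primrec₂.natPair
    exact ⟨idx [4, e, p], fun x y h => Comp.comp _ _ _ _ _ (hp x y []) ((he (x, y) h).append _)⟩
  · rintro ⟨e, he⟩
    obtain ⟨r, hr⟩ := exists_index_of_primrec (f := fun n => n.unpair.2)
      (Primrec.snd.comp .unpair)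
    obtain ⟨l, hl⟩ := exists_index_of_primrec₂ (f := fun _ n => n.unpair.1)
      (Primrec.fst.comp (Primrec.unpair.comp .snd))
    refine ⟨idx [4, idx [4, e, l], r], ?_⟩
    rintro ⟨x, y⟩ h
    have h1 : encode (x, y) = Nat.pair x y := rfl
    refine Comp.comp _ _ _ _ _ (hr _ _) (Comp.comp _ _ _ _ _ (hl _ _ _) ?_)
    rw [h1, Nat.unpair_pair]
    exact (he x y h).append _

theorem computableRel_iff {R : ℕ → ℕ → Prop} :
    ComputableRel R ↔ DecOn (fun _ : ℕ × ℕ => True) fun q => R q.1 q.2 := by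
  rw [DecOn, compOn_prod_iff]
  refine exists_congr fun e => forall₂_congr fun x y => ?_
  by_cases h : R x y <;> simp [h]

/-- The lengths of the computations below `x` are well-ordered in a computable way, by the
comparison of lengths. -/
theorem computableOrdinal_rk {x : Node} (hx : Conv x) : ComputableOrdinal (rk x) := by
  set N : ℕ → Node := Denumerable.ofNat Node with hN
  have pN : Primrec N := Primrec.ofNat Node
  -- each ordinal below `rk x` is represented by the least code of a computation of that length
  set D : ℕ → Prop := fun y => ¬ StageLE x (N y) ∧ ∀ y', y' < y → ¬ StageLE x (N y') →
    StageLE (N y') (N y) → ¬ StageLE (N y) (N y') with hD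
  have hsm (y : ℕ) : ¬ StageLE x (N y) ↔ Conv (N y) ∧ rk (N y) < rk x := by
    constructor
    · intro h
      have hy := Conv.of_not_stageLE (Or.inl hx) h
      exact ⟨hy, not_le.1 fun h' => h ⟨hx, fun _ => h'⟩⟩
    · rintro ⟨hy, h⟩ h'
      exact (h'.2 hy).not_gt h
  set R : ℕ → ℕ → Prop := fun y z => D y ∧ D z ∧ StageLE (N y) (N z) with hR
  have hsmD : DecOn (fun _ : ℕ => True) fun y => ¬ StageLE x (N y) :=
    (decOn_stageLE.comp ((Primrec.const x).pair pN)).not.mono (fun _ _ => Or.inl hx)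
      fun _ _ => Iff.rfl
  have hDD : DecOn (fun _ : ℕ => True) D := by
    refine hsmD.and ((DecOn.forall (α := ℕ) (β := ℕ)
      (D := fun q => Conv (N q.1)) (P := fun q => q.2 < q.1 → ¬ StageLE x (N q.2) →
        StageLE (N q.2) (N q.1) → ¬ StageLE (N q.1) (N q.2)) ?_).mono
        (fun y hy _ => ((hsm y).1 hy.2).1) fun _ _ => Iff.rfl)
    have p1 : Primrec fun q : ℕ × ℕ => N q.1 := pN.comp .fst
    have p2 : Primrec fun q : ℕ × ℕ => N q.2 := pN.comp .snd
    exact (DecOn.of_primrecPred (Primrec.nat_lt.comp .snd .fst)).imp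
      (((hsmD.comp .snd).mono (fun _ _ => trivial) fun _ _ => Iff.rfl).imp
      (((decOn_stageLE.comp (p2.pair p1)).mono (fun q hq => Or.inr hq.1.1) fun _ _ => Iff.rfl).imp
      ((decOn_stageLE.comp (p1.pair p2)).not.mono (fun q hq => Or.inl hq.1.1.1)
        fun _ _ => Iff.rfl)))
  have hRD : ComputableRel R := by
    rw [computableRel_iff]
    refine ((hDD.comp .fst).mono (fun _ _ => trivial) fun _ _ => Iff.rfl).and
      (((hDD.comp .snd).mono (fun _ _ => trivial) fun _ _ => Iff.rfl).and
        ((decOn_stageLE.comp ((pN.comp .fst).pair (pN.comp .snd))).mono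
          (fun q hq => Or.inl ((hsm _).1 hq.1.2.1).1) fun _ _ => Iff.rfl))
  have hDR (y : ℕ) : R y y ↔ D y :=
    ⟨fun h => h.1, fun h => ⟨h, h, ((hsm y).1 h.1).1, fun _ => le_rfl⟩⟩
  have hinj (y z : ℕ) (hy : D y) (hz : D z) (h : rk (N y) = rk (N z)) : y = z := by
    have hyc := ((hsm y).1 hy.1).1
    have hzc := ((hsm z).1 hz.1).1
    rcases lt_trichotomy y z with hlt | rfl | hlt
    · exact absurd ⟨hzc, fun _ => h.ge⟩ (hz.2 y hlt hy.1 ⟨hyc, fun _ => h.le⟩)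
    · rfl
    · exact absurd ⟨hyc, fun _ => h.le⟩ (hy.2 z hlt hz.1 ⟨hzc, fun _ => h.ge⟩)
  have hsurj (o : Ordinal.{0}) (ho : o < rk x) : ∃ y, D y ∧ rk (N y) = o := by
    have h1 : ∃ y, Conv (N y) ∧ rk (N y) = o := by
      have hx' := ho.le
      rw [rk, dif_pos hx] at hx'
      obtain ⟨z, hz, rfl⟩ := Acc.mem_range_rank_of_le hx hx'
      have hz' : N (encode z) = z := Denumerable.ofNat_encode z
      exact ⟨encode z, by rw [hz']; exact hz, by rw [hz', rk, dif_pos hz]⟩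
    classical
    obtain ⟨h2, h3⟩ := Nat.find_spec h1
    refine ⟨Nat.find h1, ⟨(hsm _).2 ⟨h2, by rw [h3]; exact ho⟩, fun y' hy' hs h4 h5 => ?_⟩, h3⟩
    have hy'c := ((hsm y').1 hs).1
    exact Nat.find_min h1 hy' ⟨hy'c, h3 ▸ le_antisymm (h4.2 h2) (h5.2 hy'c)⟩
  have hlt (y z : ℕ) (hy : D y) (hz : D z) : (R y z ∧ y ≠ z) ↔ rk (N y) < rk (N z) := by
    have hyc := ((hsm y).1 hy.1).1
    have hzc := ((hsm z).1 hz.1).1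
    constructor
    · rintro ⟨⟨_, _, h⟩, hne⟩
      exact lt_of_le_of_ne (h.2 hzc) fun h' => hne (hinj y z hy hz h')
    · intro h
      exact ⟨⟨hy, hz, hyc, fun _ => h.le⟩, fun h' => h.ne (by rw [h'])⟩
  let φ : {y : ℕ // R y y} → (rk x).ToType := fun y =>
    Ordinal.ToType.mk ⟨rk (N y.1), ((hsm y.1).1 ((hDR y.1).1 y.2).1).2⟩
  have hφ : Function.Bijective φ := by
    constructor
    · intro y z h
      have := Ordinal.ToType.mk.injective h
      exact Subtype.ext (hinj _ _ ((hDR _).1 y.2) ((hDR _).1 z.2) (congrArg Subtype.val this))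
    · intro o
      obtain ⟨⟨o, ho⟩, rfl⟩ := Ordinal.ToType.mk.surjective o
      obtain ⟨y, hy, rfl⟩ := hsurj o ho
      exact ⟨⟨y, (hDR y).2 hy⟩, rfl⟩
  let iso : (fun y z : {y : ℕ // R y y} => R y.1 z.1 ∧ y ≠ z) ≃r
      ((· < ·) : (rk x).ToType → (rk x).ToType → Prop) :=
    { toEquiv := Equiv.ofBijective φ hφ
      map_rel_iff' := by
        intro y z
        have h1 : φ y < φ z ↔ rk (N y.1) < rk (N z.1) := by
          simp only [φ, OrderIso.lt_iff_lt]
          exact Iff.rfl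
        rw [Equiv.ofBijective_apply, Equiv.ofBijective_apply, h1,
          ← hlt _ _ ((hDR _).1 y.2) ((hDR _).1 z.2), Ne, Ne, Subtype.ext_iff] }
  have hwo : IsWellOrder {y : ℕ // R y y} (fun y z => R y.1 z.1 ∧ y ≠ z) :=
    iso.toRelEmbedding.isWellOrder
  refine ⟨R, hRD, hwo, ?_⟩
  rw [← Ordinal.type_toType (rk x)]
  exact Ordinal.type_eq.2 ⟨iso⟩

/-- A computable well-ordering embeds into the lengths of computations, by recursion along it. -/
theorem ComputableOrdinal.lt_convSup {α : Ordinal.{0} } (h : ComputableOrdinal α) :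
    α < convSup := by
  obtain ⟨R, hR, hwo, rfl⟩ := h
  rw [computableRel_iff] at hR
  -- `{t}(w)` runs `{t}(s)` for all predecessors `s` of `w`
  set B : ℕ → ℕ → Prop := fun u w => R u u ∧ R u w ∧ u ≠ w with hB
  have hBD : DecOn (fun _ : ℕ × ℕ × ℕ => True) fun q => B q.2.1 q.2.2 :=
    ((hR.comp ((Primrec.fst.comp .snd).pair (Primrec.fst.comp .snd))).mono
      (fun _ _ => trivial) fun _ _ => Iff.rfl).and
    (((hR.comp .snd).mono (fun _ _ => trivial) fun _ _ => Iff.rfl).and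
      (DecOn.of_primrecPred (Primrec.eq.comp (Primrec.fst.comp .snd) (Primrec.snd.comp .snd))).not)
  obtain ⟨s, hs⟩ := CompOn.ite hBD (CompOn.of_primrec .fst)
    (CompOn.of_primrec (.const (idx [2, 0])))
  obtain ⟨p, hp⟩ := exists_index_of_primrec₃ (f := fun q => Nat.pair q.2.2 (Nat.pair q.2.1 q.1))
    (Primrec₂.natPair.comp (Primrec.snd.comp .snd)
      (Primrec₂.natPair.comp (Primrec.fst.comp .snd) .fst))
  set sel := idx [6, 3, idx [4, s, p] ] with hsel
  set g := idx [4, idx [9, 1], sel] with hg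
  obtain ⟨t, y₀, f, ht, hy₀, hf⟩ := exists_fixedPoint (idx [8, g])
  have hpos {u w : ℕ} (h : B u w) : Comp sel [u, t, y₀, w] t := by
    have h1 := hs (t, u, w) trivial
    simp only [h, if_true] at h1
    exact Comp.perm _ [u, t, y₀] w [] _ (Comp.comp _ _ _ _ _ (hp _ _ _ _) (h1.append _))
  have hneg {u w : ℕ} (h : ¬ B u w) : Comp sel [u, t, y₀, w] (idx [2, 0]) := by
    have h1 := hs (t, u, w) trivial
    simp only [h, if_false] at h1
    exact Comp.perm _ [u, t, y₀] w [] _ (Comp.comp _ _ _ _ _ (hp _ _ _ _) (h1.append _))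
  have hstep (w : ℕ) (h : ∀ u, B u w → Conv (t, [u])) : Conv (t, [w]) := by
    have h1 (u : ℕ) : ∃ b, Comp g [u, t, y₀, w] b := by
      by_cases hu : B u w
      · exact ⟨_, Comp.comp _ _ _ _ _ (hpos hu) (Comp.enum _ [_] _ _ (h u hu).comp_val)⟩
      · exact ⟨_, Comp.comp _ _ _ _ _ (hneg hu) (Comp.enum _ [_] _ _ (Comp.const 0 _))⟩
    choose r hr using h1
    have h2 : Comp y₀ [y₀, w] (suslin r) := by
      nth_rewrite 1 [hy₀]
      exact Comp.comp _ _ _ _ _ (hf _) (Comp.suslin _ _ r hr)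
    rw [ht]
    exact (Comp.comp _ _ _ _ _ (Comp.const y₀ _) h2).conv
  have hsub (u w : ℕ) (h : B u w) : TransGen Sub (t, [u]) (t, [w]) := by
    have h1 : TransGen Sub (t, [u]) (idx [8, g], [t, y₀, w]) :=
      .tail (.tail (.single (sub_enum t [u] _)) (sub_comp_right (hpos h))) (sub_suslin _ u _)
    have h3 : TransGen Sub (t, [u]) (idx [4, idx [8, g], f], [y₀, w]) :=
      h1.tail (sub_comp_right (hf [w]))
    rw [← hy₀] at h3
    have h4 := h3.tail (sub_comp_right (Comp.const y₀ [w]))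
    rwa [← ht] at h4
  have hconv (w : {w : ℕ // R w w}) : Conv (t, [w.1]) := by
    induction w using hwo.wf.induction with
    | _ w ih =>
      exact hstep w.1 fun u hu => ih ⟨u, hu.1⟩ ⟨hu.2.1, fun h => hu.2.2 (congrArg Subtype.val h)⟩
  obtain ⟨s', hs'⟩ := CompOn.ite (hR.comp (Primrec.id.pair .id))
    (CompOn.of_primrec (.const t)) (CompOn.of_primrec (.const (idx [2, 0])))
  have htop (u : ℕ) (hu : R u u) : Comp s' [u] t := by
    have h1 := hs' u trivial
    simp only [id, hu, if_true] at h1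
    exact h1
  -- a computation that is longer than all `{t}(w)`
  set top : Node := (idx [8, idx [4, idx [9, 1], s'] ], []) with htopdef
  have htopc : Conv top := by
    have h1 (u : ℕ) : ∃ b, Comp (idx [4, idx [9, 1], s']) [u] b := by
      by_cases hu : R u u
      · exact ⟨_, Comp.comp _ _ _ _ _ (htop u hu) (Comp.enum _ [_] [] _ (hconv ⟨u, hu⟩).comp_val)⟩
      · have h2 := hs' u trivial
        simp only [id, hu, if_false] at h2
        exact ⟨_, Comp.comp _ _ _ _ _ h2 (Comp.enum _ [_] [] _ (Comp.const 0 _))⟩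
    choose r hr using h1
    exact (Comp.suslin _ _ r hr).conv
  have hlt (w : {w : ℕ // R w w}) : rk (t, [w.1]) < rk top :=
    htopc.rk_lt_of_transGen (.tail (.tail (.single (sub_enum t [w.1] []))
      (sub_comp_right (htop w.1 w.2))) (sub_suslin _ w.1 _))
  refine lt_of_le_of_lt ?_ (lt_convSup_iff.2 ⟨top, htopc, rfl⟩)
  rw [← Ordinal.type_toType (rk top), Ordinal.type_le_iff']
  refine ⟨RelEmbedding.ofMonotone (fun w => Ordinal.ToType.mk ⟨rk (t, [w.1]), hlt w⟩) ?_⟩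
  intro u w huw
  rw [OrderIso.lt_iff_lt]
  exact (hconv w).rk_lt_of_transGen
    (hsub u.1 w.1 ⟨u.2, huw.1, fun h => huw.2 (Subtype.ext h)⟩)

theorem omegaOneS_eq : omegaOneS = convSup := by
  have h : {α | ¬ ComputableOrdinal α} = Set.Ici convSup := by
    ext α
    rw [Set.mem_Ici, ← not_lt, Set.mem_ofPred_eq, not_iff_not]
    refine ⟨ComputableOrdinal.lt_convSup, fun h => ?_⟩
    obtain ⟨x, hx, rfl⟩ := lt_convSup_iff.1 h
    exact computableOrdinal_rk hx
  rw [omegaOneS, h, csInf_Ici]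

end Ordinals

/-! ### The relative constructible hierarchy -/

section Hierarchy

variable {f : ℕ → Bool}

theorem mem_L {α : Ordinal.{0} } {x : ZFSet.{0} } :
    x ∈ L f α ↔ ∃ β < α, x ∈ defPow f (L f β) := by
  rw [L, ZFSet.mem_iUnion]
  simp

theorem mem_defPow {X Y : ZFSet.{0} } : Y ∈ defPow f X ↔ Y ⊆ X ∧
    (Set.univ : Set (Carrier f X)).Definable₁ setLang {y : Carrier f X | y.1 ∈ Y} := by
  rw [defPow, ZFSet.mem_sep, ZFSet.mem_powerset]

theorem L_mono {α β : Ordinal.{0} } (h : α ≤ β) : L f α ⊆ L f β := by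
  intro x hx
  rw [mem_L] at hx ⊢
  obtain ⟨γ, hγ, hx⟩ := hx
  exact ⟨γ, hγ.trans_le h, hx⟩

theorem L_trans {α : Ordinal.{0} } {x y : ZFSet.{0} } (hx : x ∈ L f α) (hy : y ∈ x) :
    y ∈ L f α := by
  obtain ⟨β, hβ, h⟩ := mem_L.1 hx
  exact L_mono hβ.le ((mem_defPow.1 h).1 hy)

theorem L_mem_L {α β : Ordinal.{0} } (h : β < α) : L f β ∈ L f α := by
  refine mem_L.2 ⟨β, h, mem_defPow.2 ⟨fun _ => id, ?_⟩⟩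
  have : {y : Carrier f (L f β) | y.1 ∈ L f β} = Set.univ := by
    ext y
    simpa using y.2
  rw [this]
  exact Set.definable_univ

end Hierarchy

/-! ### Formulas with de Bruijn indices -/

/-- Formulas of set theory with a predicate, in de Bruijn notation. The connective `nand` and the
quantifier `nall F`, which means `∃ z, ¬ F`, suffice to express all others. -/
inductive Fm : Type
  | mem (i j : ℕ)
  | eq (i j : ℕ)
  | pred (i : ℕ)
  | nand (F G : Fm)
  | nall (F : Fm)

/-- An assignment of values to the variables. Variables without a value are allowed; atomic formulas
about them are false. -/
abbrev Env : Type 1 := ℕ → Option ZFSet.{0}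

/-- The assignment that gives the value `z` to the variable `0` and shifts the other ones. -/
def Env.cons (z : Option ZFSet.{0}) (ρ : Env) : Env
  | 0 => z
  | n + 1 => ρ n

@[simp] theorem Env.cons_zero (z : Option ZFSet.{0}) (ρ : Env) : Env.cons z ρ 0 = z := rfl
@[simp] theorem Env.cons_succ (z : Option ZFSet.{0}) (ρ : Env) (n : ℕ) :
    Env.cons z ρ (n + 1) = ρ n := rfl

/-- Truth of a formula in `(X, ∈, f)`. -/
def sat (f : ℕ → Bool) (X : ZFSet.{0}) : Fm → Env → Prop
  | .mem i j, ρ => ∃ a ∈ ρ i, ∃ b ∈ ρ j, a ∈ b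
  | .eq i j, ρ => ∃ a ∈ ρ i, a ∈ ρ j
  | .pred i, ρ => ∃ a ∈ ρ i, ∃ n : ℕ, f n = true ∧ a = Ordinal.toZFSet (n : Ordinal.{0})
  | .nand F G, ρ => ¬ (sat f X F ρ ∧ sat f X G ρ)
  | .nall F, ρ => ∃ z ∈ X, ¬ sat f X F (Env.cons (some z) ρ)

/-- Negation. -/
def Fm.not (F : Fm) : Fm := .nand F F

/-- Implication. -/
def Fm.imp (F G : Fm) : Fm := .nand F G.not

@[simp] theorem sat_not {f : ℕ → Bool} {X : ZFSet.{0} } {F : Fm} {ρ : Env} :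
    sat f X F.not ρ ↔ ¬ sat f X F ρ := by
  simp [Fm.not, sat]

@[simp] theorem sat_imp {f : ℕ → Bool} {X : ZFSet.{0} } {F G : Fm} {ρ : Env} :
    sat f X (F.imp G) ρ ↔ (sat f X F ρ → sat f X G ρ) := by
  simp [Fm.imp, sat]

/-- A false formula. -/
def Fm.falsum : Fm := (Fm.imp (.eq 0 0) (.eq 0 0)).not

@[simp] theorem sat_falsum {f : ℕ → Bool} {X : ZFSet.{0} } {ρ : Env} :
    ¬ sat f X Fm.falsum ρ := by
  simp [Fm.falsum]

section Translation

variable {P : Type*}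

/-- The de Bruijn index of a variable, where the free variable `p` gets the index `g p` outside of
all quantifiers. -/
def varIdx (g : P → ℕ) {n : ℕ} : P ⊕ Fin n → ℕ
  | .inl p => n + g p
  | .inr k => n - 1 - k

/-- The index of the variable that a term consists of. -/
def termIdx (g : P → ℕ) {n : ℕ} : setLang.Term (P ⊕ Fin n) → ℕ
  | .var v => varIdx g v
  | .func e _ => Empty.elim e

/-- The translation of formulas to de Bruijn notation. -/
def toFm (g : P → ℕ) : ∀ {n : ℕ}, setLang.BoundedFormula P n → Fm
  | _, .falsum => Fm.falsum
  | _, .equal s t => .eq (termIdx g s) (termIdx g t)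
  | _, .rel SetRel.mem ts => .mem (termIdx g (ts 0)) (termIdx g (ts 1))
  | _, .rel SetRel.pred ts => .pred (termIdx g (ts 0))
  | _, .imp φ ψ => (toFm g φ).imp (toFm g ψ)
  | _, .all φ => (Fm.nall (toFm g φ)).not

variable {f : ℕ → Bool} {X : ZFSet.{0} }

theorem env_termIdx [DecidableEq P] {g : P → ℕ} {n : ℕ} (t : setLang.Term (P ⊕ Fin n))
    {val : P → Carrier f X} {xs : Fin n → Carrier f X} {ρ : Env}
    (h₁ : ∀ p ∈ t.varFinsetLeft, ρ (n + g p) = some (val p).1)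
    (h₂ : ∀ k : Fin n, ρ (n - 1 - k) = some (xs k).1) :
    ρ (termIdx g t) = some (t.realize (Sum.elim val xs)).1 := by
  rcases t with ⟨p | k⟩ | ⟨e, _⟩
  · exact h₁ p (by simp [Language.Term.varFinsetLeft])
  · exact h₂ k
  · exact Empty.elim e

theorem sat_toFm [DecidableEq P] {g : P → ℕ} {n : ℕ} (φ : setLang.BoundedFormula P n)
    {val : P → Carrier f X} {xs : Fin n → Carrier f X} {ρ : Env}
    (h₁ : ∀ p ∈ φ.freeVarFinset, ρ (n + g p) = some (val p).1)
    (h₂ : ∀ k : Fin n, ρ (n - 1 - k) = some (xs k).1) :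
    sat f X (toFm g φ) ρ ↔ φ.Realize val xs := by
  induction φ generalizing ρ with
  | falsum => simp [toFm, Language.BoundedFormula.Realize]
  | equal s t =>
    simp only [Language.BoundedFormula.freeVarFinset, Finset.mem_union] at h₁
    rw [toFm, sat, env_termIdx s (fun p hp => h₁ p (Or.inl hp)) h₂,
      env_termIdx t (fun p hp => h₁ p (Or.inr hp)) h₂]
    simp only [Option.mem_def, Option.some.injEq, exists_eq_left',
      Language.BoundedFormula.Realize]
    exact ⟨fun h => Subtype.ext h.symm, fun h => congrArg Subtype.val h.symm⟩
  | rel R ts =>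
    simp only [Language.BoundedFormula.freeVarFinset, Finset.mem_biUnion, Finset.mem_univ,
      true_and] at h₁
    cases R with
    | mem =>
      rw [toFm, sat, env_termIdx (ts 0) (fun p hp => h₁ p ⟨0, hp⟩) h₂,
        env_termIdx (ts 1) (fun p hp => h₁ p ⟨1, hp⟩) h₂]
      simp only [Option.mem_def, Option.some.injEq, exists_eq_left',
        Language.BoundedFormula.Realize]
      exact Iff.rfl
    | pred =>
      rw [toFm, sat, env_termIdx (ts 0) (fun p hp => h₁ p ⟨0, hp⟩) h₂]
      simp only [Option.mem_def, Option.some.injEq, exists_eq_left',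
        Language.BoundedFormula.Realize]
      exact Iff.rfl
  | imp φ ψ ihφ ihψ =>
    simp only [Language.BoundedFormula.freeVarFinset, Finset.mem_union] at h₁
    rw [toFm, sat_imp, Language.BoundedFormula.realize_imp,
      ihφ (fun p hp => h₁ p (Or.inl hp)) h₂, ihψ (fun p hp => h₁ p (Or.inr hp)) h₂]
  | @all n φ ih =>
    simp only [Language.BoundedFormula.freeVarFinset] at h₁
    rw [toFm, sat_not, sat, Language.BoundedFormula.realize_all]
    push Not
    have key (a : Carrier f X) : sat f X (toFm g φ) (Env.cons (some a.1) ρ) ↔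
        φ.Realize val (Fin.snoc xs a) := by
      refine ih (fun p hp => ?_) (fun k => ?_)
      · rw [Nat.add_right_comm, Env.cons_succ, h₁ p hp]
      · induction k using Fin.lastCases with
        | last => simp
        | cast k =>
          have : n + 1 - 1 - (k.castSucc : ℕ) = (n - 1 - k) + 1 := by
            have := k.2
            simp only [Fin.val_castSucc]
            omega
          rw [this, Env.cons_succ, h₂ k]
          simp
    exact ⟨fun h a => (key a).1 (h a.1 a.2), fun h z hz => (key ⟨z, hz⟩).2 (h ⟨z, hz⟩)⟩

/-- `Δ₀` formulas are absolute between transitive sets. -/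
theorem IsDelta0.sat_iff {P : Type} {g : P → ℕ} {n : ℕ} {φ : setLang.BoundedFormula P n}
    (hφ : IsDelta0 φ) {Z : ZFSet.{0} } (hXZ : X ⊆ Z) (hX : ∀ x ∈ X, ∀ y ∈ x, y ∈ X) {ρ : Env}
    (hρ : ∀ i, ∀ a ∈ ρ i, a ∈ X) : sat f X (toFm g φ) ρ ↔ sat f Z (toFm g φ) ρ := by
  induction hφ generalizing ρ with
  | falsum => simp [toFm]
  | equal s t => simp [toFm, sat]
  | rel R ts => cases R <;> simp [toFm, sat]
  | imp _ _ ihφ ihψ => rw [toFm, sat_imp, sat_imp, ihφ hρ, ihψ hρ]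
  | @ball n u φ _ ih =>
    simp only [toFm, sat_not, sat, sat_imp, not_exists, not_and, not_not]
    have hu : termIdx g (Language.Term.var (Sum.map id Fin.castSucc u) :
        setLang.Term (P ⊕ Fin (n + 1))) = varIdx g u + 1 := by
      rcases u with p | k
      · simp [termIdx, varIdx, Nat.add_right_comm]
      · have := k.2
        simp only [termIdx, varIdx, Sum.map_inr, Fin.val_castSucc]
        omega
    have hl : termIdx g (Language.Term.var (Sum.inr (Fin.last n)) :
        setLang.Term (P ⊕ Fin (n + 1))) = 0 := by
      simp [termIdx, varIdx]
    have hmem (z : ZFSet.{0}) : (∃ a ∈ Env.cons (some z) ρ 0,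
        ∃ b ∈ Env.cons (some z) ρ (varIdx g u + 1), a ∈ b) ↔ ∃ b ∈ ρ (varIdx g u), z ∈ b := by
      simp
    simp only [Matrix.cons_val_zero, Matrix.cons_val_one, hu, hl, hmem]
    have hρ' (z : ZFSet.{0}) (hz : z ∈ X) : ∀ i, ∀ a ∈ Env.cons (some z) ρ i, a ∈ X := by
      rintro (_ | i) a ha
      · rw [Env.cons_zero, Option.mem_some_iff] at ha
        exact ha ▸ hz
      · exact hρ i a ha
    constructor
    · rintro h z _ ⟨b, hb, hzb⟩
      have hz := hX b (hρ _ b hb) z hzb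
      exact (ih (hρ' z hz)).1 (h z hz ⟨b, hb, hzb⟩)
    · rintro h z hz hb
      exact (ih (hρ' z hz)).2 (h z (hXZ hz) hb)

/-- The translation from de Bruijn notation, where `σ` tells which variable an index refers to. -/
def ofFm : ∀ {n : ℕ}, Fm → (ℕ → Option (P ⊕ Fin n)) → setLang.BoundedFormula P n
  | _, .mem i j, σ => match σ i, σ j with
    | some u, some v => .rel (l := 2) SetRel.mem ![.var u, .var v]
    | _, _ => .falsum
  | _, .eq i j, σ => match σ i, σ j with
    | some u, some v => .equal (.var u) (.var v)
    | _, _ => .falsum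
  | _, .pred i, σ => match σ i with
    | some u => .rel (l := 1) SetRel.pred ![.var u]
    | _ => .falsum
  | _, .nand F G, σ => (ofFm F σ ⊓ ofFm G σ).not
  | n, .nall F, σ => (ofFm F fun i => match i with
    | 0 => some (.inr (Fin.last n))
    | i + 1 => (σ i).map (Sum.map id Fin.castSucc)).not.ex

theorem realize_ofFm {n : ℕ} (F : Fm) (σ : ℕ → Option (P ⊕ Fin n)) (val : P → Carrier f X)
    (xs : Fin n → Carrier f X) :
    (ofFm F σ).Realize val xs ↔
      sat f X F fun i => (σ i).map fun v => (Sum.elim val xs v).1 := by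
  induction F generalizing n with
  | mem i j =>
    rcases hi : σ i with _ | u <;> rcases hj : σ j with _ | v <;>
      simp [ofFm, sat, hi, hj, Language.BoundedFormula.Realize]
    exact Iff.rfl
  | eq i j =>
    rcases hi : σ i with _ | u <;> rcases hj : σ j with _ | v <;>
      simp [ofFm, sat, hi, hj, Language.BoundedFormula.Realize]
    exact ⟨fun h => congrArg Subtype.val h.symm, fun h => Subtype.ext h.symm⟩
  | pred i =>
    rcases hi : σ i with _ | u <;> simp [ofFm, sat, hi, Language.BoundedFormula.Realize]
    change (∃ n : ℕ, f n = true ∧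
      (Sum.elim val xs u).1 = Ordinal.toZFSet (n : Ordinal.{0})) ↔ _
    exact exists_congr fun _ => and_comm
  | nand F G ihF ihG => simp [ofFm, sat, ihF, ihG]
  | nall F ih =>
    simp only [ofFm, sat, Language.BoundedFormula.realize_ex,
      Language.BoundedFormula.realize_not, ih]
    have key (a : Carrier f X) : (fun i => ((match i with
        | 0 => some (.inr (Fin.last n))
        | i + 1 => (σ i).map (Sum.map id Fin.castSucc) : Option (P ⊕ Fin (n + 1)))).map
          fun v => (Sum.elim val (Fin.snoc xs a) v : Carrier f X).1) =
        Env.cons (some a.1) fun i => (σ i).map fun v => (Sum.elim val xs v).1 := by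
      funext i
      rcases i with _ | i
      · simp
      · rcases hi : σ i with _ | u | k <;> simp [hi]
    simp only [key]
    exact ⟨fun ⟨a, ha⟩ => ⟨a.1, a.2, ha⟩, fun ⟨z, hz, h⟩ => ⟨⟨z, hz⟩, h⟩⟩

end Translation

section Definable

variable {f : ℕ → Bool} {X : ZFSet.{0} }

/-- With parameters for the free variables, the two kinds of formulas define the same sets. -/
theorem sep_sat_mem_defPow (F : Fm) (ρ : Env) (hρ : ∀ i, ∀ a ∈ ρ i, a ∈ X) :
    X.sep (fun x => sat f X F (Env.cons (some x) ρ)) ∈ defPow f X := by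
  classical
  refine mem_defPow.2 ⟨fun x hx => (ZFSet.mem_sep.1 hx).1, ?_⟩
  rw [Set.Definable₁, Set.definable_iff_exists_formula_sum]
  let σ : ℕ → Option (((Set.univ : Set (Carrier f X)) ⊕ Fin 1) ⊕ Fin 0)
    | 0 => some (.inl (.inr 0))
    | i + 1 => if h : ∃ a, ρ i = some a then
        some (.inl (.inl ⟨⟨h.choose, hρ i _ h.choose_spec⟩, trivial⟩)) else none
  refine ⟨ofFm F σ, ?_⟩
  ext v
  change (v 0).1 ∈ X.sep _ ↔ _
  rw [ZFSet.mem_sep]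
  have key : (fun i => (σ i).map fun w => (Sum.elim (Sum.elim (fun a => a.1) v) default w :
      Carrier f X).1) = Env.cons (some (v 0).1) ρ := by
    funext i
    rcases i with _ | i
    · simp [σ]
    · by_cases h : ∃ a, ρ i = some a
      · simp only [σ, dif_pos h, Option.map_some, Sum.elim_inl, Env.cons_succ]
        exact h.choose_spec.symm
      · simp only [σ, dif_neg h, Option.map_none, Env.cons_succ]
        rcases hi : ρ i with _ | a
        · rfl
        · exact absurd ⟨a, hi⟩ h
  have h2 := realize_ofFm F σ (Sum.elim (fun a => a.1) v) default
  rw [key] at h2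
  exact ⟨fun h => h2.2 h.2, fun h => ⟨(v 0).2, h2.1 h⟩⟩

theorem exists_sat_of_mem_defPow {Y : ZFSet.{0} } (h : Y ∈ defPow f X) :
    ∃ (F : Fm) (l : List ZFSet.{0}), (∀ a ∈ l, a ∈ X) ∧
      Y = X.sep fun x => sat f X F (Env.cons (some x) fun i => l[i]?) := by
  classical
  obtain ⟨hY, h⟩ := mem_defPow.1 h
  rw [Set.Definable₁, Set.definable_iff_exists_formula_sum] at h
  obtain ⟨φ, hφ⟩ := h
  let l := φ.freeVarFinset.toList
  let g : (Set.univ : Set (Carrier f X)) ⊕ Fin 1 → ℕ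
    | .inl a => (if h : ∃ i, l[i]? = some (.inl a) then h.choose else 0) + 1
    | .inr _ => 0
  let v₀ : (Set.univ : Set (Carrier f X)) ⊕ Fin 1 → Option ZFSet.{0}
    | .inl a => some a.1.1
    | .inr _ => none
  by_cases hX : ∃ x₀, x₀ ∈ X
  · obtain ⟨x₀, hx₀⟩ := hX
    refine ⟨toFm g φ, l.map fun p => (v₀ p).getD x₀, ?_, ?_⟩
    · intro a ha
      obtain ⟨p, _, rfl⟩ := List.mem_map.1 ha
      rcases p with p | p
      exacts [p.1.2, hx₀]
    · ext x
      rw [ZFSet.mem_sep]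
      have key (hx : x ∈ X) : x ∈ Y ↔ φ.Realize (Sum.elim (fun a => a.1)
          fun _ => (⟨x, hx⟩ : Carrier f X)) :=
        Set.ext_iff.1 hφ fun _ => ⟨x, hx⟩
      have key2 (hx : x ∈ X) := sat_toFm (g := g) φ
        (val := Sum.elim (fun a => a.1) fun _ => (⟨x, hx⟩ : Carrier f X)) (xs := default)
        (ρ := Env.cons (some x) fun i => (l.map fun p => (v₀ p).getD x₀)[i]?) (by
          intro p hp
          rcases p with p | p
          · have hp' : ∃ i, l[i]? = some (Sum.inl p) :=
              List.mem_iff_getElem?.1 (Finset.mem_toList.2 hp)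
            rw [Nat.zero_add]
            simp only [g, dif_pos hp', Env.cons_succ]
            rw [List.getElem?_map, hp'.choose_spec]
            rfl
          · rfl) (fun k => k.elim0)
      exact ⟨fun h => ⟨hY h, (key2 (hY h)).2 ((key (hY h)).1 h)⟩,
        fun h => (key h.1).2 ((key2 h.1).1 h.2)⟩
  · refine ⟨.eq 0 0, [], by simp, ?_⟩
    ext x
    rw [ZFSet.mem_sep]
    exact ⟨fun h => absurd ⟨x, hY h⟩ hX, fun h => absurd ⟨x, h.1⟩ hX⟩

end Definable

/-! ### Names for the elements of the hierarchy -/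

section Names

open Encodable

theorem unpair_snd_lt {n : ℕ} (h : n.unpair.1 ≠ 0) : n.unpair.2 < n := by
  have h1 := Nat.pair_unpair n
  have h2 : n.unpair.2 < Nat.pair n.unpair.1 n.unpair.2 := by
    rw [Nat.pair]
    split_ifs with h'
    · have : n.unpair.2 ≤ n.unpair.2 * n.unpair.2 := Nat.le_mul_self _
      omega
    · have : n.unpair.1 ≤ n.unpair.1 * n.unpair.1 := Nat.le_mul_self _
      omega
  omega

/-- The formula coded by a natural number. -/
def fmDec (n : ℕ) : Fm :=
  if _h : n.unpair.1 ≤ 2 then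
    if n.unpair.1 = 0 then .mem n.unpair.2.unpair.1 n.unpair.2.unpair.2
    else if n.unpair.1 = 1 then .eq n.unpair.2.unpair.1 n.unpair.2.unpair.2
    else .pred n.unpair.2
  else
    if n.unpair.1 = 3 then .nand (fmDec n.unpair.2.unpair.1) (fmDec n.unpair.2.unpair.2)
    else .nall (fmDec n.unpair.2)
termination_by n
decreasing_by
  · exact (Nat.unpair_left_le _).trans_lt (unpair_snd_lt (by omega))
  · exact (Nat.unpair_right_le _).trans_lt (unpair_snd_lt (by omega))
  · exact unpair_snd_lt (by omega)

theorem exists_fmDec_eq (F : Fm) : ∃ n, fmDec n = F := by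
  induction F with
  | mem i j => exact ⟨Nat.pair 0 (Nat.pair i j), by rw [fmDec]; simp⟩
  | eq i j => exact ⟨Nat.pair 1 (Nat.pair i j), by rw [fmDec]; simp⟩
  | pred i => exact ⟨Nat.pair 2 i, by rw [fmDec]; simp⟩
  | nand F G ihF ihG =>
    obtain ⟨m, rfl⟩ := ihF
    obtain ⟨n, rfl⟩ := ihG
    exact ⟨Nat.pair 3 (Nat.pair m n), by rw [fmDec]; simp⟩
  | nall F ih =>
    obtain ⟨m, rfl⟩ := ih
    exact ⟨Nat.pair 4 m, by rw [fmDec]; simp⟩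

/-- The label of a name. A name with label `b` and formula `F` is meant to denote the set of the
elements of the level of `b` that satisfy `F`. -/
def lev (n : ℕ) : ℕ := n.unpair.1

/-- The code of the formula of a name. -/
def body (n : ℕ) : ℕ := n.unpair.2.unpair.1

/-- The parameters of a name. -/
def params (n : ℕ) : List ℕ := Denumerable.ofNat (List ℕ) n.unpair.2.unpair.2

theorem lt_of_mem_params {n y : ℕ} (h : y ∈ params n) : y < n := by
  have key (l : List ℕ) : y ∈ l → y < encode l := by
    induction l with
    | nil => simp
    | cons a l ih =>
      intro h
      rw [encode_list_cons, Nat.succ_eq_add_one, Nat.lt_succ_iff]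
      rcases List.mem_cons.1 h with rfl | h
      · exact Nat.left_le_pair _ _
      · exact (ih h).le.trans (Nat.right_le_pair _ _)
  have h1 := key _ h
  rw [params, Denumerable.encode_ofNat] at h1
  exact h1.trans_le ((Nat.unpair_right_le _).trans (Nat.unpair_right_le _))

/-- A partial assignment of ordinals to natural numbers. -/
abbrev Labelling : Type 1 := ℕ → Option Ordinal.{0}

/-- Both labels are assigned ordinals, in increasing order. -/
def LabLT (lab : Labelling) (a b : ℕ) : Prop := ∃ α ∈ lab a, ∃ β ∈ lab b, α < β

/-- The level of the hierarchy that belongs to a label, and `0` for labels without an ordinal. -/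
noncomputable def lvl (lab : Labelling) (b : ℕ) : Ordinal.{0} := (lab b).getD 0

theorem LabLT.lvl_lt {lab : Labelling} {a b : ℕ} (h : LabLT lab a b) : lvl lab a < lvl lab b := by
  obtain ⟨α, ha, β, hb, h⟩ := h
  rw [Option.mem_def] at ha hb
  simpa [lvl, ha, hb] using h

open Classical in
/-- The set denoted by a name. Parameters whose label is not below that of the name are ignored. -/
noncomputable def interp (lab : Labelling) (f : ℕ → Bool) (n : ℕ) : ZFSet.{0} :=
  (L f (lvl lab (lev n))).sep fun x =>
    sat f (L f (lvl lab (lev n))) (fmDec (body n)) (Env.cons (some x) fun i =>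
      if _h : (params n).getD i 0 < n ∧ LabLT lab (lev ((params n).getD i 0)) (lev n) then
        some (interp lab f ((params n).getD i 0)) else none)
termination_by n
decreasing_by exact _h.1

open Classical in
/-- The values of a list of names as an assignment; names with labels not below `b` are ignored. -/
noncomputable def envOf (lab : Labelling) (f : ℕ → Bool) (b : ℕ) (v : List ℕ) : Env := fun i =>
  if LabLT lab (lev (v.getD i 0)) b then some (interp lab f (v.getD i 0)) else none

/-- The labels represent an initial segment of the ordinals, and `0` is not a label. -/
structure Labelling.IsInitial (lab : Labelling) : Prop where
  zero : lab 0 = none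
  exists_eq : ∀ b, ∀ β ∈ lab b, ∀ α < β, ∃ a, lab a = some α

variable {lab : Labelling} {f : ℕ → Bool}

theorem Labelling.IsInitial.not_labLT_zero (hl : lab.IsInitial) (b : ℕ) :
    ¬ LabLT lab (lev 0) b := by
  rintro ⟨α, ha, _⟩
  have : lev 0 = 0 := by simp [lev]
  rw [this, hl.zero] at ha
  exact Option.not_mem_none _ ha

/-- Parameters are smaller than the name, so that the guard in `interp` is void. -/
theorem interp_eq (hl : lab.IsInitial) (n : ℕ) : interp lab f n =
    (L f (lvl lab (lev n))).sep fun x => sat f (L f (lvl lab (lev n))) (fmDec (body n))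
      (Env.cons (some x) (envOf lab f (lev n) (params n))) := by
  rw [interp]
  congr
  funext x
  congr 2
  funext i
  rw [envOf]
  by_cases h : LabLT lab (lev ((params n).getD i 0)) (lev n)
  · have h' : (params n).getD i 0 < n := by
      by_cases hi : i < (params n).length
      · rw [List.getD_eq_getElem _ _ hi]
        exact lt_of_mem_params (List.getElem_mem hi)
      · rw [List.getD_eq_default _ _ (not_lt.1 hi)] at h
        exact absurd h (hl.not_labLT_zero _)
    rw [dif_pos ⟨h', h⟩, if_pos h]
  · rw [dif_neg fun h' => h h'.2, if_neg h]

theorem envOf_cons {b z : ℕ} (v : List ℕ) (h : LabLT lab (lev z) b) :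
    envOf lab f b (z :: v) = Env.cons (some (interp lab f z)) (envOf lab f b v) := by
  funext i
  rcases i with _ | i
  · simp [envOf, h]
  · rw [Env.cons_succ]
    rfl

theorem interp_subset (hl : lab.IsInitial) (n : ℕ) : interp lab f n ⊆ L f (lvl lab (lev n)) := by
  rw [interp_eq hl]
  exact fun x hx => (ZFSet.mem_sep.1 hx).1

theorem interp_mem_defPow (hl : lab.IsInitial) (n : ℕ) :
    interp lab f n ∈ defPow f (L f (lvl lab (lev n))) := by
  induction n using Nat.strong_induction_on with
  | _ n ih =>
    rw [interp_eq hl]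
    refine sep_sat_mem_defPow _ _ fun i a ha => ?_
    rw [envOf] at ha
    split_ifs at ha with h
    · rw [Option.mem_some_iff] at ha
      subst ha
      refine mem_L.2 ⟨_, h.lvl_lt, ih _ ?_⟩
      by_cases hi : i < (params n).length
      · rw [List.getD_eq_getElem _ _ hi]
        exact lt_of_mem_params (List.getElem_mem hi)
      · rw [List.getD_eq_default _ _ (not_lt.1 hi)] at h
        exact absurd h (hl.not_labLT_zero _)
    · exact absurd ha (Option.not_mem_none _)

/-- Each element of the hierarchy that first appears after the level of a label has a name with that
label. -/
theorem exists_interp_eq (hl : lab.IsInitial) (α : Ordinal.{0}) : ∀ b, lab b = some α →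
    ∀ x ∈ defPow f (L f α), ∃ n, lev n = b ∧ interp lab f n = x := by
  induction α using WellFoundedLT.induction with
  | _ α ih =>
    intro b hb x hx
    obtain ⟨F, l, hlX, rfl⟩ := exists_sat_of_mem_defPow hx
    have h1 (a : ZFSet.{0}) : ∃ y, a ∈ l → LabLT lab (lev y) b ∧ interp lab f y = a := by
      by_cases ha : a ∈ l
      · obtain ⟨γ, hγ, ha'⟩ := mem_L.1 (hlX a ha)
        obtain ⟨c, hc⟩ := hl.exists_eq b α hb γ hγ
        obtain ⟨y, hy, hy'⟩ := ih γ hγ c hc a ha'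
        exact ⟨y, fun _ => ⟨⟨γ, by rw [hy]; exact hc, α, hb, hγ⟩, hy'⟩⟩
      · exact ⟨0, fun h => absurd h ha⟩
    choose N hN using h1
    obtain ⟨e, he⟩ := exists_fmDec_eq F
    have hlv : lvl lab b = α := by simp [lvl, hb]
    refine ⟨Nat.pair b (Nat.pair e (encode (l.map N))), by simp [lev], ?_⟩
    rw [interp_eq hl]
    simp only [lev, body, params, Nat.unpair_pair, Denumerable.ofNat_encode, he, hlv]
    congr
    funext x
    congr 2
    funext i
    rw [envOf]
    by_cases hi : i < l.length
    · have h2 := hN l[i] (List.getElem_mem hi)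
      have h3 : (l.map N).getD i 0 = N l[i] := by
        rw [List.getD_eq_getElem _ _ (by simpa using hi), List.getElem_map]
      rw [h3, if_pos h2.1, h2.2, List.getElem?_eq_getElem hi]
    · rw [List.getD_eq_default _ _ (by simpa using hi), if_neg (hl.not_labLT_zero b),
        List.getElem?_eq_none (not_lt.1 hi)]

/-- The quantifiers over a level of the hierarchy are quantifiers over names. -/
theorem mem_L_lvl_iff (hl : lab.IsInitial) {b : ℕ} {x : ZFSet.{0} } :
    x ∈ L f (lvl lab b) ↔ ∃ z, LabLT lab (lev z) b ∧ interp lab f z = x := by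
  constructor
  · intro hx
    obtain ⟨γ, hγ, hx⟩ := mem_L.1 hx
    rcases hb : lab b with _ | β
    · rw [lvl, hb] at hγ
      exact absurd hγ not_lt_zero
    · have hβ : lvl lab b = β := by simp [lvl, hb]
      obtain ⟨c, hc⟩ := hl.exists_eq b β hb γ (hβ ▸ hγ)
      obtain ⟨z, rfl, hz⟩ := exists_interp_eq hl γ c hc x hx
      exact ⟨z, ⟨γ, hc, β, hb, hβ ▸ hγ⟩, hz⟩
  · rintro ⟨z, hz, rfl⟩
    exact mem_L.2 ⟨_, hz.lvl_lt, interp_mem_defPow hl z⟩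

end Names

/-! ### Statements about names as infinitary propositional formulas -/

section Keys

open Encodable

/-- Codes of statements: the true statement. -/
def kTrue : ℕ := Nat.pair 0 0
/-- The label `a` is below the label `b`. -/
def kLt (a b : ℕ) : ℕ := Nat.pair 1 (Nat.pair a b)
/-- `f m = 1`. -/
def kBit (m : ℕ) : ℕ := Nat.pair 2 m
/-- Not both of the statements `k` and `l` are true. -/
def kNand (k l : ℕ) : ℕ := Nat.pair 3 (Nat.pair k l)
/-- The names in `v` satisfy the formula `F` in the level of the label `b`. -/
def kSat (b F : ℕ) (v : List ℕ) : ℕ := Nat.pair 4 (Nat.pair b (Nat.pair F (encode v)))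
/-- The name `x` denotes an element of `y`. -/
def kMem (x y : ℕ) : ℕ := Nat.pair 5 (Nat.pair x y)
/-- The name `x` does not denote a subset of `y`. -/
def kNSub (x y : ℕ) : ℕ := Nat.pair 6 (Nat.pair x y)
/-- The name `x` does not denote the natural number `n`. -/
def kNNum (x n : ℕ) : ℕ := Nat.pair 7 (Nat.pair x n)
/-- The natural number `m` is an element of `x`. -/
def kHas (x m : ℕ) : ℕ := Nat.pair 8 (Nat.pair x m)
/-- The name `x` denotes a natural number. -/
def kIsNum (x : ℕ) : ℕ := Nat.pair 9 x
/-- Not all names `j ≤ N` with labels below `b₀` satisfy, together with the names in `v`, the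
formula `F` in the level of `b`. -/
def kNAll (N b₀ b F : ℕ) (v : List ℕ) : ℕ :=
  Nat.pair 10 (Nat.pair N (Nat.pair b₀ (Nat.pair b (Nat.pair F (encode v)))))

/-- Negation. -/
def kNot (k : ℕ) : ℕ := kNand k k
/-- Conjunction. -/
def kAnd (k l : ℕ) : ℕ := kNot (kNand k l)
/-- Implication. -/
def kImp (k l : ℕ) : ℕ := kNand k (kNot l)
/-- The names `x` and `y` denote the same set. -/
def kEq (x y : ℕ) : ℕ := kAnd (kNot (kNSub x y)) (kNot (kNSub y x))

/-- The clauses for `kSat b F v`, one of which has to fail. Atomic formulas about names with labels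
not below `b` are false, in accordance with `envOf`. -/
def satClause (b F : ℕ) (v : List ℕ) (j : ℕ) : ℕ :=
  if F.unpair.1 = 0 then
    kNand (kLt (lev (v.getD F.unpair.2.unpair.1 0)) b)
      (kAnd (kLt (lev (v.getD F.unpair.2.unpair.2 0)) b)
        (kMem (v.getD F.unpair.2.unpair.1 0) (v.getD F.unpair.2.unpair.2 0)))
  else if F.unpair.1 = 1 then
    kNand (kLt (lev (v.getD F.unpair.2.unpair.1 0)) b)
      (kAnd (kLt (lev (v.getD F.unpair.2.unpair.2 0)) b)
        (kEq (v.getD F.unpair.2.unpair.1 0) (v.getD F.unpair.2.unpair.2 0)))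
  else if F.unpair.1 = 2 then
    kNand (kLt (lev (v.getD F.unpair.2 0)) b)
      (kAnd (kBit j) (kNot (kNNum (v.getD F.unpair.2 0) j)))
  else if F.unpair.1 = 3 then
    if j = 0 then kSat b F.unpair.2.unpair.1 v else kSat b F.unpair.2.unpair.2 v
  else kImp (kLt (lev j) b) (kSat b F.unpair.2 (j :: v))

/-- The clauses for the statement coded by `k`: it holds if and only if one of the statements coded
by `clause k j` fails. For `kNNum x n`, the even `j` compare the natural numbers in `x` with those
below `n`, and the odd `j` state that all elements of `x` are natural numbers. -/
def clause (k j : ℕ) : ℕ :=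
  if k.unpair.1 = 3 then if j = 0 then k.unpair.2.unpair.1 else k.unpair.2.unpair.2
  else if k.unpair.1 = 4 then
    satClause k.unpair.2.unpair.1 k.unpair.2.unpair.2.unpair.1
      (Denumerable.ofNat (List ℕ) k.unpair.2.unpair.2.unpair.2) j
  else if k.unpair.1 = 5 then
    kNand (kLt (lev j) (lev k.unpair.2.unpair.2)) (kAnd (kEq k.unpair.2.unpair.1 j)
      (kSat (lev k.unpair.2.unpair.2) (body k.unpair.2.unpair.2)
        (j :: params k.unpair.2.unpair.2)))
  else if k.unpair.1 = 6 then
    kImp (kLt (lev j) (lev k.unpair.2.unpair.1))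
      (kImp (kMem j k.unpair.2.unpair.1) (kMem j k.unpair.2.unpair.2))
  else if k.unpair.1 = 7 then
    if j % 2 = 0 then
      if j / 2 < k.unpair.2.unpair.2 then kHas k.unpair.2.unpair.1 (j / 2)
      else kNot (kHas k.unpair.2.unpair.1 (j / 2))
    else kImp (kLt (lev (j / 2)) (lev k.unpair.2.unpair.1))
      (kImp (kMem (j / 2) k.unpair.2.unpair.1) (kIsNum (j / 2)))
  else if k.unpair.1 = 8 then
    kNand (kLt (lev j) (lev k.unpair.2.unpair.1))
      (kAnd (kMem j k.unpair.2.unpair.1) (kNot (kNNum j k.unpair.2.unpair.2)))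
  else if k.unpair.1 = 9 then kNNum k.unpair.2 j
  else if k.unpair.1 = 10 ∧ j ≤ k.unpair.2.unpair.1 then
    kImp (kLt (lev j) k.unpair.2.unpair.2.unpair.1)
      (kSat k.unpair.2.unpair.2.unpair.2.unpair.1 k.unpair.2.unpair.2.unpair.2.unpair.2.unpair.1
        (j :: Denumerable.ofNat (List ℕ) k.unpair.2.unpair.2.unpair.2.unpair.2.unpair.2))
  else kTrue

variable {lab : Labelling} {f : ℕ → Bool} {T T' : ℕ → Prop}

theorem exists_not_ite_iff {k l : ℕ} :
    (∃ j, ¬ T (if j = 0 then k else l)) ↔ ¬ (T k ∧ T l) := by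
  constructor
  · rintro ⟨j, hj⟩ ⟨h1, h2⟩
    split_ifs at hj
    exacts [hj h1, hj h2]
  · intro h1
    by_cases h2 : T k
    · exact ⟨1, fun h3 => h1 ⟨h2, h3⟩⟩
    · exact ⟨0, h2⟩

theorem exists_clause_kNand {k l : ℕ} :
    (∃ j, ¬ T (clause (kNand k l) j)) ↔ ¬ (T k ∧ T l) := by
  have key (j : ℕ) : clause (kNand k l) j = if j = 0 then k else l := by simp [clause, kNand]
  simp only [key, exists_not_ite_iff]

theorem exists_clause_kSat_nand {b F : ℕ} {v : List ℕ} (hF : F.unpair.1 = 3) :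
    (∃ j, ¬ T (clause (kSat b F v) j)) ↔
      ¬ (T (kSat b F.unpair.2.unpair.1 v) ∧ T (kSat b F.unpair.2.unpair.2 v)) := by
  have key (j : ℕ) : clause (kSat b F v) j =
      if j = 0 then kSat b F.unpair.2.unpair.1 v else kSat b F.unpair.2.unpair.2 v := by
    simp [clause, kSat, satClause, hF]
  simp only [key, exists_not_ite_iff]

theorem exists_clause_kIsNum {x : ℕ} :
    (∃ j, ¬ T (clause (kIsNum x) j)) ↔ ∃ m, ¬ T (kNNum x m) := by
  simp [clause, kIsNum]

/-- The valuation `T` is correct for the atomic statements and the binary connective. -/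
structure IsBasic (lab : Labelling) (f : ℕ → Bool) (T : ℕ → Prop) : Prop where
  top : T kTrue
  lt : ∀ a b, T (kLt a b) ↔ LabLT lab a b
  bit : ∀ m, T (kBit m) ↔ f m = Bool.true
  nand : ∀ k l, T (kNand k l) ↔ ¬ (T k ∧ T l)

theorem IsBasic.not (h : IsBasic lab f T) (k : ℕ) : T (kNot k) ↔ ¬ T k := by simp [kNot, h.nand]
theorem IsBasic.and (h : IsBasic lab f T) (k l : ℕ) : T (kAnd k l) ↔ T k ∧ T l := by
  simp [kAnd, h.nand, h.not]
theorem IsBasic.imp (h : IsBasic lab f T) (k l : ℕ) : T (kImp k l) ↔ (T k → T l) := by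
  simp [kImp, h.nand, h.not]
theorem IsBasic.eq (h : IsBasic lab f T) (x y : ℕ) :
    T (kEq x y) ↔ ¬ T (kNSub x y) ∧ ¬ T (kNSub y x) := by simp [kEq, h.and, h.not]

namespace IsBasic

theorem sat_mem (h : IsBasic lab f T) {b F : ℕ} {v : List ℕ} (hF : F.unpair.1 = 0) :
    (∃ j, ¬ T (clause (kSat b F v) j)) ↔ LabLT lab (lev (v.getD F.unpair.2.unpair.1 0)) b ∧
      LabLT lab (lev (v.getD F.unpair.2.unpair.2 0)) b ∧
      T (kMem (v.getD F.unpair.2.unpair.1 0) (v.getD F.unpair.2.unpair.2 0)) := by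
  simp [clause, kSat, satClause, hF, h.nand, h.and, h.lt]

theorem sat_eq (h : IsBasic lab f T) {b F : ℕ} {v : List ℕ} (hF : F.unpair.1 = 1) :
    (∃ j, ¬ T (clause (kSat b F v) j)) ↔ LabLT lab (lev (v.getD F.unpair.2.unpair.1 0)) b ∧
      LabLT lab (lev (v.getD F.unpair.2.unpair.2 0)) b ∧
      ¬ T (kNSub (v.getD F.unpair.2.unpair.1 0) (v.getD F.unpair.2.unpair.2 0)) ∧
      ¬ T (kNSub (v.getD F.unpair.2.unpair.2 0) (v.getD F.unpair.2.unpair.1 0)) := by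
  simp [clause, kSat, satClause, hF, h.nand, h.and, h.lt, h.eq]

theorem sat_pred (h : IsBasic lab f T) {b F : ℕ} {v : List ℕ} (hF : F.unpair.1 = 2) :
    (∃ j, ¬ T (clause (kSat b F v) j)) ↔ ∃ j, LabLT lab (lev (v.getD F.unpair.2 0)) b ∧
      f j = Bool.true ∧ ¬ T (kNNum (v.getD F.unpair.2 0) j) := by
  simp [clause, kSat, satClause, hF, h.nand, h.and, h.lt, h.not, h.bit]

theorem sat_nall (h : IsBasic lab f T) {b F : ℕ} {v : List ℕ} (hF : 3 < F.unpair.1) :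
    (∃ j, ¬ T (clause (kSat b F v) j)) ↔
      ∃ j, LabLT lab (lev j) b ∧ ¬ T (kSat b F.unpair.2 (j :: v)) := by
  have h0 : F.unpair.1 ≠ 0 := by omega
  have h1 : F.unpair.1 ≠ 1 := by omega
  have h2 : F.unpair.1 ≠ 2 := by omega
  have h3 : F.unpair.1 ≠ 3 := by omega
  have key (j : ℕ) : clause (kSat b F v) j =
      kImp (kLt (lev j) b) (kSat b F.unpair.2 (j :: v)) := by
    rw [clause, kSat]
    simp [satClause, h0, h1, h2, h3]
  simp only [key, h.imp, h.lt, Classical.not_imp]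

theorem mem (h : IsBasic lab f T) (x y : ℕ) : (∃ j, ¬ T (clause (kMem x y) j)) ↔
    ∃ z, LabLT lab (lev z) (lev y) ∧ (¬ T (kNSub x z) ∧ ¬ T (kNSub z x)) ∧
      T (kSat (lev y) (body y) (z :: params y)) := by
  simp [clause, kMem, h.nand, h.and, h.lt, h.eq, and_assoc]

theorem nsub (h : IsBasic lab f T) (x y : ℕ) : (∃ j, ¬ T (clause (kNSub x y) j)) ↔
    ∃ z, LabLT lab (lev z) (lev x) ∧ T (kMem z x) ∧ ¬ T (kMem z y) := by
  simp [clause, kNSub, h.imp, h.lt]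

theorem nnum (h : IsBasic lab f T) (x n : ℕ) : (∃ j, ¬ T (clause (kNNum x n) j)) ↔
    (∃ m, ¬ (m < n ↔ T (kHas x m))) ∨
      ∃ z, LabLT lab (lev z) (lev x) ∧ T (kMem z x) ∧ ¬ T (kIsNum z) := by
  have key (j : ℕ) : clause (kNNum x n) j = if j % 2 = 0 then
      if j / 2 < n then kHas x (j / 2) else kNot (kHas x (j / 2))
      else kImp (kLt (lev (j / 2)) (lev x)) (kImp (kMem (j / 2) x) (kIsNum (j / 2))) := by
    simp [clause, kNNum]
  simp only [key]
  constructor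
  · rintro ⟨j, hj⟩
    split_ifs at hj with h1 h2
    · exact Or.inl ⟨_, fun h3 => hj (h3.1 h2)⟩
    · rw [h.not, not_not] at hj
      exact Or.inl ⟨_, fun h3 => h2 (h3.2 hj)⟩
    · rw [h.imp, h.imp, h.lt] at hj
      push Not at hj
      exact Or.inr ⟨_, hj⟩
  · rintro (⟨m, hm⟩ | ⟨z, hz⟩)
    · refine ⟨2 * m, ?_⟩
      have h1 : 2 * m % 2 = 0 := by omega
      have h2 : 2 * m / 2 = m := by omega
      rw [if_pos h1, h2]
      split_ifs with h3
      · simpa [h3] using hm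
      · simpa [h3, h.not] using hm
    · refine ⟨2 * z + 1, ?_⟩
      have h1 : ¬ (2 * z + 1) % 2 = 0 := by omega
      have h2 : (2 * z + 1) / 2 = z := by omega
      rw [if_neg h1, h2, h.imp, h.imp, h.lt]
      push Not
      exact hz

theorem has (h : IsBasic lab f T) (x m : ℕ) : (∃ j, ¬ T (clause (kHas x m) j)) ↔
    ∃ z, LabLT lab (lev z) (lev x) ∧ T (kMem z x) ∧ ¬ T (kNNum z m) := by
  simp [clause, kHas, h.nand, h.and, h.lt, h.not]

theorem nall (h : IsBasic lab f T) (N b₀ b F : ℕ) (v : List ℕ) :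
    (∃ j, ¬ T (clause (kNAll N b₀ b F v) j)) ↔
      ∃ j ≤ N, LabLT lab (lev j) b₀ ∧ ¬ T (kSat b F (j :: v)) := by
  have key (j : ℕ) : clause (kNAll N b₀ b F v) j = if j ≤ N then
      kImp (kLt (lev j) b₀) (kSat b F (j :: v)) else kTrue := by
    simp [clause, kNAll]
  simp only [key]
  refine exists_congr fun j => ?_
  split_ifs with h1
  · simp [h1, h.imp, h.lt]
  · simp [h1, h.top]

end IsBasic

/-- The valuation `T` satisfies all clauses. -/
structure IsValid (lab : Labelling) (f : ℕ → Bool) (T : ℕ → Prop) : Prop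
    extends IsBasic lab f T where
  step : ∀ k, 3 ≤ k.unpair.1 → (T k ↔ ∃ j, ¬ T (clause k j))

end Keys

/-! ### Existence and uniqueness of valuations -/

section Valuation

open Encodable

variable {lab : Labelling} {f : ℕ → Bool} {T T' : ℕ → Prop}

/-- The truth value of the statement with a given code. The names are interpreted directly, so that
the recursion is needed only for the binary connective. -/
noncomputable def truth (lab : Labelling) (f : ℕ → Bool) (k : ℕ) : Prop :=
  if k.unpair.1 = 0 then True
  else if k.unpair.1 = 1 then LabLT lab k.unpair.2.unpair.1 k.unpair.2.unpair.2
  else if k.unpair.1 = 2 then f k.unpair.2 = true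
  else if _h : k.unpair.1 = 3 then
    ¬ (truth lab f k.unpair.2.unpair.1 ∧ truth lab f k.unpair.2.unpair.2)
  else if k.unpair.1 = 4 then
    sat f (L f (lvl lab k.unpair.2.unpair.1)) (fmDec k.unpair.2.unpair.2.unpair.1)
      (envOf lab f k.unpair.2.unpair.1 (Denumerable.ofNat (List ℕ) k.unpair.2.unpair.2.unpair.2))
  else if k.unpair.1 = 5 then interp lab f k.unpair.2.unpair.1 ∈ interp lab f k.unpair.2.unpair.2
  else if k.unpair.1 = 6 then
    ¬ interp lab f k.unpair.2.unpair.1 ⊆ interp lab f k.unpair.2.unpair.2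
  else if k.unpair.1 = 7 then
    interp lab f k.unpair.2.unpair.1 ≠ Ordinal.toZFSet (k.unpair.2.unpair.2 : Ordinal.{0})
  else if k.unpair.1 = 8 then
    Ordinal.toZFSet (k.unpair.2.unpair.2 : Ordinal.{0}) ∈ interp lab f k.unpair.2.unpair.1
  else if k.unpair.1 = 9 then
    ∃ m : ℕ, interp lab f k.unpair.2 = Ordinal.toZFSet (m : Ordinal.{0})
  else if k.unpair.1 = 10 then
    ∃ j ≤ k.unpair.2.unpair.1, LabLT lab (lev j) k.unpair.2.unpair.2.unpair.1 ∧
      ¬ sat f (L f (lvl lab k.unpair.2.unpair.2.unpair.2.unpair.1))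
        (fmDec k.unpair.2.unpair.2.unpair.2.unpair.2.unpair.1)
        (envOf lab f k.unpair.2.unpair.2.unpair.2.unpair.1
          (j :: Denumerable.ofNat (List ℕ) k.unpair.2.unpair.2.unpair.2.unpair.2.unpair.2))
  else False
termination_by k
decreasing_by
  · exact (Nat.unpair_left_le _).trans_lt (unpair_snd_lt (by omega))
  · exact (Nat.unpair_right_le _).trans_lt (unpair_snd_lt (by omega))

theorem truth_isBasic (lab : Labelling) (f : ℕ → Bool) : IsBasic lab f (truth lab f) where
  top := by rw [truth]; simp [kTrue]
  lt a b := by rw [truth]; simp [kLt]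
  bit m := by rw [truth]; simp [kBit]
  nand k l := by rw [truth]; simp [kNand]

theorem truth_kSat {b F : ℕ} {v : List ℕ} : truth lab f (kSat b F v) ↔
    sat f (L f (lvl lab b)) (fmDec F) (envOf lab f b v) := by
  rw [truth]; simp [kSat]

theorem truth_kMem {x y : ℕ} : truth lab f (kMem x y) ↔ interp lab f x ∈ interp lab f y := by
  rw [truth]; simp [kMem]

theorem truth_kNSub {x y : ℕ} : truth lab f (kNSub x y) ↔ ¬ interp lab f x ⊆ interp lab f y := by
  rw [truth]; simp [kNSub]

theorem truth_kNNum {x n : ℕ} : truth lab f (kNNum x n) ↔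
    interp lab f x ≠ Ordinal.toZFSet (n : Ordinal.{0}) := by
  rw [truth]; simp [kNNum]

theorem truth_kHas {x n : ℕ} : truth lab f (kHas x n) ↔
    Ordinal.toZFSet (n : Ordinal.{0}) ∈ interp lab f x := by
  rw [truth]; simp [kHas]

theorem truth_kIsNum {x : ℕ} : truth lab f (kIsNum x) ↔
    ∃ n : ℕ, interp lab f x = Ordinal.toZFSet (n : Ordinal.{0}) := by
  rw [truth]; simp [kIsNum]

theorem truth_kNAll {N b₀ b F : ℕ} {v : List ℕ} : truth lab f (kNAll N b₀ b F v) ↔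
    ∃ j ≤ N, LabLT lab (lev j) b₀ ∧
      ¬ sat f (L f (lvl lab b)) (fmDec F) (envOf lab f b (j :: v)) := by
  rw [truth]; simp [kNAll]

theorem truth_step_kSat (hl : lab.IsInitial) (b F : ℕ) (v : List ℕ) :
    truth lab f (kSat b F v) ↔ ∃ j, ¬ truth lab f (clause (kSat b F v) j) := by
  have hb := truth_isBasic lab f
  rw [truth_kSat, fmDec]
  split_ifs with h h0 h1 h3
  · rw [hb.sat_mem h0, truth_kMem, sat, envOf]
    constructor
    · rintro ⟨a, ha, c, hc, hac⟩
      rw [envOf] at hc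
      split_ifs at ha with h1
      · split_ifs at hc with h2
        · rw [Option.mem_some_iff] at ha hc
          exact ⟨h1, h2, by rwa [ha, hc]⟩
        · exact absurd hc (Option.not_mem_none _)
      · exact absurd ha (Option.not_mem_none _)
    · rintro ⟨h1, h2, h3⟩
      refine ⟨_, ?_, _, ?_, h3⟩
      · rw [if_pos h1]; rfl
      · rw [envOf, if_pos h2]; rfl
  · rw [hb.sat_eq h1, truth_kNSub, truth_kNSub, not_not, not_not, sat, envOf, envOf]
    constructor
    · rintro ⟨a, ha, hc⟩
      split_ifs at ha with h1
      · split_ifs at hc with h2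
        · rw [Option.mem_some_iff] at ha hc
          rw [ha, hc]
          exact ⟨h1, h2, fun _ => id, fun _ => id⟩
        · exact absurd hc (Option.not_mem_none _)
      · exact absurd ha (Option.not_mem_none _)
    · rintro ⟨h1, h2, h3, h4⟩
      refine ⟨interp lab f (v.getD F.unpair.2.unpair.1 0), ?_, ?_⟩
      · rw [if_pos h1]; rfl
      · rw [if_pos h2, Option.mem_some_iff]
        exact ZFSet.ext fun z => ⟨fun hz => h4 hz, fun hz => h3 hz⟩
  · have h2 : F.unpair.1 = 2 := by omega
    rw [hb.sat_pred h2, sat, envOf]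
    simp only [truth_kNNum, not_not]
    constructor
    · rintro ⟨a, ha, n, hn, rfl⟩
      split_ifs at ha with h1
      · rw [Option.mem_some_iff] at ha
        exact ⟨n, h1, hn, ha⟩
      · exact absurd ha (Option.not_mem_none _)
    · rintro ⟨n, h1, hn, h⟩
      exact ⟨_, by rw [if_pos h1]; rfl, n, hn, h⟩
  · rw [exists_clause_kSat_nand h3, truth_kSat, truth_kSat, sat]
  · rw [hb.sat_nall (by omega), sat]
    simp only [truth_kSat]
    constructor
    · rintro ⟨z, hz, h⟩
      obtain ⟨j, hj, rfl⟩ := (mem_L_lvl_iff hl).1 hz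
      exact ⟨j, hj, by rwa [envOf_cons _ hj]⟩
    · rintro ⟨j, hj, h⟩
      exact ⟨_, (mem_L_lvl_iff hl).2 ⟨j, hj, rfl⟩, by rwa [envOf_cons _ hj] at h⟩

theorem exists_name_of_mem_interp (hl : lab.IsInitial) {x : ℕ} {z : ZFSet.{0} }
    (h : z ∈ interp lab f x) : ∃ j, LabLT lab (lev j) (lev x) ∧ interp lab f j = z :=
  (mem_L_lvl_iff hl).1 (interp_subset hl x h)

theorem truth_step_kNNum (hl : lab.IsInitial) (x n : ℕ) :
    truth lab f (kNNum x n) ↔ ∃ j, ¬ truth lab f (clause (kNNum x n) j) := by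
  rw [(truth_isBasic lab f).nnum]
  simp only [truth_kNNum, truth_kHas, truth_kMem, truth_kIsNum]
  rw [← not_iff_not]
  push Not
  constructor
  · intro h
    rw [h]
    refine ⟨fun m => by rw [Ordinal.toZFSet_mem_toZFSet_iff, Nat.cast_lt], fun z _ hz => ?_⟩
    obtain ⟨α, hα, h2⟩ := Ordinal.mem_toZFSet_iff.1 hz
    obtain ⟨m, rfl⟩ := Ordinal.lt_omega0.1 (hα.trans (Ordinal.natCast_lt_omega0 n))
    exact ⟨m, h2.symm⟩
  · rintro ⟨h1, h2⟩
    ext z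
    rw [Ordinal.mem_toZFSet_iff]
    constructor
    · intro hz
      obtain ⟨j, hj, rfl⟩ := exists_name_of_mem_interp hl hz
      obtain ⟨m, hm⟩ := h2 j hj hz
      rw [hm] at hz ⊢
      exact ⟨m, Nat.cast_lt.2 ((h1 m).2 hz), rfl⟩
    · rintro ⟨α, hα, rfl⟩
      obtain ⟨m, rfl⟩ := Ordinal.lt_omega0.1 (hα.trans (Ordinal.natCast_lt_omega0 n))
      exact (h1 m).1 (Nat.cast_lt.1 hα)

theorem exists_eq_pair (n : ℕ) : ∃ a b, n = Nat.pair a b := ⟨_, _, (Nat.pair_unpair n).symm⟩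

theorem exists_eq_encode (n : ℕ) : ∃ v : List ℕ, n = encode v :=
  ⟨_, (Denumerable.encode_ofNat n).symm⟩

/-- The truth values form a valid valuation. -/
theorem truth_isValid (hl : lab.IsInitial) (f : ℕ → Bool) : IsValid lab f (truth lab f) where
  toIsBasic := truth_isBasic lab f
  step k hk := by
    have hb := truth_isBasic lab f
    obtain ⟨t, k, rfl⟩ := exists_eq_pair k
    rw [Nat.unpair_pair] at hk
    simp only at hk
    rcases Nat.lt_or_ge t 11 with ht | ht
    · obtain ⟨x, y, rfl⟩ := exists_eq_pair k
      interval_cases t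
      · rw [← kNand, hb.nand, exists_clause_kNand]
      · obtain ⟨F, v, rfl⟩ := exists_eq_pair y
        obtain ⟨v, rfl⟩ := exists_eq_encode v
        exact truth_step_kSat hl x F v
      · rw [← kMem, hb.mem, truth_kMem, interp_eq hl y, ZFSet.mem_sep]
        simp only [truth_kNSub, truth_kSat, not_not]
        constructor
        · rintro ⟨h1, h2⟩
          obtain ⟨z, hz, hzx⟩ := (mem_L_lvl_iff hl).1 h1
          refine ⟨z, hz, by rw [hzx]; exact ⟨fun _ => id, fun _ => id⟩, ?_⟩
          rwa [envOf_cons _ hz, hzx]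
        · rintro ⟨z, hz, ⟨h1, h2⟩, h3⟩
          have hzx : interp lab f z = interp lab f x :=
            ZFSet.ext fun z => ⟨fun hz => h2 hz, fun hz => h1 hz⟩
          rw [envOf_cons _ hz, hzx] at h3
          exact ⟨(mem_L_lvl_iff hl).2 ⟨z, hz, hzx⟩, h3⟩
      · rw [← kNSub, hb.nsub, truth_kNSub]
        simp only [truth_kMem]
        constructor
        · intro h
          by_contra h1
          refine h fun z hz => ?_
          obtain ⟨j, hj, rfl⟩ := exists_name_of_mem_interp hl hz
          by_contra h2
          exact h1 ⟨j, hj, hz, h2⟩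
        · rintro ⟨z, _, h1, h2⟩ h
          exact h2 (h h1)
      · exact truth_step_kNNum hl x y
      · rw [← kHas, hb.has, truth_kHas]
        simp only [truth_kMem, truth_kNNum, not_not]
        constructor
        · intro h
          obtain ⟨j, hj, h1⟩ := exists_name_of_mem_interp hl h
          exact ⟨j, hj, by rwa [h1], h1⟩
        · rintro ⟨z, _, h1, h2⟩
          rwa [← h2]
      · rw [← kIsNum, exists_clause_kIsNum, truth_kIsNum]
        simp only [truth_kNNum, not_not]
      · obtain ⟨b₀, y, rfl⟩ := exists_eq_pair y
        obtain ⟨b, y, rfl⟩ := exists_eq_pair y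
        obtain ⟨F, v, rfl⟩ := exists_eq_pair y
        obtain ⟨v, rfl⟩ := exists_eq_encode v
        rw [← kNAll, hb.nall, truth_kNAll]
        simp only [truth_kSat]
    · have h1 (j : ℕ) : clause (Nat.pair t k) j = kTrue := by
        rw [clause, Nat.unpair_pair]
        simp (disch := omega) only [if_neg]
      have h2 : ¬ truth lab f (Nat.pair t k) := by
        rw [truth, Nat.unpair_pair]
        simp (disch := omega) only [if_neg, dif_neg]
        exact id
      simp [h1, h2, hb.top]

/-- Valid valuations agree on `kSat` for a label, given agreement on the statements about names with
smaller labels. -/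
theorem IsValid.kSat_congr (hT : IsValid lab f T) (hT' : IsValid lab f T') {b : ℕ}
    (hMem : ∀ x y, LabLT lab (lev x) b → LabLT lab (lev y) b → (T (kMem x y) ↔ T' (kMem x y)))
    (hSub : ∀ x y, LabLT lab (lev x) b → LabLT lab (lev y) b → (T (kNSub x y) ↔ T' (kNSub x y)))
    (hNum : ∀ x n, LabLT lab (lev x) b → (T (kNNum x n) ↔ T' (kNNum x n))) (F : ℕ) :
    ∀ v, T (kSat b F v) ↔ T' (kSat b F v) := by
  induction F using Nat.strong_induction_on with
  | _ F ih =>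
    intro v
    rw [hT.step _ (by simp [kSat]), hT'.step _ (by simp [kSat])]
    rcases Nat.lt_or_ge 3 F.unpair.1 with h | h
    · rw [hT.sat_nall h, hT'.sat_nall h]
      simp only [ih _ (unpair_snd_lt (n := F) (by omega))]
    · interval_cases hF : F.unpair.1
      · rw [hT.sat_mem hF, hT'.sat_mem hF]
        exact and_congr_right fun h1 => and_congr_right fun h2 => hMem _ _ h1 h2
      · rw [hT.sat_eq hF, hT'.sat_eq hF]
        exact and_congr_right fun h1 => and_congr_right fun h2 => by
          rw [hSub _ _ h1 h2, hSub _ _ h2 h1]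
      · rw [hT.sat_pred hF, hT'.sat_pred hF]
        exact exists_congr fun j => and_congr_right fun h1 => by rw [hNum _ _ h1]
      · have h3 : F.unpair.2 < F := unpair_snd_lt (by omega)
        rw [exists_clause_kSat_nand hF, exists_clause_kSat_nand hF,
          ih _ ((Nat.unpair_left_le _).trans_lt h3), ih _ ((Nat.unpair_right_le _).trans_lt h3)]

/-- Valid valuations agree on the statements about names with labels below an ordinal, by induction
on the ordinal. In the clauses of a statement about names, each name is compared only with names of
smaller labels, or the statement has been treated before: in the step, the order is `kSat`, `kMem`
for smaller `x`, `kNSub`, `kMem`, `kHas`, `kNNum`, `kIsNum`. -/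
theorem IsValid.names_congr (hT : IsValid lab f T) (hT' : IsValid lab f T') (β : Ordinal.{0}) :
    ∀ x, (∃ ξ ∈ lab (lev x), ξ < β) →
      ((∀ y, (∃ η ∈ lab (lev y), η < β) →
        (T (kMem x y) ↔ T' (kMem x y)) ∧ (T (kNSub x y) ↔ T' (kNSub x y))) ∧
      (∀ n, T (kNNum x n) ↔ T' (kNNum x n)) ∧ (T (kIsNum x) ↔ T' (kIsNum x))) := by
  induction β using WellFoundedLT.induction with
  | _ β ih =>
    have below (δ : Ordinal.{0}) (x : ℕ) (hx : ∃ ξ ∈ lab (lev x), ξ ≤ δ) (z : ℕ)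
        (hz : LabLT lab (lev z) (lev x)) : ∃ ζ ∈ lab (lev z), ζ < δ := by
      obtain ⟨ζ, hζ, ξ, hξ, h⟩ := hz
      obtain ⟨ξ', hξ', h'⟩ := hx
      rw [Option.mem_unique hξ' hξ] at h'
      exact ⟨ζ, hζ, h.trans_le h'⟩
    -- agreement below `δ` yields agreement for names with labels at most `δ`
    have key (δ : Ordinal.{0}) (hδ : δ < β) :
        (∀ x y, (∃ ξ ∈ lab (lev x), ξ ≤ δ) → (∃ ξ ∈ lab (lev y), ξ ≤ δ) →
          (T (kMem x y) ↔ T' (kMem x y)) ∧ (T (kNSub x y) ↔ T' (kNSub x y))) ∧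
        ∀ x, (∃ ξ ∈ lab (lev x), ξ ≤ δ) →
          (∀ n, T (kNNum x n) ↔ T' (kNNum x n)) ∧ (T (kIsNum x) ↔ T' (kIsNum x)) := by
      have hA := ih δ hδ
      have hlow (y z : ℕ) (hy : ∃ ξ ∈ lab (lev y), ξ ≤ δ) (hz : LabLT lab (lev z) (lev y)) :=
        below δ y hy z hz
      have hSat (y F : ℕ) (v : List ℕ) (hy : ∃ ξ ∈ lab (lev y), ξ ≤ δ) :
          T (kSat (lev y) F v) ↔ T' (kSat (lev y) F v) :=
        hT.kSat_congr hT' (fun w z hw hz => ((hA w (hlow _ _ hy hw)).1 z (hlow _ _ hy hz)).1)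
          (fun w z hw hz => ((hA w (hlow _ _ hy hw)).1 z (hlow _ _ hy hz)).2)
          (fun w n hw => (hA w (hlow _ _ hy hw)).2.1 n) F v
      have hMem₁ (w y : ℕ) (hw : ∃ ξ ∈ lab (lev w), ξ < δ) (hy : ∃ ξ ∈ lab (lev y), ξ ≤ δ) :
          T (kMem w y) ↔ T' (kMem w y) := by
        rw [hT.step _ (by simp [kMem]), hT'.step _ (by simp [kMem]), hT.mem, hT'.mem]
        refine exists_congr fun z => and_congr_right fun hz => ?_
        rw [hSat _ _ _ hy, ((hA w hw).1 z (hlow _ _ hy hz)).2,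
          ((hA z (hlow _ _ hy hz)).1 w hw).2]
      have hSub (x y : ℕ) (hx : ∃ ξ ∈ lab (lev x), ξ ≤ δ) (hy : ∃ ξ ∈ lab (lev y), ξ ≤ δ) :
          T (kNSub x y) ↔ T' (kNSub x y) := by
        rw [hT.step _ (by simp [kNSub]), hT'.step _ (by simp [kNSub]), hT.nsub, hT'.nsub]
        refine exists_congr fun z => and_congr_right fun hz => ?_
        rw [hMem₁ z x (hlow _ _ hx hz) hx, hMem₁ z y (hlow _ _ hx hz) hy]
      have hMem (x y : ℕ) (hx : ∃ ξ ∈ lab (lev x), ξ ≤ δ) (hy : ∃ ξ ∈ lab (lev y), ξ ≤ δ) :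
          T (kMem x y) ↔ T' (kMem x y) := by
        rw [hT.step _ (by simp [kMem]), hT'.step _ (by simp [kMem]), hT.mem, hT'.mem]
        refine exists_congr fun z => and_congr_right fun hz => ?_
        have hz' : ∃ ξ ∈ lab (lev z), ξ ≤ δ := by
          obtain ⟨ξ, h1, h2⟩ := hlow _ _ hy hz
          exact ⟨ξ, h1, h2.le⟩
        rw [hSat _ _ _ hy, hSub x z hx hz', hSub z x hz' hx]
      have hHas (x m : ℕ) (hx : ∃ ξ ∈ lab (lev x), ξ ≤ δ) : T (kHas x m) ↔ T' (kHas x m) := by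
        rw [hT.step _ (by simp [kHas]), hT'.step _ (by simp [kHas]), hT.has, hT'.has]
        refine exists_congr fun z => and_congr_right fun hz => ?_
        rw [hMem₁ z x (hlow _ _ hx hz) hx, (hA z (hlow _ _ hx hz)).2.1 m]
      have hNum (x n : ℕ) (hx : ∃ ξ ∈ lab (lev x), ξ ≤ δ) : T (kNNum x n) ↔ T' (kNNum x n) := by
        rw [hT.step _ (by simp [kNNum]), hT'.step _ (by simp [kNNum]), hT.nnum, hT'.nnum]
        refine or_congr (exists_congr fun m => by rw [hHas x m hx])
          (exists_congr fun z => and_congr_right fun hz => ?_)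
        rw [hMem₁ z x (hlow _ _ hx hz) hx, (hA z (hlow _ _ hx hz)).2.2]
      refine ⟨fun x y hx hy => ⟨hMem x y hx hy, hSub x y hx hy⟩, fun x hx =>
        ⟨fun n => hNum x n hx, ?_⟩⟩
      rw [hT.step _ (by simp [kIsNum]), hT'.step _ (by simp [kIsNum]), exists_clause_kIsNum,
        exists_clause_kIsNum]
      exact exists_congr fun m => by rw [hNum x m hx]
    rintro x ⟨ξ, hξ, h⟩
    refine ⟨?_, (key ξ h).2 x ⟨ξ, hξ, le_rfl⟩⟩
    rintro y ⟨η, hη, h'⟩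
    exact (key (max ξ η) (max_lt h h')).1 x y ⟨ξ, hξ, le_max_left _ _⟩ ⟨η, hη, le_max_right _ _⟩

/-- A valid valuation is correct for the statements coded by `kNAll`. -/
theorem IsValid.kNAll_iff (hl : lab.IsInitial) (hT : IsValid lab f T) {N b₀ b F : ℕ} {v : List ℕ}
    (hb : ∃ β, lab b = some β) : T (kNAll N b₀ b F v) ↔
      ∃ j ≤ N, LabLT lab (lev j) b₀ ∧
        ¬ sat f (L f (lvl lab b)) (fmDec F) (envOf lab f b (j :: v)) := by
  have hT' := truth_isValid hl f
  obtain ⟨β, hβ⟩ := hb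
  have h0 (z : ℕ) (hz : LabLT lab (lev z) b) : ∃ ζ ∈ lab (lev z), ζ < β := by
    obtain ⟨ζ, hζ, β', hβ', h⟩ := hz
    rw [Option.mem_unique hβ' hβ] at h
    exact ⟨ζ, hζ, h⟩
  have hc := hT.names_congr hT' β
  have h1 (v : List ℕ) : T (kSat b F v) ↔ truth lab f (kSat b F v) :=
    hT.kSat_congr hT' (fun w z hw hz => ((hc w (h0 w hw)).1 z (h0 z hz)).1)
      (fun w z hw hz => ((hc w (h0 w hw)).1 z (h0 z hz)).2)
      (fun w n hw => (hc w (h0 w hw)).2.1 n) F v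
  rw [hT.step _ (by simp [kNAll]), hT.nall]
  simp only [h1, truth_kSat]

end Valuation

/-! ### The measure of an analytic set -/

section AnalyticMeasure

open scoped ENNReal

/-- The sequence `⟨h 0, …, h (n - 1)⟩`. -/
def seq (h : ℕ → ℕ) (n : ℕ) : List ℕ := (List.range n).map h

@[simp] theorem length_seq (h : ℕ → ℕ) (n : ℕ) : (seq h n).length = n := by simp [seq]

theorem getD_seq (h : ℕ → ℕ) {n i : ℕ} (hi : i < n) : (seq h n).getD i 0 = h i := by
  rw [List.getD_eq_getElem _ _ (by simpa using hi)]
  simp [seq]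

theorem seq_succ (h : ℕ → ℕ) (n : ℕ) : seq h (n + 1) = seq h n ++ [h n] := by
  simp [seq, List.range_succ]

theorem seq_eq_ofFn (h : ℕ → ℕ) (n : ℕ) : seq h n = List.ofFn fun i : Fin n => h i := by
  apply List.ext_getElem <;> simp [seq]

theorem exists_seq_eq (l : List ℕ) : ∃ h, l = seq h l.length :=
  ⟨fun i => l.getD i 0, by apply List.ext_getElem <;> simp +contextual [seq]⟩

/-- The members of the Cantor space as sequences of natural numbers. -/
def bits (f : ℕ → Bool) (n : ℕ) : ℕ := (f n).toNat

instance : IsProbabilityMeasure cantorMeasure := by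
  unfold cantorMeasure
  infer_instance

theorem measurable_restrict (n : ℕ) : Measurable fun (f : ℕ → Bool) (i : Fin n) => f i := by
  fun_prop

theorem setOf_seq_bits (n : ℕ) (P : List ℕ → Prop) : {f | P (seq (bits f) n)} =
    (fun (f : ℕ → Bool) (i : Fin n) => f i) ⁻¹' {g | P (List.ofFn fun i => (g i).toNat)} := by
  ext f
  simp [seq_eq_ofFn, bits]

theorem measurableSet_seq_bits (n : ℕ) (P : List ℕ → Prop) :
    MeasurableSet {f | P (seq (bits f) n)} := by
  rw [setOf_seq_bits]
  exact measurable_restrict n (Set.toFinite _).measurableSet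

theorem cantorMeasure_restrict_eq {n : ℕ} (g : Fin n → Bool) :
    cantorMeasure ((fun (f : ℕ → Bool) (i : Fin n) => f i) ⁻¹' {g}) = (2⁻¹ : ℝ≥0∞) ^ n := by
  let g' (i : ℕ) : Bool := if h : i < n then g ⟨i, h⟩ else false
  have h : (fun (f : ℕ → Bool) (i : Fin n) => f i) ⁻¹' {g} =
      Set.pi (Finset.range n) fun i => {g' i} := by
    ext f
    simp only [Set.mem_preimage, Set.mem_singleton_iff, Set.mem_pi, Finset.coe_range, Set.mem_Iio]
    constructor
    · rintro rfl i hi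
      simp [g', hi]
    · intro h
      funext i
      rw [h i i.2]
      simp [g', i.2]
  rw [h, cantorMeasure, Measure.infinitePi_pi _ fun i _ => measurableSet_singleton _]
  simp

/-- The measure of a cylinder of depth `n` is a multiple of `2⁻ⁿ`, and it is the number of the nodes
of the cylinder that matters. -/
theorem exists_card (n : ℕ) (P : List ℕ → Prop) :
    ∃ c : ℕ, 2 ^ n * cantorMeasure {f | P (seq (bits f) n)} = c ∧ ∀ m, m ≤ c ↔
      ∃ t : List (List ℕ), m ≤ t.length ∧ t.Nodup ∧
        ∀ σ ∈ t, σ.length = n ∧ (∀ i < n, σ.getD i 0 ≤ 1) ∧ P σ := by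
  classical
  let e (g : Fin n → Bool) : List ℕ := List.ofFn fun i => (g i).toNat
  have he : Function.Injective e := by
    intro g g' h
    funext i
    have h1 := congrFun (List.ofFn_injective h) i
    revert h1
    cases g i <;> cases g' i <;> simp
  let S : Finset (Fin n → Bool) := Finset.univ.filter fun g => P (e g)
  have h1 : 2 ^ n * cantorMeasure {f | P (seq (bits f) n)} = S.card := by
    have h2 : {g | P (List.ofFn fun i => (g i).toNat)} = (S : Set (Fin n → Bool)) := by
      ext g
      simp [S, e]
    rw [setOf_seq_bits, h2,
      ← Measure.map_apply (measurable_restrict n) (Finset.measurableSet S),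
      ← sum_measure_singleton]
    simp only [Measure.map_apply (measurable_restrict n) (measurableSet_singleton _),
      cantorMeasure_restrict_eq, Finset.sum_const, nsmul_eq_mul]
    rw [mul_left_comm, ← mul_pow, ENNReal.mul_inv_cancel two_ne_zero ENNReal.ofNat_ne_top, one_pow,
      mul_one]
  refine ⟨S.card, h1, fun m => ?_⟩
  constructor
  · intro h
    refine ⟨S.toList.map e, by simpa using h, S.nodup_toList.map he, ?_⟩
    intro σ hσ
    obtain ⟨g, hg, rfl⟩ := List.mem_map.1 hσ
    refine ⟨by simp [e], fun i hi => ?_, by simpa [S] using hg⟩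
    rw [List.getD_eq_getElem _ _ (by simpa [e] using hi)]
    simp only [e, List.getElem_ofFn]
    exact Bool.toNat_le _
  · rintro ⟨t, h, ht, hP⟩
    rw [← List.toFinset_card_of_nodup ht] at h
    refine h.trans ((Finset.card_le_card fun σ hσ => ?_).trans
      (Finset.card_image_of_injective S he).le)
    obtain ⟨h3, h4, h5⟩ := hP σ (List.mem_toFinset.1 hσ)
    have h6 : e (fun i => decide (σ.getD i 0 = 1)) = σ := by
      apply List.ext_getElem
      · simp [e, h3]
      · intro i hi hi'
        have h7 := h4 i (h3 ▸ hi')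
        rw [List.getD_eq_getElem _ _ hi'] at h7
        simp only [e, List.getElem_ofFn, List.getD_eq_getElem _ _ hi']
        interval_cases σ[i] <;> simp
    refine Finset.mem_image.2 ⟨_, Finset.mem_filter.2 ⟨Finset.mem_univ _, ?_⟩, h6⟩
    rw [h6]
    exact h5

/-- The approximation of depth `n` to an analytic set, where the entries of the witness are bounded
by `b`. -/
def approx (R : List ℕ → List ℕ → Prop) (b : ℕ → ℕ) (n : ℕ) : Set (ℕ → Bool) :=
  {f | ∃ s : List ℕ, s.length = n ∧ (∀ i < n, s.getD i 0 ≤ b i) ∧ R (seq (bits f) n) s}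

variable {R : List ℕ → List ℕ → Prop} {r : ℝ≥0∞}

/-- If an analytic set has outer measure greater than `r`, then the entries of the witnesses can be
bounded in such a way that its approximations have at least measure `r`. -/
theorem exists_bound_of_lt (h : r < cantorMeasure {f | ∃ s, ∀ n, R (seq (bits f) n) (seq s n)}) :
    ∃ b, ∀ n, r ≤ cantorMeasure (approx R b n) := by
  -- the part of the analytic set with witnesses whose first entries are bounded by `β`
  let A (β : List ℕ) : Set (ℕ → Bool) :=
    {f | ∃ s : ℕ → ℕ, (∀ i < β.length, s i ≤ β.getD i 0) ∧ ∀ n, R (seq (bits f) n) (seq s n)}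
  have hA (β : List ℕ) : A β = ⋃ c, A (β ++ [c]) := by
    ext f
    rw [Set.mem_iUnion]
    constructor
    · rintro ⟨s, hs, hR⟩
      refine ⟨s β.length, s, fun i hi => ?_, hR⟩
      rw [List.length_append, List.length_singleton, Nat.lt_succ_iff] at hi
      rcases hi.lt_or_eq with hi | rfl
      · rw [List.getD_append _ _ _ _ hi]
        exact hs i hi
      · simp
    · rintro ⟨c, s, hs, hR⟩
      refine ⟨s, fun i hi => ?_, hR⟩
      rw [← List.getD_append β [c] 0 i hi]
      exact hs i (by rw [List.length_append]; omega)
  -- a further entry can be bounded without the measure falling to `r`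
  have hstep (β : List ℕ) : ∃ c, r < cantorMeasure (A β) → r < cantorMeasure (A (β ++ [c])) := by
    by_cases hβ : r < cantorMeasure (A β)
    · rw [hA] at hβ
      have hm : Monotone fun c => A (β ++ [c]) := by
        rintro c c' hc f ⟨s, hs, hR⟩
        refine ⟨s, fun i hi => ?_, hR⟩
        have h1 := hs i (by simpa using hi)
        rw [List.length_append, List.length_singleton, Nat.lt_succ_iff] at hi
        rcases hi.lt_or_eq with hi | rfl
        · rw [List.getD_append _ _ _ _ hi] at h1 ⊢
          exact h1
        · simp only [List.getD_append_right _ _ _ _ le_rfl, Nat.sub_self,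
            List.getD_cons_zero] at h1 ⊢
          exact h1.trans hc
      rw [hm.measure_iUnion, lt_iSup_iff] at hβ
      obtain ⟨c, hc⟩ := hβ
      exact ⟨c, fun _ => hc⟩
    · exact ⟨0, fun h => absurd h hβ⟩
  choose c hc using hstep
  let β : ℕ → List ℕ := fun n => Nat.rec [] (fun _ l => l ++ [c l]) n
  have hβ (n : ℕ) : β n = seq (fun n => c (β n)) n := by
    induction n with
    | zero => rfl
    | succ n ih => rw [seq_succ, ← ih]
  have hr (n : ℕ) : r < cantorMeasure (A (β n)) := by
    induction n with
    | zero => simpa [A, β] using h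
    | succ n ih => exact hc _ ih
  refine ⟨fun n => c (β n), fun n => (hr n).le.trans (measure_mono ?_)⟩
  rintro f ⟨s, hs, hR⟩
  refine ⟨seq s n, length_seq _ _, fun i hi => ?_, hR n⟩
  have h1 := hs i (by rw [hβ, length_seq]; exact hi)
  rw [hβ, getD_seq _ hi] at h1
  rwa [getD_seq _ hi]

/-- Conversely, by compactness such a bound shows that the analytic set has at least measure `r`. -/
theorem le_measure_of_bound (hR : ∀ h s n, R (seq h (n + 1)) (seq s (n + 1)) →
    R (seq h n) (seq s n)) {b : ℕ → ℕ} (h : ∀ n, r ≤ cantorMeasure (approx R b n)) :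
    r ≤ cantorMeasure {f | ∃ s, ∀ n, R (seq (bits f) n) (seq s n)} := by
  have hanti : Antitone (approx R b) := by
    refine antitone_nat_of_succ_le fun n => ?_
    rintro f ⟨s, hs, hb, h⟩
    obtain ⟨s, rfl⟩ : ∃ s', s = seq s' (n + 1) := hs ▸ exists_seq_eq s
    refine ⟨seq s n, length_seq _ _, fun i hi => ?_, hR _ _ _ h⟩
    have h1 := hb i (by omega)
    rw [getD_seq _ (by omega)] at h1
    rwa [getD_seq _ hi]
  have h1 : cantorMeasure (⋂ n, approx R b n) = ⨅ n, cantorMeasure (approx R b n) :=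
    hanti.measure_iInter (fun n => (measurableSet_seq_bits n fun σ => ∃ s : List ℕ, s.length = n ∧
      (∀ i < n, s.getD i 0 ≤ b i) ∧ R σ s).nullMeasurableSet) ⟨0, measure_ne_top _ _⟩
  refine ((le_iInf h).trans h1.ge).trans (measure_mono fun f hf => ?_)
  -- the witnesses of depth `n` for `f` form a decreasing sequence of nonempty compact sets
  let K (n : ℕ) : Set (ℕ → ℕ) :=
    (Set.univ.pi fun i => Set.Iic (b i)) ∩ {s | R (seq (bits f) n) (seq s n)}
  have hcl (n : ℕ) : IsClosed {s | R (seq (bits f) n) (seq s n)} := by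
    have : {s | R (seq (bits f) n) (seq s n)} =
        (fun (s : ℕ → ℕ) (i : Fin n) => s i) ⁻¹' {g | R (seq (bits f) n) (List.ofFn g)} := by
      ext s
      simp [seq_eq_ofFn s]
    rw [this]
    exact (isClosed_discrete _).preimage (by fun_prop)
  have hcpt : IsCompact (Set.univ.pi fun i => Set.Iic (b i)) :=
    isCompact_univ_pi fun i => (Set.finite_Iic (b i)).isCompact
  obtain ⟨s, hs⟩ := IsCompact.nonempty_iInter_of_sequence_nonempty_isCompact_isClosed K
    (fun n s hs => ⟨hs.1, hR _ _ _ hs.2⟩) (fun n => by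
      obtain ⟨s, hs, hb, h⟩ := Set.mem_iInter.1 hf n
      obtain ⟨s', rfl⟩ : ∃ s', s = seq s' n := hs ▸ exists_seq_eq s
      have h2 : seq s' n = seq (fun i => if i < n then s' i else 0) n :=
        List.map_congr_left fun i hi => by rw [if_pos (List.mem_range.1 hi)]
      refine ⟨fun i => if i < n then s' i else 0, fun i _ => ?_, ?_⟩
      · change (if i < n then s' i else 0) ≤ b i
        split_ifs with hi
        · have := hb i hi
          rwa [getD_seq _ hi] at this
        · exact Nat.zero_le _
      · rw [h2] at h
        exact h)
    (hcpt.inter_right (hcl 0))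
    (fun n => (isClosed_set_pi fun i _ => isClosed_discrete _).inter (hcl n))
  exact ⟨s, fun n => (Set.mem_iInter.1 hs n).2⟩

end AnalyticMeasure

/-! ### Deciding lower bounds for the measure of an analytic set -/

section DecideMeasure

open scoped ENNReal

variable {α β : Type} [Primcodable α] {D : α → Prop}

theorem DecOn.eq {γ : Type} [Primcodable γ] {F G : α → γ} (hF : Primrec F)
    (hG : Primrec G) : DecOn D fun a => F a = G a := .of_primrecPred (Primrec.eq.comp hF hG)

theorem DecOn.lt {F G : α → ℕ} (hF : Primrec F) (hG : Primrec G) : DecOn D fun a => F a < G a :=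
  .of_primrecPred (Primrec.nat_lt.comp hF hG)

theorem DecOn.le {F G : α → ℕ} (hF : Primrec F) (hG : Primrec G) : DecOn D fun a => F a ≤ G a :=
  .of_primrecPred (Primrec.nat_le.comp hF hG)

theorem DecOn.forall_right [Denumerable β] {P : α → β → Prop}
    (h : DecOn (fun q : α × β => D q.1) fun q => P q.1 q.2) : DecOn D fun a => ∀ b, P a b :=
  h.forall.mono (fun _ h _ => h) fun _ _ => Iff.rfl

theorem DecOn.exists_right [Denumerable β] {P : α → β → Prop}
    (h : DecOn (fun q : α × β => D q.1) fun q => P q.1 q.2) : DecOn D fun a => ∃ b, P a b :=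
  h.exists.mono (fun _ h _ => h) fun _ _ => Iff.rfl

theorem primrec_two_pow : Primrec fun n : ℕ => 2 ^ n :=
  (Primrec.nat_rec₁ (f := fun _ m => 2 * m) 1
    (Primrec.nat_mul.comp (Primrec.const 2) Primrec.snd)).of_eq fun n => by
    induction n with
    | zero => rfl
    | succ n ih => rw [Nat.pow_succ, ← ih, Nat.mul_comm]

/-- For the analytic sets of a computable family, the Suslin functional distinguishes between
measure less than `p / d` and measure greater than `p / d`: what is decided is the existence of a
bound for the witnesses all of whose approximations, which are finite objects, have measure `p / d`
or more. -/
theorem exists_decOn_measure {R : α → List ℕ → List ℕ → Prop}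
    (hR : DecOn (fun q : α × List ℕ × List ℕ => D q.1) fun q => R q.1 q.2.1 q.2.2)
    (hcl : ∀ a h s n, R a (seq h (n + 1)) (seq s (n + 1)) → R a (seq h n) (seq s n))
    (p : ℕ) {d : ℕ} (hd : d ≠ 0) : ∃ Q : α → Prop, DecOn D Q ∧
      (∀ a, Q a → (p / d : ℝ≥0∞) ≤ cantorMeasure {f | ∃ s, ∀ n, R a (seq (bits f) n) (seq s n)}) ∧
      ∀ a, (p / d : ℝ≥0∞) < cantorMeasure {f | ∃ s, ∀ n, R a (seq (bits f) n) (seq s n)} → Q a := by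
  -- the list `t` shows that the approximation for the bounds in the list `l` has measure `≥ p / d`
  let W (a : α) (l : List ℕ) (t : List (List ℕ)) : Prop :=
    p * 2 ^ l.length ≤ d * t.length ∧ (∀ i j, j < t.length → i < j → t.getD i [] ≠ t.getD j []) ∧
      ∀ i, i < t.length → (t.getD i []).length = l.length ∧
        (∀ k, k < l.length → (t.getD i []).getD k 0 ≤ 1) ∧
        ∃ s : List ℕ, s.length = l.length ∧ (∀ k, k < l.length → s.getD k 0 ≤ l.getD k 0) ∧
          R a (t.getD i []) s
  have hW : DecOn (fun q : (α × List ℕ) × List (List ℕ) => D q.1.1) fun q => W q.1.1 q.1.2 q.2 := by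
    refine (DecOn.le (Primrec.nat_mul.comp (.const p)
      (primrec_two_pow.comp (Primrec.list_length.comp (Primrec.snd.comp .fst))))
      (Primrec.nat_mul.comp (.const d) (Primrec.list_length.comp .snd))).and (.and ?_ ?_)
    · refine .forall_right (.forall_right ?_)
      refine (DecOn.lt .snd (Primrec.list_length.comp (Primrec.snd.comp
        (Primrec.fst.comp .fst)))).imp ((DecOn.lt (Primrec.snd.comp .fst) .snd).imp
          (DecOn.not (.eq ?_ ?_)))
      · exact (Primrec.list_getD []).comp (Primrec.snd.comp (Primrec.fst.comp .fst))
          (Primrec.snd.comp .fst)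
      · exact (Primrec.list_getD []).comp (Primrec.snd.comp (Primrec.fst.comp .fst)) .snd
    · refine .forall_right ?_
      have hti : Primrec fun q : ((α × List ℕ) × List (List ℕ)) × ℕ => q.1.2.getD q.2 [] :=
        (Primrec.list_getD []).comp (Primrec.snd.comp .fst) .snd
      have hl : Primrec fun q : ((α × List ℕ) × List (List ℕ)) × ℕ => q.1.1.2 :=
        Primrec.snd.comp (Primrec.fst.comp .fst)
      have ha : Primrec fun q : ((α × List ℕ) × List (List ℕ)) × ℕ => q.1.1.1 :=
        Primrec.fst.comp (Primrec.fst.comp .fst)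
      refine (DecOn.lt .snd (Primrec.list_length.comp (Primrec.snd.comp .fst))).imp
        ((DecOn.eq (Primrec.list_length.comp hti) (Primrec.list_length.comp hl)).and (.and ?_ ?_))
      · refine .forall_right ((DecOn.lt .snd (Primrec.list_length.comp (hl.comp .fst))).imp
          (.le ((Primrec.list_getD 0).comp (hti.comp .fst) .snd) (.const 1)))
      · refine .exists_right ((DecOn.eq (Primrec.list_length.comp .snd)
          (Primrec.list_length.comp (hl.comp .fst))).and (.and ?_ ?_))
        · exact .forall_right ((DecOn.lt .snd (Primrec.list_length.comp
            (hl.comp (Primrec.fst.comp .fst)))).imp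
            (.le ((Primrec.list_getD 0).comp (Primrec.snd.comp .fst) .snd)
            ((Primrec.list_getD 0).comp (hl.comp (Primrec.fst.comp .fst)) .snd)))
        · refine (hR.comp ((ha.comp .fst).pair ((hti.comp .fst).pair .snd))).mono ?_
            fun _ _ => Iff.rfl
          exact fun _ h => h.1.1.1.1.1.1.1
  have hW' (a : α) (b : ℕ → ℕ) (n : ℕ) : (∃ t, W a (seq b n) t) ↔
      (p / d : ℝ≥0∞) ≤ cantorMeasure (approx (R a) b n) := by
    obtain ⟨c, hc, hc'⟩ := exists_card n fun σ => ∃ s : List ℕ, s.length = n ∧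
      (∀ i < n, s.getD i 0 ≤ b i) ∧ R a σ s
    have h1 : (p / d : ℝ≥0∞) ≤ cantorMeasure (approx (R a) b n) ↔ p * 2 ^ n ≤ d * c := by
      rw [ENNReal.div_le_iff' (by simpa using hd) (ENNReal.natCast_ne_top d),
        ← ENNReal.mul_le_mul_iff_left (c := 2 ^ n) (by simp) (by simp), mul_assoc,
        mul_comm (cantorMeasure _), approx, hc]
      norm_cast
    have h2 (s : List ℕ) : (∀ k, k < n → s.getD k 0 ≤ (seq b n).getD k 0) ↔
        ∀ k < n, s.getD k 0 ≤ b k :=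
      forall₂_congr fun k hk => by rw [getD_seq _ hk]
    have h3 (t : List (List ℕ)) (Q : List ℕ → Prop) :
        (∀ i, i < t.length → Q (t.getD i [])) ↔ ∀ σ ∈ t, Q σ := by
      rw [List.forall_mem_iff_getElem]
      exact forall₂_congr fun i hi => by rw [List.getD_eq_getElem _ _ hi]
    have h4 (t : List (List ℕ)) :
        (∀ i j, j < t.length → i < j → t.getD i [] ≠ t.getD j []) ↔ t.Nodup := by
      rw [List.Nodup, List.pairwise_iff_getElem]
      constructor
      · intro h i j hi hj hij
        have := h i j hj hij
        rwa [List.getD_eq_getElem _ _ hi, List.getD_eq_getElem _ _ hj] at this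
      · intro h i j hj hij
        rw [List.getD_eq_getElem _ _ (hij.trans hj), List.getD_eq_getElem _ _ hj]
        exact h i j (hij.trans hj) hj hij
    simp only [W, length_seq, h2, h4, h1]
    constructor
    · rintro ⟨t, ht1, ht2, ht3⟩
      exact ht1.trans (Nat.mul_le_mul_left _ ((hc' _).2 ⟨t, le_rfl, ht2, (h3 t _).1 ht3⟩))
    · intro h
      obtain ⟨t, ht1, ht2, ht3⟩ := (hc' c).1 le_rfl
      exact ⟨t, h.trans (Nat.mul_le_mul_left _ ht1), ht2, (h3 t _).2 ht3⟩
  refine ⟨fun a => ∃ b, ∀ n, ∃ t, W a (seq b n) t,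
    (DecOn.exists_fun (D := fun q => D q.1) (P := fun q : α × List ℕ => ∃ t, W q.1 q.2 t)
      hW.exists_right).mono (fun _ h _ => h) fun _ _ => Iff.rfl, ?_, ?_⟩
  · rintro a ⟨b, hb⟩
    exact le_measure_of_bound (hcl a) fun n => (hW' a b n).1 (hb n)
  · intro a ha
    obtain ⟨b, hb⟩ := exists_bound_of_lt ha
    exact ⟨b, fun n => (hW' a b n).2 (hb n)⟩

end DecideMeasure

/-! ### Approximations to valuations -/

section Approximation

open Encodable

variable {α : Type} [Primcodable α]

section Primrec

variable {F G H K : α → ℕ} {v : α → List ℕ}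

theorem primrec_unpair_fst (hF : Primrec F) : Primrec fun a => (F a).unpair.1 :=
  Primrec.fst.comp (Primrec.unpair.comp hF)
theorem primrec_unpair_snd (hF : Primrec F) : Primrec fun a => (F a).unpair.2 :=
  Primrec.snd.comp (Primrec.unpair.comp hF)
theorem primrec_lev (hF : Primrec F) : Primrec fun a => lev (F a) := primrec_unpair_fst hF
theorem primrec_body (hF : Primrec F) : Primrec fun a => body (F a) :=
  primrec_unpair_fst (primrec_unpair_snd hF)
theorem primrec_params (hF : Primrec F) : Primrec fun a => params (F a) :=
  (Primrec.ofNat (List ℕ)).comp (primrec_unpair_snd (primrec_unpair_snd hF))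
theorem primrec_getD (hv : Primrec v) (hF : Primrec F) : Primrec fun a => (v a).getD (F a) 0 :=
  (Primrec.list_getD 0).comp hv hF
theorem primrec_pair (hF : Primrec F) (hG : Primrec G) :
    Primrec fun a => Nat.pair (F a) (G a) := Primrec₂.natPair.comp hF hG
theorem primrec_kLt (hF : Primrec F) (hG : Primrec G) : Primrec fun a => kLt (F a) (G a) :=
  primrec_pair (.const 1) (primrec_pair hF hG)
theorem primrec_kNand (hF : Primrec F) (hG : Primrec G) : Primrec fun a => kNand (F a) (G a) :=
  primrec_pair (.const 3) (primrec_pair hF hG)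
theorem primrec_kNot (hF : Primrec F) : Primrec fun a => kNot (F a) := primrec_kNand hF hF
theorem primrec_kAnd (hF : Primrec F) (hG : Primrec G) : Primrec fun a => kAnd (F a) (G a) :=
  primrec_kNot (primrec_kNand hF hG)
theorem primrec_kImp (hF : Primrec F) (hG : Primrec G) : Primrec fun a => kImp (F a) (G a) :=
  primrec_kNand hF (primrec_kNot hG)
theorem primrec_kMem (hF : Primrec F) (hG : Primrec G) : Primrec fun a => kMem (F a) (G a) :=
  primrec_pair (.const 5) (primrec_pair hF hG)
theorem primrec_kNSub (hF : Primrec F) (hG : Primrec G) : Primrec fun a => kNSub (F a) (G a) :=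
  primrec_pair (.const 6) (primrec_pair hF hG)
theorem primrec_kNNum (hF : Primrec F) (hG : Primrec G) : Primrec fun a => kNNum (F a) (G a) :=
  primrec_pair (.const 7) (primrec_pair hF hG)
theorem primrec_kHas (hF : Primrec F) (hG : Primrec G) : Primrec fun a => kHas (F a) (G a) :=
  primrec_pair (.const 8) (primrec_pair hF hG)
theorem primrec_kEq (hF : Primrec F) (hG : Primrec G) : Primrec fun a => kEq (F a) (G a) :=
  primrec_kAnd (primrec_kNot (primrec_kNSub hF hG)) (primrec_kNot (primrec_kNSub hG hF))
theorem primrec_kSat (hF : Primrec F) (hG : Primrec G) (hv : Primrec v) :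
    Primrec fun a => kSat (F a) (G a) (v a) :=
  primrec_pair (.const 4) (primrec_pair hF (primrec_pair hG (Primrec.encode.comp hv)))
theorem primrec_kNAll (hF : Primrec F) (hG : Primrec G) (hH : Primrec H) (hK : Primrec K)
    (hv : Primrec v) : Primrec fun a => kNAll (F a) (G a) (H a) (K a) (v a) :=
  primrec_pair (.const 10) (primrec_pair hF (primrec_pair hG (primrec_pair hH
    (primrec_pair hK (Primrec.encode.comp hv)))))
theorem primrec_ite_eq {n : ℕ} (hF : Primrec F) (hG : Primrec G) (hH : Primrec H) :
    Primrec fun a => if F a = n then G a else H a :=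
  Primrec.ite (Primrec.eq.comp hF (.const n)) hG hH

theorem primrec_satClause (hF : Primrec F) (hG : Primrec G) (hv : Primrec v) (hH : Primrec H) :
    Primrec fun a => satClause (F a) (G a) (v a) (H a) := by
  have h2 := primrec_unpair_snd hG
  have hx := primrec_getD hv (primrec_unpair_fst h2)
  have hy := primrec_getD hv (primrec_unpair_snd h2)
  have hz := primrec_getD hv h2
  refine primrec_ite_eq (primrec_unpair_fst hG) ?_ (primrec_ite_eq (primrec_unpair_fst hG) ?_
    (primrec_ite_eq (primrec_unpair_fst hG) ?_ (primrec_ite_eq (primrec_unpair_fst hG) ?_ ?_)))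
  · exact primrec_kNand (primrec_kLt (primrec_lev hx) hF)
      (primrec_kAnd (primrec_kLt (primrec_lev hy) hF) (primrec_kMem hx hy))
  · exact primrec_kNand (primrec_kLt (primrec_lev hx) hF)
      (primrec_kAnd (primrec_kLt (primrec_lev hy) hF) (primrec_kEq hx hy))
  · exact primrec_kNand (primrec_kLt (primrec_lev hz) hF)
      (primrec_kAnd (primrec_pair (.const 2) hH) (primrec_kNot (primrec_kNNum hz hH)))
  · exact primrec_ite_eq hH (primrec_kSat hF (primrec_unpair_fst h2) hv)
      (primrec_kSat hF (primrec_unpair_snd h2) hv)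
  · exact primrec_kImp (primrec_kLt (primrec_lev hH) hF)
      (primrec_kSat hF h2 (Primrec.list_cons.comp hH hv))

theorem primrec_clause (hF : Primrec F) (hG : Primrec G) :
    Primrec fun a => clause (F a) (G a) := by
  have ht := primrec_unpair_fst hF
  have h2 := primrec_unpair_snd hF
  have hx := primrec_unpair_fst h2
  have hy := primrec_unpair_snd h2
  have hG2 : Primrec fun a => G a / 2 := Primrec.nat_div.comp hG (.const 2)
  refine primrec_ite_eq ht ?_ (primrec_ite_eq ht ?_ (primrec_ite_eq ht ?_ (primrec_ite_eq ht ?_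
    (primrec_ite_eq ht ?_ (primrec_ite_eq ht ?_ (primrec_ite_eq ht ?_ (Primrec.ite ?_ ?_
      (.const kTrue))))))))
  · exact primrec_ite_eq hG hx hy
  · exact primrec_satClause hx (primrec_unpair_fst hy)
      ((Primrec.ofNat (List ℕ)).comp (primrec_unpair_snd hy)) hG
  · exact primrec_kNand (primrec_kLt (primrec_lev hG) (primrec_lev hy))
      (primrec_kAnd (primrec_kEq hx hG) (primrec_kSat (primrec_lev hy) (primrec_body hy)
        (Primrec.list_cons.comp hG (primrec_params hy))))
  · exact primrec_kImp (primrec_kLt (primrec_lev hG) (primrec_lev hx))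
      (primrec_kImp (primrec_kMem hG hx) (primrec_kMem hG hy))
  · exact primrec_ite_eq (Primrec.nat_mod.comp hG (.const 2))
      (Primrec.ite (Primrec.nat_lt.comp hG2 hy) (primrec_kHas hx hG2)
        (primrec_kNot (primrec_kHas hx hG2)))
      (primrec_kImp (primrec_kLt (primrec_lev hG2) (primrec_lev hx))
        (primrec_kImp (primrec_kMem hG2 hx) (primrec_pair (.const 9) hG2)))
  · exact primrec_kNand (primrec_kLt (primrec_lev hG) (primrec_lev hx))
      (primrec_kAnd (primrec_kMem hG hx) (primrec_kNot (primrec_kNNum hG hy)))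
  · exact primrec_kNNum h2 hG
  · exact (Primrec.eq.comp ht (.const 10)).and (Primrec.nat_le.comp hG hx)
  · have h3 := primrec_unpair_snd (primrec_unpair_snd hy)
    exact primrec_kImp (primrec_kLt (primrec_lev hG) (primrec_unpair_fst hy))
      (primrec_kSat (primrec_unpair_fst (primrec_unpair_snd hy)) (primrec_unpair_fst h3)
        (Primrec.list_cons.comp hG ((Primrec.ofNat (List ℕ)).comp (primrec_unpair_snd h3))))

end Primrec

/-- The values of `s` below `n` are consistent with being a valuation for which the statement coded
by `t` is false, where `h` is the characteristic function of the predicate. A statement `k` is true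
if `s k ≠ 0`, and then `s k - 1` tells a clause that fails. -/
def Consistent (Lt : ℕ → ℕ → Prop) (t n : ℕ) (h s : ℕ → ℕ) : Prop :=
  (t < n → s t = 0) ∧ ∀ k, k < n →
    (k = kTrue → ¬ s k = 0) ∧
    (k.unpair.1 = 1 → (¬ s k = 0 ↔ Lt k.unpair.2.unpair.1 k.unpair.2.unpair.2)) ∧
    (k.unpair.1 = 2 → k.unpair.2 < n → (¬ s k = 0 ↔ ¬ h k.unpair.2 = 0)) ∧
    (3 ≤ k.unpair.1 → ¬ s k = 0 → clause k (s k - 1) < n → s (clause k (s k - 1)) = 0) ∧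
    (3 ≤ k.unpair.1 → s k = 0 → ∀ j, j < n → clause k j < n → ¬ s (clause k j) = 0)

variable {Lt : ℕ → ℕ → Prop} {t : ℕ}

theorem Consistent.congr {n : ℕ} {h h' s s' : ℕ → ℕ} (hc : Consistent Lt t n h s)
    (hh : ∀ i < n, h i = h' i) (hs : ∀ i < n, s i = s' i) : Consistent Lt t n h' s' := by
  refine ⟨fun ht => hs t ht ▸ hc.1 ht, fun k hk => ?_⟩
  obtain ⟨h1, h2, h3, h4, h5⟩ := hc.2 k hk
  rw [← hs k hk]
  exact ⟨h1, h2, fun e hm => hh _ hm ▸ h3 e hm, fun e h0 hj => hs _ hj ▸ h4 e h0 hj,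
    fun e h0 j hj hj' => hs _ hj' ▸ h5 e h0 j hj hj'⟩

theorem Consistent.mono {m n : ℕ} (hmn : m ≤ n) {h s : ℕ → ℕ} (hc : Consistent Lt t n h s) :
    Consistent Lt t m h s := by
  refine ⟨fun ht => hc.1 (ht.trans_le hmn), fun k hk => ?_⟩
  obtain ⟨h1, h2, h3, h4, h5⟩ := hc.2 k (hk.trans_le hmn)
  exact ⟨h1, h2, fun e hm => h3 e (hm.trans_le hmn), fun e h0 hj => h4 e h0 (hj.trans_le hmn),
    fun e h0 j hj hj' => h5 e h0 j (hj.trans_le hmn) (hj'.trans_le hmn)⟩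

/-- The consistent approximations of all lengths are the initial parts of valid valuations. -/
theorem exists_consistent_iff {lab : Labelling} (f : ℕ → Bool) :
    (∃ s, ∀ n, Consistent (LabLT lab) t n (bits f) s) ↔ ∃ T, IsValid lab f T ∧ ¬ T t := by
  have hbit (m : ℕ) : ¬ bits f m = 0 ↔ f m = true := by
    rw [bits]
    cases f m <;> simp
  constructor
  · rintro ⟨s, hs⟩
    have step (k : ℕ) (hk : 3 ≤ k.unpair.1) : s k ≠ 0 ↔ ∃ j, ¬ s (clause k j) ≠ 0 := by
      constructor
      · intro h
        refine ⟨s k - 1, not_not.2 ?_⟩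
        exact ((hs (max k (clause k (s k - 1)) + 1)).2 k
          (Nat.lt_succ_of_le (le_max_left _ _))).2.2.2.1 hk h (Nat.lt_succ_of_le (le_max_right _ _))
      · rintro ⟨j, hj⟩ h
        refine hj (((hs (max k (max j (clause k j)) + 1)).2 k
          (Nat.lt_succ_of_le (le_max_left _ _))).2.2.2.2 hk h j ?_ ?_)
        · exact Nat.lt_succ_of_le ((le_max_left _ _).trans (le_max_right _ _))
        · exact Nat.lt_succ_of_le ((le_max_right _ _).trans (le_max_right _ _))
    refine ⟨fun k => s k ≠ 0, { top := ?_, lt := ?_, bit := ?_, nand := ?_, step := step },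
      not_not.2 ((hs (t + 1)).1 (Nat.lt_succ_self t))⟩
    · exact ((hs _).2 kTrue (Nat.lt_succ_self _)).1 rfl
    · intro a b
      simpa [kLt] using ((hs _).2 (kLt a b) (Nat.lt_succ_self _)).2.1 (by simp [kLt])
    · intro m
      have h1 := ((hs (max (kBit m) m + 1)).2 (kBit m)
        (Nat.lt_succ_of_le (le_max_left _ _))).2.2.1 (by simp [kBit])
        (by simp [kBit])
      rw [hbit] at h1
      simpa [kBit] using h1
    · intro k l
      rw [step _ (by simp [kNand]), exists_clause_kNand (T := fun k => s k ≠ 0)]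
  · rintro ⟨T, hT, ht⟩
    classical
    have hw (k : ℕ) : ∃ j, T k → 3 ≤ k.unpair.1 → ¬ T (clause k j) := by
      by_cases h : T k ∧ 3 ≤ k.unpair.1
      · obtain ⟨j, hj⟩ := (hT.step k h.2).1 h.1
        exact ⟨j, fun _ _ => hj⟩
      · exact ⟨0, fun h1 h2 => absurd ⟨h1, h2⟩ h⟩
    choose w hw using hw
    have hs (k : ℕ) : (if T k then w k + 1 else 0) = 0 ↔ ¬ T k := by
      by_cases h : T k <;> simp [h]
    refine ⟨fun k => if T k then w k + 1 else 0, fun n => ⟨fun _ => (hs t).2 ht, fun k _ => ?_⟩⟩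
    simp only [hs, not_not]
    refine ⟨fun hk => hk ▸ hT.top, ?_⟩
    obtain ⟨c, k, rfl⟩ := exists_eq_pair k
    refine ⟨?_, ?_, ?_, ?_⟩
    · rw [Nat.unpair_pair]
      rintro rfl
      obtain ⟨a, b, rfl⟩ := exists_eq_pair k
      rw [Nat.unpair_pair]
      exact hT.lt a b
    · rw [Nat.unpair_pair]
      rintro rfl _
      rw [hbit]
      exact hT.bit k
    · intro h1 h2 _
      simp only [h2, if_true, Nat.add_sub_cancel]
      exact hw _ h2 h1
    · intro h1 h2 j _ _
      by_contra h3
      exact h2 ((hT.step _ h1).2 ⟨j, h3⟩)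

theorem decOn_consistent {D : α → Prop} {Lt : α → ℕ → ℕ → Prop} {t : α → ℕ}
    (hLt : DecOn (fun q : α × ℕ × ℕ => D q.1) fun q => Lt q.1 q.2.1 q.2.2) (ht : Primrec t) :
    DecOn (fun q : α × List ℕ × List ℕ => D q.1) fun q =>
      Consistent (Lt q.1) (t q.1) q.2.2.length (fun i => q.2.1.getD i 0)
        fun i => q.2.2.getD i 0 := by
  have hn : Primrec fun q : α × List ℕ × List ℕ => q.2.2.length :=
    Primrec.list_length.comp (Primrec.snd.comp .snd)
  have hs : Primrec fun q : α × List ℕ × List ℕ => q.2.2 := Primrec.snd.comp .snd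
  have h1 : Primrec fun q : (α × List ℕ × List ℕ) × ℕ => q.2.unpair.1 := primrec_unpair_fst .snd
  have h2 : Primrec fun q : (α × List ℕ × List ℕ) × ℕ => q.2.unpair.2 := primrec_unpair_snd .snd
  have hsk : Primrec fun q : (α × List ℕ × List ℕ) × ℕ => q.1.2.2.getD q.2 0 :=
    primrec_getD (hs.comp .fst) .snd
  refine ((DecOn.lt (ht.comp .fst) hn).imp (.eq (primrec_getD hs (ht.comp .fst)) (.const 0))).and
    (.forall_right ((DecOn.lt .snd (hn.comp .fst)).imp (.and ?_ (.and ?_ (.and ?_ (.and ?_ ?_))))))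
  · exact (DecOn.eq .snd (.const _)).imp (.not (.eq hsk (.const 0)))
  · refine (DecOn.eq h1 (.const 1)).imp ((DecOn.not (.eq hsk (.const 0))).iff ?_)
    refine (hLt.comp ((Primrec.fst.comp .fst).pair ((primrec_unpair_fst h2).pair
      (primrec_unpair_snd h2)))).mono ?_ fun _ _ => Iff.rfl
    exact fun _ h => h.1.1.1.1
  · exact (DecOn.eq h1 (.const 2)).imp ((DecOn.lt h2 (hn.comp .fst)).imp
      ((DecOn.not (.eq hsk (.const 0))).iff
        (.not (.eq (primrec_getD (Primrec.fst.comp (Primrec.snd.comp .fst)) h2) (.const 0)))))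
  · have hc : Primrec fun q : (α × List ℕ × List ℕ) × ℕ => clause q.2 (q.1.2.2.getD q.2 0 - 1) :=
      primrec_clause .snd (Primrec.nat_sub.comp hsk (.const 1))
    exact (DecOn.le (.const 3) h1).imp ((DecOn.not (.eq hsk (.const 0))).imp
      ((DecOn.lt hc (hn.comp .fst)).imp (.eq (primrec_getD (hs.comp .fst) hc) (.const 0))))
  · have hc : Primrec fun q : ((α × List ℕ × List ℕ) × ℕ) × ℕ => clause q.1.2 q.2 :=
      primrec_clause (Primrec.snd.comp .fst) .snd
    exact (DecOn.le (.const 3) h1).imp ((DecOn.eq hsk (.const 0)).imp (.forall_right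
      ((DecOn.lt .snd (hn.comp (Primrec.fst.comp .fst))).imp
        ((DecOn.lt hc (hn.comp (Primrec.fst.comp .fst))).imp
          (.not (.eq (primrec_getD (hs.comp (Primrec.fst.comp .fst)) hc) (.const 0)))))))

/-- For a computable family of labellings, the Suslin functional distinguishes between measure less
than `p / d` and measure greater than `p / d` of the set of all `f` for which the statement coded by
`t` fails in some valid valuation. -/
theorem exists_decOn_measure_isValid {D : α → Prop} {lab : α → Labelling} {t : α → ℕ}
    (hlab : DecOn (fun q : α × ℕ × ℕ => D q.1) fun q => LabLT (lab q.1) q.2.1 q.2.2)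
    (ht : Primrec t) (p : ℕ) {d : ℕ} (hd : d ≠ 0) : ∃ Q : α → Prop, DecOn D Q ∧
      (∀ a, Q a → (p / d : ENNReal) ≤ cantorMeasure {f | ∃ T, IsValid (lab a) f T ∧ ¬ T (t a)}) ∧
      ∀ a, (p / d : ENNReal) < cantorMeasure {f | ∃ T, IsValid (lab a) f T ∧ ¬ T (t a)} → Q a := by
  have key (a : α) (h s : ℕ → ℕ) (n : ℕ) : Consistent (LabLT (lab a)) (t a) (seq s n).length
      (fun i => (seq h n).getD i 0) (fun i => (seq s n).getD i 0) ↔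
      Consistent (LabLT (lab a)) (t a) n h s := by
    rw [length_seq]
    exact ⟨fun hc => hc.congr (fun i hi => getD_seq h hi) fun i hi => getD_seq s hi,
      fun hc => hc.congr (fun i hi => (getD_seq h hi).symm) fun i hi => (getD_seq s hi).symm⟩
  obtain ⟨Q, hQ, hQ₁, hQ₂⟩ := exists_decOn_measure (R := fun a σ s => Consistent (LabLT (lab a))
    (t a) s.length (fun i => σ.getD i 0) fun i => s.getD i 0)
    (decOn_consistent (Lt := fun a => LabLT (lab a)) hlab ht)
    (fun a h s n hc => (key a h s n).2 (((key a h s _).1 hc).mono n.le_succ)) p hd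
  simp only [key, exists_consistent_iff] at hQ₁ hQ₂
  exact ⟨Q, hQ, hQ₁, hQ₂⟩

end Approximation

/-! ### Labels for the ordinals below `ω₁^S` -/

section Labels

open Encodable

/-- The label `b` stands for the length of the computation with code `b`. -/
def node (b : ℕ) : Node := Denumerable.ofNat Node b

@[simp] theorem node_encode (x : Node) : node (encode x) = x := Denumerable.ofNat_encode x

open Classical in
/-- The labelling of all convergent computations. -/
noncomputable def labAll : Labelling := fun b => if Conv (node b) then some (rk (node b)) else none

open Classical in
/-- The labelling of the computations that are not longer than `x`. -/
noncomputable def labUpTo (x : Node) : Labelling := fun b =>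
  if Conv (node b) ∧ rk (node b) ≤ rk x then some (rk (node b)) else none

theorem not_conv_node_zero : ¬ Conv (node 0) := by
  have : node 0 = (0, []) := by
    simp [node]
  rw [this]
  exact not_conv_zero

theorem labAll_isInitial : labAll.IsInitial where
  zero := by rw [labAll, if_neg not_conv_node_zero]
  exists_eq b β hβ α hα := by
    rw [labAll] at hβ
    split_ifs at hβ with h
    · rw [Option.mem_some_iff] at hβ
      subst hβ
      obtain ⟨x, hx, rfl⟩ := lt_convSup_iff.1 (hα.trans (lt_convSup_iff.2 ⟨_, h, rfl⟩))
      exact ⟨encode x, by simp [labAll, hx]⟩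
    · exact absurd hβ (Option.not_mem_none _)

theorem labUpTo_isInitial (x : Node) : (labUpTo x).IsInitial where
  zero := by rw [labUpTo, if_neg fun h => not_conv_node_zero h.1]
  exists_eq b β hβ α hα := by
    rw [labUpTo] at hβ
    split_ifs at hβ with h
    · rw [Option.mem_some_iff] at hβ
      subst hβ
      obtain ⟨y, hy, rfl⟩ := lt_convSup_iff.1 (hα.trans (lt_convSup_iff.2 ⟨_, h.1, rfl⟩))
      exact ⟨encode y, by simp [labUpTo, hy, hα.le.trans h.2]⟩
    · exact absurd hβ (Option.not_mem_none _)

theorem labLT_labAll {a b : ℕ} :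
    LabLT labAll a b ↔ Conv (node a) ∧ Conv (node b) ∧ rk (node a) < rk (node b) := by
  by_cases ha : Conv (node a) <;> by_cases hb : Conv (node b) <;> simp [LabLT, labAll, ha, hb]

theorem labLT_labUpTo {x : Node} {a b : ℕ} :
    LabLT (labUpTo x) a b ↔ LabLT labAll a b ∧ rk (node b) ≤ rk x := by
  rw [labLT_labAll]
  constructor
  · rintro ⟨α, hα, β, hβ, h⟩
    rw [labUpTo] at hα hβ
    split_ifs at hα with h1
    · split_ifs at hβ with h2
      · rw [Option.mem_some_iff] at hα hβ
        exact ⟨⟨h1.1, h2.1, by rwa [hα, hβ]⟩, h2.2⟩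
      · exact absurd hβ (Option.not_mem_none _)
    · exact absurd hα (Option.not_mem_none _)
  · rintro ⟨⟨ha, hb, h⟩, h'⟩
    exact ⟨_, by rw [labUpTo, if_pos ⟨ha, h.le.trans h'⟩]; rfl, _,
      by rw [labUpTo, if_pos ⟨hb, h'⟩]; rfl, h⟩

theorem lvl_labAll {x : Node} (hx : Conv x) : lvl labAll (encode x) = rk x := by
  simp [lvl, labAll, hx]

theorem lvl_labUpTo {x y : Node} (hy : Conv y) (hxy : rk y ≤ rk x) :
    lvl (labUpTo x) (encode y) = rk y := by
  simp [lvl, labUpTo, hy, hxy]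

/-- Labels can be compared by the comparison of the lengths of computations. The cut at `x` makes
sure that a convergent computation takes part in each comparison. -/
theorem decOn_labLT_labUpTo {α : Type} [Primcodable α] {D : α → Prop} {x : α → Node}
    (hx : Primrec x) (hD : ∀ a, D a → Conv (x a)) :
    DecOn (fun q : α × ℕ × ℕ => D q.1) fun q => LabLT (labUpTo (x q.1)) q.2.1 q.2.2 := by
  have hn : Primrec node := Primrec.ofNat Node
  have h1 := decOn_stageLE.comp (g := fun q : α × ℕ × ℕ => (node q.2.2, x q.1))
    ((hn.comp (Primrec.snd.comp .snd)).pair (hx.comp .fst))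
  have h2 := decOn_stageLE.comp (g := fun q : α × ℕ × ℕ => (node q.2.2, node q.2.1))
    ((hn.comp (Primrec.snd.comp .snd)).pair (hn.comp (Primrec.fst.comp .snd)))
  refine ((h1.mono (D' := fun q => D q.1) (fun q hq => Or.inr (hD _ hq)) fun _ _ => Iff.rfl).and
    (h2.mono (fun q hq => Or.inl hq.2.1) fun _ _ => Iff.rfl).not).mono (fun _ => id)
    fun q hq => ?_
  have hq := hD _ hq
  rw [labLT_labUpTo, labLT_labAll]
  simp only [StageLE]
  constructor
  · rintro ⟨⟨h3, h4⟩, h5⟩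
    have h6 : Conv (node q.2.1) ∧ rk (node q.2.1) < rk (node q.2.2) := by
      by_contra h6
      exact h5 ⟨h3, fun h7 => not_lt.1 fun h8 => h6 ⟨h7, h8⟩⟩
    exact ⟨⟨h6.1, h3, h6.2⟩, h4 hq⟩
  · rintro ⟨⟨h3, h4, h5⟩, h6⟩
    exact ⟨⟨h4, fun _ => h6⟩, fun h => not_le.2 h5 (h.2 h3)⟩

variable {f : ℕ → Bool}

/-- Names that survive the cut at `x` keep their meaning. -/
theorem interp_labUpTo {x : Node} (n : ℕ) (hn : Conv (node (lev n)))
    (hnx : rk (node (lev n)) ≤ rk x) : interp (labUpTo x) f n = interp labAll f n := by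
  induction n using Nat.strong_induction_on with
  | _ n ih =>
    rw [interp, interp]
    have h1 : lvl (labUpTo x) (lev n) = lvl labAll (lev n) := by
      simp [lvl, labUpTo, labAll, hn, hnx]
    rw [h1]
    congr
    funext y
    congr 2
    funext i
    rw [labLT_labUpTo, and_iff_left hnx]
    split_ifs with h
    · obtain ⟨h2, _, h3⟩ := labLT_labAll.1 h.2
      rw [ih _ h.1 h2 (h3.le.trans hnx)]
    · rfl

theorem envOf_labUpTo {x y : Node} (v : List ℕ) (hxy : rk y ≤ rk x) :
    envOf (labUpTo x) f (encode y) v = envOf labAll f (encode y) v := by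
  funext i
  rw [envOf, envOf, labLT_labUpTo, node_encode, and_iff_left hxy]
  split_ifs with h
  · obtain ⟨h2, _, h3⟩ := labLT_labAll.1 h
    rw [node_encode] at h3
    rw [interp_labUpTo _ h2 (h3.le.trans hxy)]
  · rfl

/-- The assignment given by a list of names does not depend on the bound for the labels. -/
theorem envOf_labAll_eq {x y : Node} (hy : Conv y) (hxy : rk x ≤ rk y) {v : List ℕ}
    (hv : ∀ z ∈ v, LabLT labAll (lev z) (encode x)) :
    envOf labAll f (encode y) v = envOf labAll f (encode x) v := by
  funext i
  rw [envOf, envOf]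
  by_cases hi : i < v.length
  · have h1 := hv _ (List.getElem_mem hi)
    rw [← List.getD_eq_getElem _ 0 hi] at h1
    rw [if_pos h1, if_pos]
    rw [labLT_labAll, node_encode] at h1 ⊢
    exact ⟨h1.1, hy, h1.2.2.trans_le hxy⟩
  · rw [List.getD_eq_default _ _ (not_lt.1 hi), if_neg (labAll_isInitial.not_labLT_zero _),
      if_neg (labAll_isInitial.not_labLT_zero _)]

theorem envOf_mem_L {x : Node} (hx : Conv x) {v : List ℕ} (i : ℕ) (a : ZFSet.{0})
    (ha : a ∈ envOf labAll f (encode x) v i) : a ∈ L f (rk x) := by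
  rw [envOf] at ha
  split_ifs at ha with h
  · rw [Option.mem_some_iff] at ha
    rw [← lvl_labAll hx]
    exact (mem_L_lvl_iff labAll_isInitial).2 ⟨_, h, ha⟩
  · exact absurd ha (Option.not_mem_none _)

end Labels

/-! ### Bounds that are valid almost everywhere -/

section Bounding

open Encodable
open scoped ENNReal

theorem analyticSet_isValid (lab : Labelling) (t : ℕ) :
    AnalyticSet {f | ∃ T, IsValid lab f T ∧ ¬ T t} := by
  have h1 : {f | ∃ T, IsValid lab f T ∧ ¬ T t} = Prod.fst ''
      {q : (ℕ → Bool) × (ℕ → ℕ) | ∀ n, Consistent (LabLT lab) t n (bits q.1) q.2} := by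
    ext f
    rw [Set.mem_ofPred_eq, ← exists_consistent_iff]
    simp
  rw [h1]
  have : PolishSpace ((ℕ → Bool) × (ℕ → ℕ)) := {}
  refine (IsClosed.analyticSet ?_).image_of_continuous continuous_fst
  have h2 : {q : (ℕ → Bool) × (ℕ → ℕ) | ∀ n, Consistent (LabLT lab) t n (bits q.1) q.2} =
      ⋂ n, {q | Consistent (LabLT lab) t n (bits q.1) q.2} := by
    ext q
    simp
  rw [h2]
  refine isClosed_iInter fun n => ?_
  have h3 : {q : (ℕ → Bool) × (ℕ → ℕ) | Consistent (LabLT lab) t n (bits q.1) q.2} =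
      (fun q (i : Fin n) => (q.1 i, q.2 i)) ⁻¹' {g | Consistent (LabLT lab) t n
        (fun i => if h : i < n then (g ⟨i, h⟩).1.toNat else 0)
        fun i => if h : i < n then (g ⟨i, h⟩).2 else 0} := by
    ext q
    rw [Set.mem_preimage, Set.mem_ofPred_eq, Set.mem_ofPred_eq]
    exact ⟨fun h => h.congr (fun i hi => by simp [hi, bits]) fun i hi => by simp [hi],
      fun h => h.congr (fun i hi => by simp [hi, bits]) fun i hi => by simp [hi]⟩
  rw [h3]
  exact (isClosed_discrete _).preimage (by fun_prop)

/-- The set of all `f` such that all elements `j ≤ N` of the level of `x₀` satisfy the formula `F`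
in the level of `x`, with parameters `u`. -/
def allSat (F : ℕ) (x₀ : Node) (u : List ℕ) (N : ℕ) (x : Node) : Set (ℕ → Bool) :=
  {f | ∀ j ≤ N, LabLT labAll (lev j) (encode x₀) →
    sat f (L f (rk x)) (fmDec F) (envOf labAll f (encode x₀) (j :: u))}

variable {F : ℕ} {x₀ : Node} {u : List ℕ}

theorem allSat_eq (hu : ∀ z ∈ u, LabLT labAll (lev z) (encode x₀)) (N : ℕ) {x : Node}
    (hx : Conv x) (hxx : rk x₀ ≤ rk x) : allSat F x₀ u N x =
      {f | ∃ T, IsValid (labUpTo x) f T ∧ ¬ T (kNAll N (encode x₀) (encode x) F u)} := by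
  ext f
  have key (T : ℕ → Prop) (hT : IsValid (labUpTo x) f T) :
      ¬ T (kNAll N (encode x₀) (encode x) F u) ↔ f ∈ allSat F x₀ u N x := by
    rw [hT.kNAll_iff (labUpTo_isInitial x) ⟨rk x, by simp [labUpTo, hx]⟩, allSat]
    simp only [lvl_labUpTo hx le_rfl, envOf_labUpTo _ le_rfl, labLT_labUpTo, node_encode,
      and_iff_left hxx, not_exists, not_and, not_not, Set.mem_ofPred_eq]
    refine forall₃_congr fun j _ hj => ?_
    rw [envOf_labAll_eq hx hxx]
    rintro z hz
    rcases List.mem_cons.1 hz with rfl | hz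
    exacts [hj, hu z hz]
  exact ⟨fun h => ⟨_, truth_isValid (labUpTo_isInitial x) f, (key _
    (truth_isValid (labUpTo_isInitial x) f)).2 h⟩, fun ⟨T, hT, h⟩ => (key T hT).1 h⟩

/-- The set and its complement are analytic, since validity determines the truth value. -/
theorem measurableSet_allSat (hu : ∀ z ∈ u, LabLT labAll (lev z) (encode x₀)) (N : ℕ)
    {x : Node} (hx : Conv x) (hxx : rk x₀ ≤ rk x) : MeasurableSet (allSat F x₀ u N x) := by
  have h1 := allSat_eq (F := F) hu N hx hxx
  refine AnalyticSet.measurableSet_of_compl (h1 ▸ analyticSet_isValid _ _) ?_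
  have h2 : (allSat F x₀ u N x)ᶜ = {f | ∃ T, IsValid (labUpTo x) f T ∧
      ¬ T (kNot (kNAll N (encode x₀) (encode x) F u))} := by
    ext f
    have hl := labUpTo_isInitial x
    have hb : ∃ β, labUpTo x (encode x) = some β := ⟨rk x, by simp [labUpTo, hx]⟩
    rw [h1, Set.mem_compl_iff, Set.mem_ofPred_eq, Set.mem_ofPred_eq]
    constructor
    · intro h
      have hT := truth_isValid hl f
      exact ⟨_, hT, fun h3 => h ⟨_, hT, (hT.not _).1 h3⟩⟩
    · rintro ⟨T, hT, h3⟩ ⟨T', hT', h4⟩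
      rw [hT.not, not_not, hT.kNAll_iff hl hb] at h3
      rw [hT'.kNAll_iff hl hb] at h4
      exact h4 h3
  rw [h2]
  exact analyticSet_isValid _ _

/-- The formula `F` is preserved when a level of the hierarchy is replaced by a larger one. -/
def Upward (F : Fm) : Prop := ∀ (f : ℕ → Bool) (α β : Ordinal.{0}) (ρ : Env), α ≤ β →
  (∀ i, ∀ a ∈ ρ i, a ∈ L f α) → sat f (L f α) F ρ → sat f (L f β) F ρ

theorem allSat_mono (hF : Upward (fmDec F)) (hx₀ : Conv x₀) (N : ℕ) {x y : Node}
    (hxx : rk x₀ ≤ rk x) (hxy : rk x ≤ rk y) : allSat F x₀ u N x ⊆ allSat F x₀ u N y :=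
  fun f hf j hj hj' => hF f _ _ _ hxy
    (fun i a ha => L_mono hxx (envOf_mem_L hx₀ i a ha)) (hf j hj hj')

/-- If all elements of a level satisfy an upward absolute formula in some level below `ω₁^S`, then
for almost all `f` a single level suffices. If `r` is less than the measure of the set `B` of all
`f` for which the hypothesis holds, then for each `N` some level meets the first `N` requirements
with measure more than `r`. This is decidable up to equality with `r`, so that by `exists_bound` one
level does for all `N`; by continuity of the measure it meets all requirements with measure `r` or
more. -/
theorem ae_exists_bound (hF : Upward (fmDec F)) (hx₀ : Conv x₀)
    (hu : ∀ z ∈ u, LabLT labAll (lev z) (encode x₀)) : ∀ᵐ f ∂cantorMeasure,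
    (∀ j, LabLT labAll (lev j) (encode x₀) → ∃ x, Conv x ∧ rk x₀ ≤ rk x ∧
      sat f (L f (rk x)) (fmDec F) (envOf labAll f (encode x₀) (j :: u))) →
    ∃ x, Conv x ∧ rk x₀ ≤ rk x ∧ ∀ j, LabLT labAll (lev j) (encode x₀) →
      sat f (L f (rk x)) (fmDec F) (envOf labAll f (encode x₀) (j :: u)) := by
  set B : Set (ℕ → Bool) := {f | ∀ j, LabLT labAll (lev j) (encode x₀) →
    ∃ x, Conv x ∧ rk x₀ ≤ rk x ∧
      sat f (L f (rk x)) (fmDec F) (envOf labAll f (encode x₀) (j :: u))} with hB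
  set B' : Set (ℕ → Bool) := {f | ∃ x, Conv x ∧ rk x₀ ≤ rk x ∧
    ∀ j, LabLT labAll (lev j) (encode x₀) →
      sat f (L f (rk x)) (fmDec F) (envOf labAll f (encode x₀) (j :: u))} with hB'
  have hBB : B' ⊆ B := fun f ⟨x, hx, hxx, h⟩ j hj => ⟨x, hx, hxx, h j hj⟩
  have hB'_eq : B' = ⋃ x : {x : Node // Conv x ∧ rk x₀ ≤ rk x}, ⋂ N, allSat F x₀ u N x.1 := by
    ext f
    rw [Set.mem_iUnion]
    constructor
    · rintro ⟨x, hx, hxx, h⟩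
      exact ⟨⟨x, hx, hxx⟩, Set.mem_iInter.2 fun N j _ hj => h j hj⟩
    · rintro ⟨⟨x, hx, hxx⟩, h⟩
      exact ⟨x, hx, hxx, fun j hj => Set.mem_iInter.1 h j j le_rfl hj⟩
  have hm : MeasurableSet B' := by
    rw [hB'_eq]
    exact .iUnion fun x => .iInter fun N => measurableSet_allSat hu N x.2.1 x.2.2
  -- every finite part of the requirement is met at some level
  have hBN (N : ℕ) : B ⊆ ⋃ x : {x : Node // Conv x ∧ rk x₀ ≤ rk x}, allSat F x₀ u N x.1 := by
    intro f hf
    rw [Set.mem_iUnion]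
    induction N with
    | zero =>
      by_cases h : LabLT labAll (lev 0) (encode x₀)
      · exact absurd h (labAll_isInitial.not_labLT_zero _)
      · exact ⟨⟨x₀, hx₀, le_rfl⟩, fun j hj hj' => absurd (Nat.le_zero.1 hj ▸ hj') h⟩
    | succ N ih =>
      obtain ⟨⟨x, hx, hxx⟩, h⟩ := ih
      by_cases hN : LabLT labAll (lev (N + 1)) (encode x₀)
      · obtain ⟨y, hy, hyy, h'⟩ := hf _ hN
        have key (z : Node) (hz : rk x ≤ rk z) (hz' : rk y ≤ rk z) :
            f ∈ allSat F x₀ u (N + 1) z := by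
          intro j hj hj'
          rcases Nat.le_succ_iff.1 hj with hj | rfl
          · exact allSat_mono hF hx₀ N hxx hz h j hj hj'
          · exact hF f _ _ _ hz' (fun i a ha => L_mono hyy (envOf_mem_L hx₀ i a ha)) h'
        rcases le_total (rk x) (rk y) with hxy | hxy
        · exact ⟨⟨y, hy, hyy⟩, key y hxy le_rfl⟩
        · exact ⟨⟨x, hx, hxx⟩, key x le_rfl hxy⟩
      · refine ⟨⟨x, hx, hxx⟩, fun j hj hj' => ?_⟩
        rcases Nat.le_succ_iff.1 hj with hj | rfl
        exacts [h j hj hj', absurd hj' hN]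
  have key (p d : ℕ) (hd : d ≠ 0) (hr : (p / d : ℝ≥0∞) < cantorMeasure B) :
      (p / d : ℝ≥0∞) ≤ cantorMeasure B' := by
    obtain ⟨Q, hQ, hQ₁, hQ₂⟩ := exists_decOn_measure_isValid (D := fun q : ℕ × Node => Conv q.2)
      (lab := fun q => labUpTo q.2) (t := fun q => kNAll q.1 (encode x₀) (encode q.2) F u)
      (decOn_labLT_labUpTo .snd fun _ => id)
      (primrec_kNAll .fst (.const _) (Primrec.encode.comp .snd) (.const _) (.const _)) p hd
    have hs : DecOn (fun q : ℕ × Node => Conv q.2) fun q => StageLE x₀ q.2 :=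
      (decOn_stageLE.comp (g := fun q : ℕ × Node => (x₀, q.2)) ((Primrec.const x₀).pair .snd)).mono
        (fun _ _ => Or.inl hx₀) fun _ _ => Iff.rfl
    obtain ⟨y, hy, hy'⟩ := exists_bound (hs.and (hQ.mono (fun _ h => h.1) fun _ _ => Iff.rfl))
      (fun N => by
        have h1 := hr.trans_le (measure_mono (hBN N))
        have hdir : Directed (· ⊆ ·) fun x : {x : Node // Conv x ∧ rk x₀ ≤ rk x} =>
            allSat F x₀ u N x.1 := by
          intro x y
          rcases le_total (rk x.1) (rk y.1) with h | h
          · exact ⟨y, allSat_mono hF hx₀ N x.2.2 h, subset_rfl⟩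
          · exact ⟨x, subset_rfl, allSat_mono hF hx₀ N y.2.2 h⟩
        rw [hdir.measure_iUnion, lt_iSup_iff] at h1
        obtain ⟨⟨x, hx, hxx⟩, h1⟩ := h1
        rw [allSat_eq hu N hx hxx] at h1
        exact ⟨x, hx, ⟨hx₀, fun _ => hxx⟩, hQ₂ (N, x) h1⟩)
    have hxy : rk x₀ ≤ rk y := by
      obtain ⟨x, hx, h1, h2, _⟩ := hy' 0
      exact (h2.2 hx).trans h1.le
    have h3 (N : ℕ) : (p / d : ℝ≥0∞) ≤ cantorMeasure (allSat F x₀ u N y) := by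
      obtain ⟨x, hx, h1, h2, h3⟩ := hy' N
      have h4 := hQ₁ (N, x) h3
      rw [← allSat_eq hu N hx (h2.2 hx)] at h4
      exact h4.trans (measure_mono (allSat_mono hF hx₀ N (h2.2 hx) h1.le))
    have h4 : Antitone fun N => allSat F x₀ u N y :=
      fun M N hMN f hf j hj hj' => hf j (hj.trans hMN) hj'
    rw [hB'_eq]
    refine le_trans ?_ (measure_mono (Set.subset_iUnion _ ⟨y, hy, hxy⟩))
    rw [h4.measure_iInter (fun N => (measurableSet_allSat hu N hy hxy).nullMeasurableSet)
      ⟨0, measure_ne_top _ _⟩]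
    exact le_iInf h3
  have hle : cantorMeasure B ≤ cantorMeasure B' := by
    refine le_of_forall_lt fun c hc => ?_
    obtain ⟨q, hq, hq', hq''⟩ := ENNReal.lt_iff_exists_rat_btwn.1 hc
    have h1 : ((Real.toNNReal q : NNReal) : ℝ≥0∞) = (q.num.toNat / q.den : ℝ≥0∞) := by
      have h2 : (q.num : ℝ) = (q.num.toNat : ℝ) := by
        exact_mod_cast (Int.toNat_of_nonneg (Rat.num_nonneg.2 hq)).symm
      have h3 : (q : ℝ) = ((q.num.toNat / q.den : NNReal) : ℝ) := by
        rw [Rat.cast_def, h2]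
        push_cast
        rfl
      rw [h3, Real.toNNReal_coe, ENNReal.coe_div (by simp)]
      simp
    rw [h1] at hq' hq''
    exact hq'.trans_le (key _ _ q.den_nz hq'')
  have h0 : cantorMeasure (B \ B') = 0 := by
    rw [measure_sdiff hBB hm.nullMeasurableSet (measure_ne_top _ _)]
    exact tsub_eq_zero_of_le hle
  filter_upwards [measure_eq_zero_iff_ae_notMem.1 h0] with f hf h
  by_contra h'
  exact hf ⟨h, h'⟩

end Bounding

/-! ### Kripke-Platek set theory in the level `ω₁^S` -/

section Admissible

open Encodable

variable {f : ℕ → Bool}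

theorem Conv.exists_rk_lt {x : Node} (hx : Conv x) : ∃ y, Conv y ∧ rk x < rk y := by
  obtain ⟨c, hc⟩ := hx.exists_comp
  have hy : Conv (idx [4, idx [2, 0], x.1], x.2) :=
    (Comp.comp _ _ _ _ _ hc (Comp.const 0 (c :: x.2))).conv
  exact ⟨_, hy, hy.rk_lt (sub_comp_left _ _ _)⟩

theorem mem_L_convSup {z : ZFSet.{0} } :
    z ∈ L f convSup ↔ ∃ x, Conv x ∧ z ∈ L f (rk x) := by
  constructor
  · intro hz
    obtain ⟨β, hβ, hz⟩ := mem_L.1 hz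
    obtain ⟨y, hy, rfl⟩ := lt_convSup_iff.1 hβ
    obtain ⟨x, hx, hyx⟩ := hy.exists_rk_lt
    exact ⟨x, hx, mem_L.2 ⟨_, hyx, hz⟩⟩
  · rintro ⟨x, hx, hz⟩
    exact L_mono (lt_convSup_iff.2 ⟨x, hx, rfl⟩).le hz

/-- Finitely many elements of the level `ω₁^S` belong to a single smaller level. -/
theorem exists_level (p : ℕ → ZFSet.{0}) (n : ℕ) (hp : ∀ i < n, p i ∈ L f convSup) :
    ∃ x, Conv x ∧ ∀ i < n, p i ∈ L f (rk x) := by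
  induction n with
  | zero => exact ⟨_, conv_trivNode, fun i hi => absurd hi (Nat.not_lt_zero i)⟩
  | succ n ih =>
    obtain ⟨x, hx, h⟩ := ih fun i hi => hp i (hi.trans n.lt_succ_self)
    obtain ⟨y, hy, h'⟩ := mem_L_convSup.1 (hp n n.lt_succ_self)
    have key (z : Node) (hxz : rk x ≤ rk z) (hyz : rk y ≤ rk z) :
        ∀ i < n + 1, p i ∈ L f (rk z) := by
      intro i hi
      rcases Nat.lt_succ_iff_lt_or_eq.1 hi with hi | rfl
      exacts [L_mono hxz (h i hi), L_mono hyz h']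
    rcases le_total (rk x) (rk y) with hxy | hxy
    · exact ⟨y, hy, key y hxy le_rfl⟩
    · exact ⟨x, hx, key x le_rfl hxy⟩

/-- The assignment of the values `p 0, …, p (n - 1)`. -/
def envList (p : ℕ → ZFSet.{0}) (n : ℕ) : Env := fun i => if i < n then some (p i) else none

theorem mem_of_mem_envList {p : ℕ → ZFSet.{0} } {n : ℕ} {X : ZFSet.{0} } (hp : ∀ i < n, p i ∈ X)
    (i : ℕ) (b : ZFSet.{0}) (hb : b ∈ envList p n i) : b ∈ X := by
  rw [envList] at hb
  split_ifs at hb with h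
  · exact Option.mem_some_iff.1 hb ▸ hp i h
  · exact absurd hb (Option.not_mem_none _)

theorem mem_of_mem_cons {z : ZFSet.{0} } {ρ : Env} {X : ZFSet.{0} } (hz : z ∈ X)
    (hρ : ∀ i, ∀ a ∈ ρ i, a ∈ X) : ∀ i, ∀ a ∈ Env.cons (some z) ρ i, a ∈ X
  | 0, _, ha => Option.mem_some_iff.1 ha ▸ hz
  | i + 1, a, ha => hρ i a ha

/-- A bound for the free variables of a formula. -/
theorem exists_freeVar_lt {n : ℕ} (φ : setLang.BoundedFormula ℕ n) :
    ∃ N, ∀ i ∈ φ.freeVarFinset, i < N :=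
  ⟨φ.freeVarFinset.sup id + 1, fun _ hi => Nat.lt_succ_of_le (Finset.le_sup (f := id) hi)⟩

/-- The formula stating that, if the variable `0` is an element of the variable `N + 1`, then
`∃ y, φ`. -/
def collectFm (φ : setLang.BoundedFormula ℕ 2) (N : ℕ) : Fm :=
  (Fm.mem 0 (N + 1)).imp (Fm.nall (toFm id φ).not)

theorem sat_collectFm {φ : setLang.BoundedFormula ℕ 2} {N : ℕ} {X : ZFSet.{0} } {ρ : Env} :
    sat f X (collectFm φ N) ρ ↔ ((∃ a ∈ ρ 0, ∃ b ∈ ρ (N + 1), a ∈ b) →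
      ∃ y ∈ X, sat f X (toFm id φ) (Env.cons (some y) ρ)) := by
  rw [collectFm, sat_imp, sat, sat]
  simp only [sat_not, not_not]

theorem upward_collectFm {φ : setLang.BoundedFormula ℕ 2} (hφ : IsDelta0 φ) (N : ℕ) :
    Upward (collectFm φ N) := by
  intro f α β ρ hαβ hρ h
  rw [sat_collectFm] at h ⊢
  intro h'
  obtain ⟨y, hy, h⟩ := h h'
  exact ⟨y, L_mono hαβ hy,
    (hφ.sat_iff (L_mono hαβ) (fun _ hx _ => L_trans hx) (mem_of_mem_cons hy hρ)).1 h⟩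

/-- `Δ₀` separation: by absoluteness, the set is definable over a level that contains the
parameters. -/
theorem delta0_separation_L (φ : setLang.BoundedFormula ℕ 1) (hφ : IsDelta0 φ)
    (p : ℕ → Carrier f (L f convSup)) (a : Carrier f (L f convSup)) :
    ∃ b : Carrier f (L f convSup), ∀ x : Carrier f (L f convSup),
      x.1 ∈ b.1 ↔ x.1 ∈ a.1 ∧ φ.Realize p ![x] := by
  obtain ⟨N, hN⟩ := exists_freeVar_lt φ
  let q (i : ℕ) : ZFSet.{0} := if i < N then (p i).1 else a.1
  have hq₀ (i : ℕ) (hi : i < N) : q i = (p i).1 := if_pos hi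
  have hq₁ : q N = a.1 := if_neg (lt_irrefl N)
  obtain ⟨y, hy, hyq⟩ := exists_level (f := f) q (N + 1) fun i _ => by
    by_cases hi : i < N
    · exact hq₀ i hi ▸ (p i).2
    · have hqi : q i = a.1 := if_neg hi
      exact hqi ▸ a.2
  have hyκ := lt_convSup_iff.2 ⟨y, hy, rfl⟩
  let F : Fm := ((Fm.mem 0 (N + 1)).imp (toFm id φ).not).not
  have hF (z : ZFSet.{0}) : sat f (L f (rk y)) F (Env.cons (some z) (envList q (N + 1))) ↔
      z ∈ a.1 ∧ sat f (L f (rk y)) (toFm id φ) (Env.cons (some z) (envList q (N + 1))) := by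
    simp only [F, sat_not, sat_imp, Classical.not_imp, not_not, sat]
    simp [envList, hq₁]
  refine ⟨⟨_, mem_L.2 ⟨rk y, hyκ, sep_sat_mem_defPow F (envList q (N + 1))
    (mem_of_mem_envList hyq)⟩⟩, fun x => ?_⟩
  rw [ZFSet.mem_sep, hF]
  have h1 : sat f (L f convSup) (toFm id φ) (Env.cons (some x.1) (envList q (N + 1))) ↔
      φ.Realize p ![x] := by
    refine sat_toFm φ (fun i hi => ?_) (fun k => ?_)
    · have hi := hN i hi
      rw [Nat.add_comm 1, Env.cons_succ, envList, id, if_pos (hi.trans N.lt_succ_self), hq₀ i hi]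
    · rw [Subsingleton.elim k 0]
      rfl
  have h2 (hx : x.1 ∈ L f (rk y)) := hφ.sat_iff (g := id) (f := f) (L_mono hyκ.le)
    (fun _ hx _ => L_trans hx) (mem_of_mem_cons hx (mem_of_mem_envList hyq))
  constructor
  · rintro ⟨hx, hxa, h⟩
    exact ⟨hxa, h1.1 ((h2 hx).1 h)⟩
  · rintro ⟨hxa, h⟩
    have hx : x.1 ∈ L f (rk y) := L_trans (hq₁ ▸ hyq N N.lt_succ_self) hxa
    exact ⟨hx, hxa, (h2 hx).2 (h1.2 h)⟩

/-- Bounds for upward absolute formulas exist in the hierarchy relative to `f`. -/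
def HasBounds (f : ℕ → Bool) : Prop := ∀ (F : ℕ) (x₀ : Node) (u : List ℕ), Upward (fmDec F) →
  Conv x₀ → (∀ z ∈ u, LabLT labAll (lev z) (encode x₀)) →
    (∀ j, LabLT labAll (lev j) (encode x₀) → ∃ x, Conv x ∧ rk x₀ ≤ rk x ∧
      sat f (L f (rk x)) (fmDec F) (envOf labAll f (encode x₀) (j :: u))) →
    ∃ x, Conv x ∧ rk x₀ ≤ rk x ∧ ∀ j, LabLT labAll (lev j) (encode x₀) →
      sat f (L f (rk x)) (fmDec F) (envOf labAll f (encode x₀) (j :: u))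

theorem ae_hasBounds : ∀ᵐ f ∂cantorMeasure, HasBounds f :=
  ae_all_iff.2 fun _ => ae_all_iff.2 fun _ => ae_all_iff.2 fun _ => ae_all_iff.2 fun hF =>
    ae_all_iff.2 fun hx₀ => ae_all_iff.2 fun hu => ae_exists_bound hF hx₀ hu

/-- `Δ₀` collection: the bound for the formula `collectFm φ N` is a level that contains the values
sought. -/
theorem delta0_collection_L (hf : HasBounds f) (φ : setLang.BoundedFormula ℕ 2) (hφ : IsDelta0 φ)
    (p : ℕ → Carrier f (L f convSup)) (a : Carrier f (L f convSup))
    (h : ∀ x : Carrier f (L f convSup), x.1 ∈ a.1 →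
      ∃ y : Carrier f (L f convSup), φ.Realize p ![x, y]) :
    ∃ b : Carrier f (L f convSup), ∀ x : Carrier f (L f convSup), x.1 ∈ a.1 →
      ∃ y : Carrier f (L f convSup), y.1 ∈ b.1 ∧ φ.Realize p ![x, y] := by
  obtain ⟨N, hN⟩ := exists_freeVar_lt φ
  let q (i : ℕ) : ZFSet.{0} := if i < N then (p i).1 else a.1
  have hq₀ (i : ℕ) (hi : i < N) : q i = (p i).1 := if_pos hi
  have hq₁ : q N = a.1 := if_neg (lt_irrefl N)
  obtain ⟨x₀, hx₀, hxq⟩ := exists_level (f := f) q (N + 1) fun i _ => by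
    by_cases hi : i < N
    · exact hq₀ i hi ▸ (p i).2
    · have hqi : q i = a.1 := if_neg hi
      exact hqi ▸ a.2
  have hxa : a.1 ∈ L f (rk x₀) := hq₁ ▸ hxq N N.lt_succ_self
  -- names for the parameters
  have hname (z : ZFSet.{0}) (hz : z ∈ L f (rk x₀)) :
      ∃ n, LabLT labAll (lev n) (encode x₀) ∧ interp labAll f n = z := by
    rw [← lvl_labAll hx₀] at hz
    exact (mem_L_lvl_iff labAll_isInitial).1 hz
  have hnames (i : ℕ) : ∃ n, i < N + 1 → LabLT labAll (lev n) (encode x₀) ∧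
      interp labAll f n = q i := by
    by_cases hi : i < N + 1
    · obtain ⟨n, hn⟩ := hname _ (hxq i hi)
      exact ⟨n, fun _ => hn⟩
    · exact ⟨0, fun h => absurd h hi⟩
  choose u hu using hnames
  have henv : envOf labAll f (encode x₀) (seq u (N + 1)) = envList q (N + 1) := by
    funext i
    rw [envOf, envList]
    by_cases hi : i < N + 1
    · rw [getD_seq _ hi, if_pos (hu i hi).1, if_pos hi, (hu i hi).2]
    · rw [List.getD_eq_default _ _ (by simpa using hi),
        if_neg (labAll_isInitial.not_labLT_zero _), if_neg hi]
  obtain ⟨F, hF⟩ := exists_fmDec_eq (collectFm φ N)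
  have key (x y : Carrier f (L f convSup)) : sat f (L f convSup) (toFm id φ)
      (Env.cons (some y.1) (Env.cons (some x.1) (envList q (N + 1)))) ↔ φ.Realize p ![x, y] := by
    refine sat_toFm φ (fun i hi => ?_) (fun k => ?_)
    · have hi := hN i hi
      rw [Nat.add_comm 2, Env.cons_succ, Env.cons_succ, envList, id,
        if_pos (hi.trans N.lt_succ_self), hq₀ i hi]
    · fin_cases k <;> rfl
  have key' (x y : Carrier f (L f convSup)) (z : Node) (hz : Conv z) (hxz : rk x₀ ≤ rk z)
      (hx : x.1 ∈ L f (rk z)) (hy : y.1 ∈ L f (rk z)) : sat f (L f (rk z)) (toFm id φ)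
      (Env.cons (some y.1) (Env.cons (some x.1) (envList q (N + 1)))) ↔ φ.Realize p ![x, y] := by
    rw [← key]
    exact hφ.sat_iff (L_mono (lt_convSup_iff.2 ⟨z, hz, rfl⟩).le) (fun _ hx _ => L_trans hx)
      (mem_of_mem_cons hy (mem_of_mem_cons hx (mem_of_mem_envList fun i hi =>
        L_mono hxz (hxq i hi))))
  have hsat (z : Node) (j : ℕ) (hj : LabLT labAll (lev j) (encode x₀)) :
      sat f (L f (rk z)) (fmDec F) (envOf labAll f (encode x₀) (j :: seq u (N + 1))) ↔
        (interp labAll f j ∈ a.1 → ∃ y ∈ L f (rk z), sat f (L f (rk z)) (toFm id φ)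
          (Env.cons (some y) (Env.cons (some (interp labAll f j)) (envList q (N + 1))))) := by
    rw [hF, sat_collectFm, envOf_cons _ hj, henv]
    simp [envList, hq₁]
  have hκ {z : Node} {w : ZFSet.{0} } (hz : Conv z) (hw : w ∈ L f (rk z)) : w ∈ L f convSup :=
    mem_L_convSup.2 ⟨z, hz, hw⟩
  obtain ⟨z, hz, hxz, hall⟩ := hf F x₀ (seq u (N + 1)) (hF ▸ upward_collectFm hφ N) hx₀ (by
      intro n hn
      obtain ⟨i, hi, rfl⟩ := List.mem_map.1 hn
      exact (hu i (List.mem_range.1 hi)).1) (by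
    intro j hj
    by_cases hja : interp labAll f j ∈ a.1
    · have hjx : interp labAll f j ∈ L f (rk x₀) := L_trans hxa hja
      obtain ⟨y, hy⟩ := h ⟨_, hκ hx₀ hjx⟩ hja
      obtain ⟨z, hz, hyz⟩ := mem_L_convSup.1 y.2
      have key'' (w : Node) (hw : Conv w) (hxw : rk x₀ ≤ rk w) (hzw : rk z ≤ rk w) :
          sat f (L f (rk w)) (fmDec F) (envOf labAll f (encode x₀) (j :: seq u (N + 1))) :=
        (hsat w j hj).2 fun _ => ⟨y.1, L_mono hzw hyz, (key' ⟨_, hκ hx₀ hjx⟩ y w hw hxw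
          (L_mono hxw hjx) (L_mono hzw hyz)).2 hy⟩
      rcases le_total (rk x₀) (rk z) with hxz | hxz
      · exact ⟨z, hz, hxz, key'' z hz hxz le_rfl⟩
      · exact ⟨x₀, hx₀, le_rfl, key'' x₀ hx₀ le_rfl hxz⟩
    · exact ⟨x₀, hx₀, le_rfl, (hsat x₀ j hj).2 fun h => absurd h hja⟩)
  refine ⟨⟨L f (rk z), L_mem_L (lt_convSup_iff.2 ⟨z, hz, rfl⟩)⟩, fun x hx => ?_⟩
  have hxx : x.1 ∈ L f (rk x₀) := L_trans hxa hx
  obtain ⟨j, hj, hjx⟩ := hname _ hxx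
  obtain ⟨y, hy, hy'⟩ := (hsat z j hj).1 (hall j hj) (hjx ▸ hx)
  rw [hjx] at hy'
  exact ⟨⟨y, hκ hz hy⟩, hy, (key' x ⟨y, hκ hz hy⟩ z hz hxz (L_mono hxz hxx) hy).1 hy'⟩

theorem isAdmissible_of_hasBounds (hf : HasBounds f) : IsAdmissible f omegaOneS := by
  rw [omegaOneS_eq]
  exact
  { nonempty := ⟨⟨_, L_mem_L (lt_convSup_iff.2 ⟨_, conv_trivNode, rfl⟩)⟩⟩
    extensionality := fun a b h => Subtype.ext <| ZFSet.ext fun z =>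
      ⟨fun hz => (h ⟨z, L_trans a.2 hz⟩).1 hz, fun hz => (h ⟨z, L_trans b.2 hz⟩).2 hz⟩
    foundation := fun φ p h => by
      have hwf : WellFounded fun x y : Carrier f (L f convSup) => x.1 ∈ y.1 :=
        InvImage.wf (fun x : Carrier f (L f convSup) => x.1) ZFSet.mem_wf
      obtain ⟨x, hx, hx'⟩ := hwf.has_min {x | φ.Realize p ![x]} h
      exact ⟨x, hx, fun y hy hy' => hx' y hy' hy⟩
    pairing := fun a b => by
      obtain ⟨x, hx, h⟩ := exists_level (f := f) (fun i => if i = 0 then a.1 else b.1) 2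
        fun i _ => by split_ifs; exacts [a.2, b.2]
      exact ⟨⟨_, L_mem_L (lt_convSup_iff.2 ⟨x, hx, rfl⟩)⟩, h 0 (by norm_num), h 1 (by norm_num)⟩
    union := fun a => by
      obtain ⟨x, hx, h⟩ := mem_L_convSup.1 a.2
      exact ⟨⟨_, L_mem_L (lt_convSup_iff.2 ⟨x, hx, rfl⟩)⟩,
        fun b hb y hy => L_trans (L_trans h hb) hy⟩
    delta0_separation := delta0_separation_L
    delta0_replacement := delta0_collection_L hf }

end Admissible

end SuslinFunctional

theorem mainTheorem8 :
    NullMeasurableSet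
        {f : ℕ → Bool | SuslinFunctional.IsAdmissible f SuslinFunctional.omegaOneS}
        SuslinFunctional.cantorMeasure ∧
      SuslinFunctional.cantorMeasure
        {f : ℕ → Bool | SuslinFunctional.IsAdmissible f SuslinFunctional.omegaOneS} = 1 := by
  have h : {f : ℕ → Bool | SuslinFunctional.IsAdmissible f SuslinFunctional.omegaOneS}
      =ᵐ[SuslinFunctional.cantorMeasure] Set.univ :=
    Filter.eventuallyEq_univ.2 (SuslinFunctional.ae_hasBounds.mono fun _ hf =>
      SuslinFunctional.isAdmissible_of_hasBounds hf)
  exact ⟨nullMeasurableSet_univ.congr h.symm, (measure_congr h).trans measure_univ⟩
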